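/- Conventions. Let $X$ be a compact Hausdorff space, $Y\subset X$ a closed subspace and $I=[0,1]$. Vector bundles are complex, of finite (locally constant) rank. $K(X)$ is the Grothendieck group of vector bundles on $X$. $K(X,Y)$ is the abelian group generated by triples $(E^0,E^1,\alpha)$, where $E^0,E^1$ are vector bundles on $X$ and $\alpha:E^0|_Y\to E^1|_Y$ is an isomorphism, with the relations: isomorphic triples are equal, $[T\oplus T']=[T]+[T']$, and $[P,P,\mathrm{id}]=0$. For $U\subset X$ open, $\mathcal{HF}(U)$ has as objects the pairs $(E,h)$ of a $\mathbb Z_2$-graded Hermitian vector bundle $E=E^0\oplus E^1$ on $U$ and a Hermitian bundle map $h:E\to E$ of degree $1$, with components $h_{10}:E^0\to E^1$ and $h_{01}=h_{10}^*$. Put $(E,h)_{y,<\mu}=\bigoplus_{\lambda<\mu}\ker(h_y^2-\lambda)$. Homomorphisms $(E,h)\to(E',h')$ are degree $0$ bundle maps $\phi$ with $\phi h=h'\phi$, where $\phi,\phi'$ are identified if every $x\in U$ has an open neighbourhood $V\subset U$ and a $\mu>0$ such that $\phi=\phi'$ on $(E,h)_{y,<\mu}$ for all $y\in V$. A vectorial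 bundle $\mathbb E$ on a space consists of an open cover $\{U_\alpha\}$, objects $(E_\alpha,h_\alpha)$ of $\mathcal{HF}(U_\alpha)$ and homomorphisms $\phi_{\alpha\beta}:(E_\beta,h_\beta)\to(E_\alpha,h_\alpha)$ in $\mathcal{HF}(U_\alpha\cap U_\beta)$ with $\phi_{\alpha\beta}\phi_{\beta\alpha}=1$ in $\mathcal{HF}(U_\alpha\cap U_\beta)$ and $\phi_{\alpha\beta}\phi_{\beta\gamma}=\phi_{\alpha\gamma}$ in $\mathcal{HF}(U_\alpha\cap U_\beta\cap U_\gamma)$. A homomorphism $\mathbb E'\to\mathbb E$ is a family $\psi_{\alpha\alpha'}:(E'_{\alpha'},h'_{\alpha'})\to(E_\alpha,h_\alpha)$ in $\mathcal{HF}(U_\alpha\cap U'_{\alpha'})$ with $\psi_{\alpha\alpha'}\phi'_{\alpha'\beta'}=\psi_{\alpha\beta'}$ and $\phi_{\alpha\beta}\psi_{\beta\beta'}=\psi_{\alpha\beta'}$ on triple intersections; it is an isomorphism if there is a homomorphism $\chi:\mathbb E\to\mathbb E'$ with $\chi_{\alpha'\alpha}\psi_{\alpha\beta'}=\phi'_{\alpha'\beta'}$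 and $\psi_{\alpha\alpha'}\chi_{\alpha'\beta}=\phi_{\alpha\beta}$ on triple intersections. The support $\mathrm{Supp}\,\mathbb E$ is the closure of the set of points $x$ at which $(h_\alpha)_x$ is not invertible for some $\alpha$ with $x\in U_\alpha$. $KF(X,Y)$ is the set of homotopy classes of vectorial bundles $\mathbb E$ on $X$ with $\mathrm{Supp}\,\mathbb E\cap Y=\emptyset$, where a homotopy between $\mathbb E_0$ and $\mathbb E_1$ is a vectorial bundle $\tilde{\mathbb E}$ on $X\times I$ with $\mathrm{Supp}\,\tilde{\mathbb E}\cap(Y\times I)=\emptyset$ and $\tilde{\mathbb E}|_{X\times\{i\}}\cong\mathbb E_i$ for $i=0,1$. Addition in $KF(X,Y)$ is the direct sum. Put $KF(X)=KF(X,\emptyset)$. Theorem (Furuta). (1) There is a unique isomorphism $\Phi:K(X,Y)\to KF(X,Y)$ such that for every $\mathbb Z_2$-graded Hermitian vector bundle $E=E^0\oplus E^1$ on $X$ and every Hermitian bundle map $h:E\to E$ of degree $1$ such that the vectorial bundle $(E,h)$ (with open cover $\{X\}$) has support disjoint from $Y$, one has $\Phi[E^0,E^1,h_{10}|_Y]=[(E,h)]$.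 (2) There is a unique isomorphism $\Phi:K(X)\to KF(X)$ such that $\Phi([E^0]-[E^1])=[(E^0\oplus E^1,0)]$ for all Hermitian vector bundles $E^0,E^1$ on $X$. -/

import Mathlib

open Set Topology

universe u

/-! ### Complex vector bundles of finite (locally constant) rank -/

/-- A linear local trivialization, over an open set `dom`, of a family of complex vector spaces
`Fib x`, with a finite-dimensional model space.  Over `dom` the linear maps `coord x` and `lift x`
are mutually inverse; outside `dom` their values are irrelevant. -/
structure LocalTriv {X : Type u} [TopologicalSpace X] (Fib : X → Type)
    [∀ x, AddCommGroup (Fib x)] [∀ x, Module ℂ (Fib x)] where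
  Model : Type
  [normed : NormedAddCommGroup Model]
  [space : NormedSpace ℂ Model]
  [finDim : FiniteDimensional ℂ Model]
  dom : Set X
  isOpen_dom : IsOpen dom
  coord : ∀ x, Fib x →ₗ[ℂ] Model
  lift : ∀ x, Model →ₗ[ℂ] Fib x
  coord_lift : ∀ x ∈ dom, ∀ v, coord x (lift x v) = v
  lift_coord : ∀ x ∈ dom, ∀ v, lift x (coord x v) = v

attribute [instance] LocalTriv.normed LocalTriv.space LocalTriv.finDim

/-- A complex vector bundle of finite rank over the subset `U` of `X`: a family of complex vector
spaces with an atlas of local trivializations covering `U` whose transition functions are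
continuous.  The rank is locally constant (it may differ on different components).  The fibres are
indexed by all points of `X` for convenience; those outside `U` are irrelevant. -/
structure CBundle {X : Type u} [TopologicalSpace X] (U : Set X) where
  Fib : X → Type
  [addCommGroup : ∀ x, AddCommGroup (Fib x)]
  [module : ∀ x, Module ℂ (Fib x)]
  Idx : Type u
  chart : Idx → LocalTriv Fib
  cover : ∀ x ∈ U, ∃ a, x ∈ (chart a).dom
  compat : ∀ a b, ∀ v : (chart a).Model,
    ContinuousOn (fun x => (chart b).coord x ((chart a).lift x v))
      ((chart a).dom ∩ (chart b).dom ∩ U)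

attribute [instance] CBundle.addCommGroup CBundle.module

/-- A family of linear maps between the fibres of two bundles is continuous over `W` (a subset of
both bases), i.e. it is a bundle map over `W`: its matrices in the charts are continuous. -/
def CBundle.ContMap {X : Type u} [TopologicalSpace X] {U V : Set X} (E : CBundle U) (F : CBundle V)
    (W : Set X) (f : ∀ x, E.Fib x →ₗ[ℂ] F.Fib x) : Prop :=
  ∀ a b, ∀ v : (E.chart a).Model,
    ContinuousOn (fun x => (F.chart b).coord x (f x ((E.chart a).lift x v)))
      ((E.chart a).dom ∩ (F.chart b).dom ∩ W)

/-- Pullback of local trivializations. -/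
def LocalTriv.comap {X X' : Type u} [TopologicalSpace X] [TopologicalSpace X'] {Fib : X → Type}
    [∀ x, AddCommGroup (Fib x)] [∀ x, Module ℂ (Fib x)] (e : LocalTriv Fib) (f : C(X', X)) :
    LocalTriv (fun x' => Fib (f x')) where
  Model := e.Model
  dom := f ⁻¹' e.dom
  isOpen_dom := e.isOpen_dom.preimage f.continuous
  coord x' := e.coord (f x')
  lift x' := e.lift (f x')
  coord_lift x' hx := e.coord_lift (f x') hx
  lift_coord x' hx := e.lift_coord (f x') hx

/-- Pullback of vector bundles along a continuous map. -/
def CBundle.comap {X X' : Type u} [TopologicalSpace X] [TopologicalSpace X'] {U : Set X}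
    (E : CBundle U) (f : C(X', X)) : CBundle (f ⁻¹' U) where
  Fib x' := E.Fib (f x')
  Idx := E.Idx
  chart a := (E.chart a).comap f
  cover x' hx := E.cover (f x') hx
  compat a b v := (E.compat a b v).comp f.continuous.continuousOn (fun _ hx => hx)

theorem CBundle.ContMap.comap {X X' : Type u} [TopologicalSpace X] [TopologicalSpace X']
    {U V W : Set X} {E : CBundle U} {F : CBundle V} {g : ∀ x, E.Fib x →ₗ[ℂ] F.Fib x}
    (h : E.ContMap F W g) (f : C(X', X)) :
    (E.comap f).ContMap (F.comap f) (f ⁻¹' W) (fun x' => g (f x')) :=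
  fun a b v => (h a b v).comp f.continuous.continuousOn (fun _ hx => hx)

theorem CBundle.ContMap.mono {X : Type u} [TopologicalSpace X]
    {U V W W' : Set X} {E : CBundle U} {F : CBundle V} {g : ∀ x, E.Fib x →ₗ[ℂ] F.Fib x}
    (h : E.ContMap F W g) (hW : W' ⊆ W) : E.ContMap F W' g :=
  fun a b v => (h a b v).mono (inter_subset_inter_right _ hW)

/-- Direct sum of local trivializations. -/
noncomputable def LocalTriv.sum {X : Type u} [TopologicalSpace X] {Fib Fib' : X → Type}
    [∀ x, AddCommGroup (Fib x)] [∀ x, Module ℂ (Fib x)]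
    [∀ x, AddCommGroup (Fib' x)] [∀ x, Module ℂ (Fib' x)]
    (e : LocalTriv Fib) (e' : LocalTriv Fib') : LocalTriv (fun x => Fib x × Fib' x) where
  Model := e.Model × e'.Model
  dom := e.dom ∩ e'.dom
  isOpen_dom := e.isOpen_dom.inter e'.isOpen_dom
  coord x := (e.coord x).prodMap (e'.coord x)
  lift x := (e.lift x).prodMap (e'.lift x)
  coord_lift x hx v := Prod.ext (e.coord_lift x hx.1 v.1) (e'.coord_lift x hx.2 v.2)
  lift_coord x hx v := Prod.ext (e.lift_coord x hx.1 v.1) (e'.lift_coord x hx.2 v.2)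

/-- Direct sum of vector bundles; its natural base is the intersection of the bases. -/
noncomputable def CBundle.sum {X : Type u} [TopologicalSpace X] {U V : Set X} (E : CBundle U) (F : CBundle V) :
    CBundle (U ∩ V) where
  Fib x := E.Fib x × F.Fib x
  Idx := E.Idx × F.Idx
  chart a := (E.chart a.1).sum (F.chart a.2)
  cover x hx := by
    obtain ⟨a, ha⟩ := E.cover x hx.1
    obtain ⟨b, hb⟩ := F.cover x hx.2
    exact ⟨(a, b), ha, hb⟩
  compat a b v :=
    ((E.compat a.1 b.1 v.1).mono fun _ hx => ⟨⟨hx.1.1.1, hx.1.2.1⟩, hx.2.1⟩).prodMk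
      ((F.compat a.2 b.2 v.2).mono fun _ hx => ⟨⟨hx.1.1.2, hx.1.2.2⟩, hx.2.2⟩)

theorem CBundle.ContMap.sum {X : Type u} [TopologicalSpace X]
    {U V U' V' W W' : Set X} {E : CBundle U} {F : CBundle V} {E' : CBundle U'} {F' : CBundle V'}
    {g : ∀ x, E.Fib x →ₗ[ℂ] F.Fib x} {g' : ∀ x, E'.Fib x →ₗ[ℂ] F'.Fib x}
    (h : E.ContMap F W g) (h' : E'.ContMap F' W' g') :
    (E.sum E').ContMap (F.sum F') (W ∩ W') (fun x => (g x).prodMap (g' x)) :=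
  fun a b v =>
    ((h a.1 b.1 v.1).mono fun _ hx => ⟨⟨hx.1.1.1, hx.1.2.1⟩, hx.2.1⟩).prodMk
      ((h' a.2 b.2 v.2).mono fun _ hx => ⟨⟨hx.1.1.2, hx.1.2.2⟩, hx.2.2⟩)

theorem CBundle.contMap_id {X : Type u} [TopologicalSpace X] {U W : Set X} (E : CBundle U)
    (hW : W ⊆ U) : E.ContMap E W (fun _ => LinearMap.id) :=
  fun a b v => (E.compat a b v).mono (inter_subset_inter_right _ hW)

/-- Regard a bundle over `U` as a bundle over a smaller subset `V`. -/
def CBundle.restrict {X : Type u} [TopologicalSpace X] {U V : Set X} (E : CBundle U)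
    (h : V ⊆ U) : CBundle V where
  Fib := E.Fib
  Idx := E.Idx
  chart := E.chart
  cover x hx := E.cover x (h hx)
  compat a b v := (E.compat a b v).mono (inter_subset_inter_right _ h)

/-- Direct sum of vector bundles over the whole space. -/
noncomputable def CBundle.gsum {X : Type u} [TopologicalSpace X] (E F : CBundle (univ : Set X)) :
    CBundle (univ : Set X) :=
  (E.sum F).restrict (fun _ _ => ⟨trivial, trivial⟩)

/-- `f` and `g` are mutually inverse isomorphisms of vector bundles over the whole space. -/
structure CBundle.IsoPair {X : Type u} [TopologicalSpace X] (E F : CBundle (univ : Set X))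
    (f : ∀ x, E.Fib x →ₗ[ℂ] F.Fib x) (g : ∀ x, F.Fib x →ₗ[ℂ] E.Fib x) : Prop where
  cont_to : E.ContMap F univ f
  cont_inv : F.ContMap E univ g
  left_inv : ∀ x v, g x (f x v) = v
  right_inv : ∀ x v, f x (g x v) = v

/-! ### The K-groups `K(X)` and `K(X, Y)` formulated by vector bundles -/

/-- The relations of the Grothendieck group `K(X)`: isomorphic bundles are identified, and the
addition is the direct sum. -/
inductive KGroup.Rel {X : Type u} [TopologicalSpace X] :
    FreeAbelianGroup (CBundle (univ : Set X)) → Prop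
  | iso (E F : CBundle (univ : Set X)) (h : ∃ f g, E.IsoPair F f g) :
      KGroup.Rel (FreeAbelianGroup.of E - FreeAbelianGroup.of F)
  | sum (E F : CBundle (univ : Set X)) :
      KGroup.Rel
        (FreeAbelianGroup.of (E.gsum F) - (FreeAbelianGroup.of E + FreeAbelianGroup.of F))

/-- `K(X)`: the Grothendieck group of complex vector bundles over `X`. -/
abbrev KGroup (X : Type u) [TopologicalSpace X] :=
  FreeAbelianGroup (CBundle (univ : Set X)) ⧸
    AddSubgroup.closure {z : FreeAbelianGroup (CBundle (univ : Set X)) | KGroup.Rel z}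

/-- The class `[E]` in `K(X)`. -/
def KGroup.mk {X : Type u} [TopologicalSpace X] (E : CBundle (univ : Set X)) : KGroup X :=
  QuotientAddGroup.mk (FreeAbelianGroup.of E)

/-- A triple `(E⁰, E¹, α)`: vector bundles `E⁰, E¹` over `X` and an isomorphism
`α : E⁰|_Y → E¹|_Y` (values of `α` outside `Y` are irrelevant; the inverse of a continuous
fibrewise bijective map of vector bundles is automatically continuous). -/
structure KTriple {X : Type u} [TopologicalSpace X] (Y : Set X) where
  E₀ : CBundle (univ : Set X)
  E₁ : CBundle (univ : Set X)
  α : ∀ x, E₀.Fib x →ₗ[ℂ] E₁.Fib x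
  cont : E₀.ContMap E₁ Y α
  bij : ∀ x ∈ Y, Function.Bijective (α x)

/-- Isomorphism of triples: isomorphisms of the bundles over `X` intertwining the given
isomorphisms over `Y`. -/
def KTriple.Iso {X : Type u} [TopologicalSpace X] {Y : Set X} (S T : KTriple Y) : Prop :=
  ∃ f₀ g₀ f₁ g₁, S.E₀.IsoPair T.E₀ f₀ g₀ ∧ S.E₁.IsoPair T.E₁ f₁ g₁ ∧
    ∀ x ∈ Y, ∀ v, f₁ x (S.α x v) = T.α x (f₀ x v)

/-- Direct sum of triples. -/
noncomputable def KTriple.sum {X : Type u} [TopologicalSpace X] {Y : Set X} (S T : KTriple Y) : KTriple Y where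
  E₀ := S.E₀.gsum T.E₀
  E₁ := S.E₁.gsum T.E₁
  α x := (S.α x).prodMap (T.α x)
  cont := (S.cont.sum T.cont).mono (fun _ hx => ⟨hx, hx⟩)
  bij x hx := (S.bij x hx).prodMap (T.bij x hx)

/-- The elementary triple `(P, P, id)`. -/
def KTriple.elem {X : Type u} [TopologicalSpace X] (Y : Set X) (P : CBundle (univ : Set X)) :
    KTriple Y where
  E₀ := P
  E₁ := P
  α _ := LinearMap.id
  cont := P.contMap_id (subset_univ Y)
  bij _ _ := Function.bijective_id

/-- The relations of `K(X, Y)`: isomorphic triples are identified, the addition is the direct sum,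
and elementary triples are zero. -/
inductive RelKGroup.Rel {X : Type u} [TopologicalSpace X] {Y : Set X} :
    FreeAbelianGroup (KTriple Y) → Prop
  | iso (S T : KTriple Y) (h : S.Iso T) :
      RelKGroup.Rel (FreeAbelianGroup.of S - FreeAbelianGroup.of T)
  | sum (S T : KTriple Y) :
      RelKGroup.Rel
        (FreeAbelianGroup.of (S.sum T) - (FreeAbelianGroup.of S + FreeAbelianGroup.of T))
  | elem (P : CBundle (univ : Set X)) :
      RelKGroup.Rel (FreeAbelianGroup.of (KTriple.elem Y P))

/-- The relative K-group `K(X, Y)` formulated by difference triples of vector bundles. -/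
abbrev RelKGroup (X : Type u) [TopologicalSpace X] (Y : Set X) :=
  FreeAbelianGroup (KTriple Y) ⧸
    AddSubgroup.closure {z : FreeAbelianGroup (KTriple Y) | RelKGroup.Rel z}

/-- The class `[E⁰, E¹, α]` in `K(X, Y)`. -/
def RelKGroup.mk {X : Type u} [TopologicalSpace X] {Y : Set X} (T : KTriple Y) : RelKGroup X Y :=
  QuotientAddGroup.mk (FreeAbelianGroup.of T)

/-! ### Hermitian vector bundles -/

/-- A Hermitian vector bundle over `U`: a complex vector bundle with a continuous family of
(positive definite) Hermitian inner products on the fibres. -/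
structure HBundle {X : Type u} [TopologicalSpace X] (U : Set X) extends CBundle U where
  metric : ∀ x, InnerProductSpace.Core ℂ (Fib x)
  cont_metric : ∀ a, ∀ v w : (chart a).Model,
    ContinuousOn (fun x => (metric x).inner ((chart a).lift x v) ((chart a).lift x w))
      ((chart a).dom ∩ U)

/-- Pullback of Hermitian vector bundles. -/
def HBundle.comap {X X' : Type u} [TopologicalSpace X] [TopologicalSpace X'] {U : Set X}
    (E : HBundle U) (f : C(X', X)) : HBundle (f ⁻¹' U) where
  toCBundle := E.toCBundle.comap f
  metric x' := E.metric (f x')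
  cont_metric a v w := (E.cont_metric a v w).comp f.continuous.continuousOn (fun _ hx => hx)

/-- The orthogonal direct sum of two Hermitian inner products. -/
@[reducible]
noncomputable def sumMetric {V W : Type} [AddCommGroup V] [Module ℂ V] [AddCommGroup W] [Module ℂ W]
    (c : InnerProductSpace.Core ℂ V) (d : InnerProductSpace.Core ℂ W) :
    InnerProductSpace.Core ℂ (V × W) where
  inner p q := c.inner p.1 q.1 + d.inner p.2 q.2
  conj_inner_symm p q := by
    rw [map_add, c.conj_inner_symm, d.conj_inner_symm]
  re_inner_nonneg p := by
    rw [map_add]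
    exact add_nonneg (c.re_inner_nonneg _) (d.re_inner_nonneg _)
  add_left p q r := by
    simp only [Prod.fst_add, Prod.snd_add, c.add_left, d.add_left]
    ring
  smul_left p q r := by
    simp only [Prod.smul_fst, Prod.smul_snd, c.smul_left, d.smul_left]
    ring
  definite p hp := by
    have h := congrArg (RCLike.re : ℂ → ℝ) hp
    rw [map_add, map_zero] at h
    have h1 := c.re_inner_nonneg p.1
    have h2 := d.re_inner_nonneg p.2
    have i1 : (c.inner p.1 p.1).im = 0 := by
      have := congrArg Complex.im (c.conj_inner_symm p.1 p.1)
      simp only [Complex.conj_im] at this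
      linarith
    have i2 : (d.inner p.2 p.2).im = 0 := by
      have := congrArg Complex.im (d.conj_inner_symm p.2 p.2)
      simp only [Complex.conj_im] at this
      linarith
    refine Prod.ext (c.definite _ (Complex.ext ?_ i1)) (d.definite _ (Complex.ext ?_ i2))
    · change (c.inner p.1 p.1).re + (d.inner p.2 p.2).re = 0 at h
      change 0 ≤ (c.inner p.1 p.1).re at h1
      change 0 ≤ (d.inner p.2 p.2).re at h2
      change (c.inner p.1 p.1).re = 0
      linarith
    · change (c.inner p.1 p.1).re + (d.inner p.2 p.2).re = 0 at h
      change 0 ≤ (c.inner p.1 p.1).re at h1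
      change 0 ≤ (d.inner p.2 p.2).re at h2
      change (d.inner p.2 p.2).re = 0
      linarith

/-- Orthogonal direct sum of Hermitian vector bundles. -/
noncomputable def HBundle.sum {X : Type u} [TopologicalSpace X] {U V : Set X} (E : HBundle U) (F : HBundle V) :
    HBundle (U ∩ V) where
  toCBundle := E.toCBundle.sum F.toCBundle
  metric x := sumMetric (E.metric x) (F.metric x)
  cont_metric a v w :=
    ((E.cont_metric a.1 v.1 w.1).mono fun _ hx => ⟨hx.1.1, hx.2.1⟩).add
      ((F.cont_metric a.2 v.2 w.2).mono fun _ hx => ⟨hx.1.2, hx.2.2⟩)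

/-! ### The categories `HF(U)` -/

/-- An object `(E, h)` of `HF(U)`: a `ℤ/2`-graded Hermitian vector bundle `E = even ⊕ odd` over `U`
and a Hermitian map `h : E → E` of degree one, given by its components `h₁₀ : even → odd` and
`h₀₁ : odd → even`, which are adjoint to each other. -/
structure HFObj {X : Type u} [TopologicalSpace X] (U : Set X) where
  even : HBundle U
  odd : HBundle U
  h₁₀ : ∀ x, even.Fib x →ₗ[ℂ] odd.Fib x
  h₀₁ : ∀ x, odd.Fib x →ₗ[ℂ] even.Fib x
  cont₁₀ : even.toCBundle.ContMap odd.toCBundle U h₁₀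
  cont₀₁ : odd.toCBundle.ContMap even.toCBundle U h₀₁
  hermitian : ∀ x ∈ U, ∀ v w,
    (odd.metric x).inner (h₁₀ x v) w = (even.metric x).inner v (h₀₁ x w)

/-- `h` is invertible at the point `x`. -/
def HFObj.InvertibleAt {X : Type u} [TopologicalSpace X] {U : Set X} (E : HFObj U) (x : X) : Prop :=
  Function.Bijective (E.h₁₀ x) ∧ Function.Bijective (E.h₀₁ x)

/-- The even part of `(E, h)_{x, < μ}`, the sum over `r < μ` of the eigenspaces
`Ker (h_x ^ 2 - r)`. -/
def HFObj.lowEven {X : Type u} [TopologicalSpace X] {U : Set X} (E : HFObj U) (x : X) (μ : ℝ) :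
    Submodule ℂ (E.even.Fib x) :=
  ⨆ (r : ℝ) (_ : r < μ), Module.End.eigenspace (E.h₀₁ x ∘ₗ E.h₁₀ x) (r : ℂ)

/-- The odd part of `(E, h)_{x, < μ}`. -/
def HFObj.lowOdd {X : Type u} [TopologicalSpace X] {U : Set X} (E : HFObj U) (x : X) (μ : ℝ) :
    Submodule ℂ (E.odd.Fib x) :=
  ⨆ (r : ℝ) (_ : r < μ), Module.End.eigenspace (E.h₁₀ x ∘ₗ E.h₀₁ x) (r : ℂ)

/-- A family of degree zero linear maps between the fibres of two objects. -/
structure HFMap {X : Type u} [TopologicalSpace X] {U V : Set X} (E : HFObj U) (F : HFObj V) where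
  even : ∀ x, E.even.Fib x →ₗ[ℂ] F.even.Fib x
  odd : ∀ x, E.odd.Fib x →ₗ[ℂ] F.odd.Fib x

/-- The identity. -/
def HFMap.id {X : Type u} [TopologicalSpace X] {U : Set X} (E : HFObj U) : HFMap E E where
  even _ := LinearMap.id
  odd _ := LinearMap.id

/-- Composition `φ ∘ ψ`. -/
def HFMap.comp {X : Type u} [TopologicalSpace X] {U V W : Set X} {E : HFObj U} {F : HFObj V}
    {G : HFObj W} (φ : HFMap F G) (ψ : HFMap E F) : HFMap E G where
  even x := φ.even x ∘ₗ ψ.even x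
  odd x := φ.odd x ∘ₗ ψ.odd x

/-- `φ` represents a homomorphism `E|_W → F|_W` in `HF(W)`: over `W` it is continuous and
satisfies `φ h = h φ`. -/
structure HFMap.IsHom {X : Type u} [TopologicalSpace X] {U V : Set X} {E : HFObj U} {F : HFObj V}
    (φ : HFMap E F) (W : Set X) : Prop where
  cont_even : E.even.toCBundle.ContMap F.even.toCBundle W φ.even
  cont_odd : E.odd.toCBundle.ContMap F.odd.toCBundle W φ.odd
  comm₁₀ : ∀ x ∈ W, ∀ v, φ.odd x (E.h₁₀ x v) = F.h₁₀ x (φ.even x v)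
  comm₀₁ : ∀ x ∈ W, ∀ v, φ.even x (E.h₀₁ x v) = F.h₀₁ x (φ.odd x v)

/-- Two representatives define the same homomorphism in `HF(W)`: each point of `W` has a
neighbourhood `N` and a number `μ > 0` such that they agree on `(E, h)_{y, < μ}` for all `y` in
`N ∩ W`. -/
def HFMap.Eqv {X : Type u} [TopologicalSpace X] {U V : Set X} {E : HFObj U} {F : HFObj V}
    (φ ψ : HFMap E F) (W : Set X) : Prop :=
  ∀ x ∈ W, ∃ μ : ℝ, 0 < μ ∧ ∃ N : Set X, IsOpen N ∧ x ∈ N ∧ ∀ y ∈ N ∩ W,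
    (∀ ξ ∈ E.lowEven y μ, φ.even y ξ = ψ.even y ξ) ∧
    (∀ ξ ∈ E.lowOdd y μ, φ.odd y ξ = ψ.odd y ξ)

/-- Pullback of objects. -/
def HFObj.comap {X X' : Type u} [TopologicalSpace X] [TopologicalSpace X'] {U : Set X}
    (E : HFObj U) (f : C(X', X)) : HFObj (f ⁻¹' U) where
  even := E.even.comap f
  odd := E.odd.comap f
  h₁₀ x' := E.h₁₀ (f x')
  h₀₁ x' := E.h₀₁ (f x')
  cont₁₀ := E.cont₁₀.comap f
  cont₀₁ := E.cont₀₁.comap f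
  hermitian x' hx := E.hermitian (f x') hx

/-- Pullback of maps. -/
def HFMap.comap {X X' : Type u} [TopologicalSpace X] [TopologicalSpace X'] {U V : Set X}
    {E : HFObj U} {F : HFObj V} (φ : HFMap E F) (f : C(X', X)) :
    HFMap (E.comap f) (F.comap f) where
  even x' := φ.even (f x')
  odd x' := φ.odd (f x')

theorem HFMap.IsHom.comap {X X' : Type u} [TopologicalSpace X] [TopologicalSpace X']
    {U V W : Set X} {E : HFObj U} {F : HFObj V} {φ : HFMap E F} (h : φ.IsHom W) (f : C(X', X)) :
    (φ.comap f).IsHom (f ⁻¹' W) where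
  cont_even := h.cont_even.comap f
  cont_odd := h.cont_odd.comap f
  comm₁₀ x' hx := h.comm₁₀ (f x') hx
  comm₀₁ x' hx := h.comm₀₁ (f x') hx

theorem HFMap.Eqv.comap {X X' : Type u} [TopologicalSpace X] [TopologicalSpace X']
    {U V W : Set X} {E : HFObj U} {F : HFObj V} {φ ψ : HFMap E F} (h : φ.Eqv ψ W) (f : C(X', X)) :
    (φ.comap f).Eqv (ψ.comap f) (f ⁻¹' W) := by
  intro x' hx
  obtain ⟨μ, hμ, N, hN, hxN, H⟩ := h (f x') hx
  exact ⟨μ, hμ, f ⁻¹' N, hN.preimage f.continuous, hxN, fun y hy => H (f y) hy⟩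

/-- Direct sum of objects. -/
noncomputable def HFObj.sum {X : Type u} [TopologicalSpace X] {U V : Set X} (E : HFObj U) (F : HFObj V) :
    HFObj (U ∩ V) where
  even := E.even.sum F.even
  odd := E.odd.sum F.odd
  h₁₀ x := (E.h₁₀ x).prodMap (F.h₁₀ x)
  h₀₁ x := (E.h₀₁ x).prodMap (F.h₀₁ x)
  cont₁₀ := E.cont₁₀.sum F.cont₁₀
  cont₀₁ := E.cont₀₁.sum F.cont₀₁
  hermitian x hx v w :=
    congrArg₂ (· + ·) (E.hermitian x hx.1 v.1 w.1) (F.hermitian x hx.2 v.2 w.2)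

/-- Direct sum of maps. -/
noncomputable def HFMap.sum {X : Type u} [TopologicalSpace X] {U V U' V' : Set X} {E : HFObj U} {F : HFObj V}
    {E' : HFObj U'} {F' : HFObj V'} (φ : HFMap E F) (φ' : HFMap E' F') :
    HFMap (E.sum E') (F.sum F') where
  even x := (φ.even x).prodMap (φ'.even x)
  odd x := (φ.odd x).prodMap (φ'.odd x)

theorem HFMap.IsHom.sum {X : Type u} [TopologicalSpace X] {U V U' V' W W' W'' : Set X}
    {E : HFObj U} {F : HFObj V} {E' : HFObj U'} {F' : HFObj V'} {φ : HFMap E F} {φ' : HFMap E' F'}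
    (h : φ.IsHom W) (h' : φ'.IsHom W') (hW : W'' ⊆ W ∩ W') : (φ.sum φ').IsHom W'' where
  cont_even := (h.cont_even.sum h'.cont_even).mono hW
  cont_odd := (h.cont_odd.sum h'.cont_odd).mono hW
  comm₁₀ x hx v := Prod.ext (h.comm₁₀ x (hW hx).1 v.1) (h'.comm₁₀ x (hW hx).2 v.2)
  comm₀₁ x hx v := Prod.ext (h.comm₀₁ x (hW hx).1 v.1) (h'.comm₀₁ x (hW hx).2 v.2)

/-- A vector in the low-energy part of a direct sum has components in the low-energy parts. -/
theorem iSup_eigenspace_prodMap_le {V W : Type} [AddCommGroup V] [Module ℂ V] [AddCommGroup W]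
    [Module ℂ W] (f : Module.End ℂ V) (g : Module.End ℂ W) {μ μ₁ μ₂ : ℝ} (h₁ : μ ≤ μ₁)
    (h₂ : μ ≤ μ₂) {ξ : V × W}
    (hξ : ξ ∈ ⨆ (r : ℝ) (_ : r < μ), Module.End.eigenspace (LinearMap.prodMap f g) (r : ℂ)) :
    ξ.1 ∈ (⨆ (r : ℝ) (_ : r < μ₁), Module.End.eigenspace f (r : ℂ)) ∧
      ξ.2 ∈ (⨆ (r : ℝ) (_ : r < μ₂), Module.End.eigenspace g (r : ℂ)) := by
  have key : (⨆ (r : ℝ) (_ : r < μ), Module.End.eigenspace (LinearMap.prodMap f g) (r : ℂ)) ≤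
      (⨆ (r : ℝ) (_ : r < μ₁), Module.End.eigenspace f (r : ℂ)).prod
        (⨆ (r : ℝ) (_ : r < μ₂), Module.End.eigenspace g (r : ℂ)) := by
    refine iSup₂_le fun r hr v hv => ?_
    rw [Module.End.mem_eigenspace_iff] at hv
    refine ⟨Submodule.mem_iSup_of_mem r (Submodule.mem_iSup_of_mem (hr.trans_le h₁) ?_),
      Submodule.mem_iSup_of_mem r (Submodule.mem_iSup_of_mem (hr.trans_le h₂) ?_)⟩
    · rw [Module.End.mem_eigenspace_iff]
      exact congrArg Prod.fst hv
    · rw [Module.End.mem_eigenspace_iff]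
      exact congrArg Prod.snd hv
  exact key hξ

theorem HFMap.Eqv.sum {X : Type u} [TopologicalSpace X] {U V U' V' W W' W'' : Set X}
    {E : HFObj U} {F : HFObj V} {E' : HFObj U'} {F' : HFObj V'} {φ ψ : HFMap E F}
    {φ' ψ' : HFMap E' F'} (h : φ.Eqv ψ W) (h' : φ'.Eqv ψ' W') (hW : W'' ⊆ W ∩ W') :
    (φ.sum φ').Eqv (ψ.sum ψ') W'' := by
  intro x hx
  obtain ⟨μ, hμ, N, hN, hxN, H⟩ := h x (hW hx).1
  obtain ⟨μ', hμ', N', hN', hxN', H'⟩ := h' x (hW hx).2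
  refine ⟨min μ μ', lt_min hμ hμ', N ∩ N', hN.inter hN', ⟨hxN, hxN'⟩, fun y hy => ?_⟩
  have H := H y ⟨hy.1.1, (hW hy.2).1⟩
  have H' := H' y ⟨hy.1.2, (hW hy.2).2⟩
  refine ⟨fun ξ hξ => ?_, fun ξ hξ => ?_⟩
  · have k := iSup_eigenspace_prodMap_le (E.h₀₁ y ∘ₗ E.h₁₀ y) (E'.h₀₁ y ∘ₗ E'.h₁₀ y)
      (min_le_left μ μ') (min_le_right μ μ') hξ
    exact Prod.ext (H.1 _ k.1) (H'.1 _ k.2)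
  · have k := iSup_eigenspace_prodMap_le (E.h₁₀ y ∘ₗ E.h₀₁ y) (E'.h₁₀ y ∘ₗ E'.h₀₁ y)
      (min_le_left μ μ') (min_le_right μ μ') hξ
    exact Prod.ext (H.2 _ k.1) (H'.2 _ k.2)

theorem HFMap.Eqv.mono {X : Type u} [TopologicalSpace X] {U V W W' : Set X} {E : HFObj U}
    {F : HFObj V} {φ ψ : HFMap E F} (h : φ.Eqv ψ W) (hW : W' ⊆ W) : φ.Eqv ψ W' := by
  intro x hx
  obtain ⟨μ, hμ, N, hN, hxN, H⟩ := h x (hW hx)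
  exact ⟨μ, hμ, N, hN, hxN, fun y hy => H y ⟨hy.1, hW hy.2⟩⟩

/-! ### Vectorial bundles -/

/-- A vectorial bundle over `X`: an open cover `U i`, objects `(E i, h i)` of `HF(U i)` and
homomorphisms `φ i j : E j → E i` in `HF(U i ∩ U j)` (given by representatives) satisfying the
cocycle conditions. -/
structure VectorialBundle (X : Type u) [TopologicalSpace X] where
  Idx : Type u
  U : Idx → Set X
  isOpen : ∀ i, IsOpen (U i)
  cover : ∀ x, ∃ i, x ∈ U i
  obj : ∀ i, HFObj (U i)
  φ : ∀ i j, HFMap (obj j) (obj i)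
  isHom : ∀ i j, (φ i j).IsHom (U i ∩ U j)
  inverse : ∀ i j, ((φ i j).comp (φ j i)).Eqv (HFMap.id (obj i)) (U i ∩ U j)
  cocycle : ∀ i j k, ((φ i j).comp (φ j k)).Eqv (φ i k) (U i ∩ U j ∩ U k)

/-- Homomorphisms `E' → E` of vectorial bundles: families `ψ i i' : E' i' → E i` of homomorphisms
in `HF(U i ∩ U' i')` compatible with the transition homomorphisms of `E'` and of `E`. -/
structure VectorialBundle.IsHom {X : Type u} [TopologicalSpace X] (E' E : VectorialBundle X)
    (ψ : ∀ i i', HFMap (E'.obj i') (E.obj i)) : Prop where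
  isHom : ∀ i i', (ψ i i').IsHom (E.U i ∩ E'.U i')
  source : ∀ i i' j', ((ψ i i').comp (E'.φ i' j')).Eqv (ψ i j') (E.U i ∩ E'.U i' ∩ E'.U j')
  target : ∀ i j j', ((E.φ i j).comp (ψ j j')).Eqv (ψ i j') (E.U i ∩ E.U j ∩ E'.U j')

/-- Vectorial bundles are isomorphic if there are homomorphisms `ψ : E' → E` and `χ : E → E'`
inverse to each other; the identity homomorphism of `E` is the family `φ i j`. -/
def VectorialBundle.Iso {X : Type u} [TopologicalSpace X] (E' E : VectorialBundle X) : Prop :=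
  ∃ (ψ : ∀ i i', HFMap (E'.obj i') (E.obj i)) (χ : ∀ i' i, HFMap (E.obj i) (E'.obj i')),
    E'.IsHom E ψ ∧ E.IsHom E' χ ∧
    (∀ i' i j', ((χ i' i).comp (ψ i j')).Eqv (E'.φ i' j') (E'.U i' ∩ E.U i ∩ E'.U j')) ∧
    (∀ i i' j, ((ψ i i').comp (χ i' j)).Eqv (E.φ i j) (E.U i ∩ E'.U i' ∩ E.U j))

/-- The support: the closure of the set of points at which some `h i` is not invertible. -/
def VectorialBundle.supp {X : Type u} [TopologicalSpace X] (E : VectorialBundle X) : Set X :=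
  closure {x | ∃ i, x ∈ E.U i ∧ ¬ (E.obj i).InvertibleAt x}

/-- Pullback of vectorial bundles along a continuous map. -/
def VectorialBundle.comap {X X' : Type u} [TopologicalSpace X] [TopologicalSpace X']
    (E : VectorialBundle X) (f : C(X', X)) : VectorialBundle X' where
  Idx := E.Idx
  U i := f ⁻¹' E.U i
  isOpen i := (E.isOpen i).preimage f.continuous
  cover x' := E.cover (f x')
  obj i := (E.obj i).comap f
  φ i j := (E.φ i j).comap f
  isHom i j := (E.isHom i j).comap f
  inverse i j := (E.inverse i j).comap f
  cocycle i j k := (E.cocycle i j k).comap f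

/-- Direct sum of vectorial bundles, over the common refinement of the two covers. -/
noncomputable def VectorialBundle.sum {X : Type u} [TopologicalSpace X] (E F : VectorialBundle X) :
    VectorialBundle X where
  Idx := E.Idx × F.Idx
  U i := E.U i.1 ∩ F.U i.2
  isOpen i := (E.isOpen i.1).inter (F.isOpen i.2)
  cover x := by
    obtain ⟨i, hi⟩ := E.cover x
    obtain ⟨j, hj⟩ := F.cover x
    exact ⟨(i, j), hi, hj⟩
  obj i := (E.obj i.1).sum (F.obj i.2)
  φ i j := (E.φ i.1 j.1).sum (F.φ i.2 j.2)
  isHom i j := (E.isHom i.1 j.1).sum (F.isHom i.2 j.2)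
    fun _ hx => ⟨⟨hx.1.1, hx.2.1⟩, ⟨hx.1.2, hx.2.2⟩⟩
  inverse i j := (E.inverse i.1 j.1).sum (F.inverse i.2 j.2)
    fun _ hx => ⟨⟨hx.1.1, hx.2.1⟩, ⟨hx.1.2, hx.2.2⟩⟩
  cocycle i j k := (E.cocycle i.1 j.1 k.1).sum (F.cocycle i.2 j.2 k.2)
    fun _ hx => ⟨⟨⟨hx.1.1.1, hx.1.2.1⟩, hx.2.1⟩, ⟨⟨hx.1.1.2, hx.1.2.2⟩, hx.2.2⟩⟩

theorem VectorialBundle.isHom_refl {X : Type u} [TopologicalSpace X] (E : VectorialBundle X) :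
    E.IsHom E E.φ where
  isHom := E.isHom
  source := E.cocycle
  target := E.cocycle

theorem VectorialBundle.Iso.refl {X : Type u} [TopologicalSpace X] (E : VectorialBundle X) :
    E.Iso E :=
  ⟨E.φ, E.φ, E.isHom_refl, E.isHom_refl, E.cocycle, E.cocycle⟩

theorem VectorialBundle.IsHom.sum {X : Type u} [TopologicalSpace X]
    {E' E F' F : VectorialBundle X} {ψ : ∀ i i', HFMap (E'.obj i') (E.obj i)}
    {χ : ∀ i i', HFMap (F'.obj i') (F.obj i)} (h : E'.IsHom E ψ) (k : F'.IsHom F χ) :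
    (E'.sum F').IsHom (E.sum F) (fun i i' => (ψ i.1 i'.1).sum (χ i.2 i'.2)) where
  isHom i i' := (h.isHom i.1 i'.1).sum (k.isHom i.2 i'.2)
    fun _ hx => ⟨⟨hx.1.1, hx.2.1⟩, ⟨hx.1.2, hx.2.2⟩⟩
  source i i' j' := (h.source i.1 i'.1 j'.1).sum (k.source i.2 i'.2 j'.2)
    fun _ hx => ⟨⟨⟨hx.1.1.1, hx.1.2.1⟩, hx.2.1⟩, ⟨⟨hx.1.1.2, hx.1.2.2⟩, hx.2.2⟩⟩
  target i j j' := (h.target i.1 j.1 j'.1).sum (k.target i.2 j.2 j'.2)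
    fun _ hx => ⟨⟨⟨hx.1.1.1, hx.1.2.1⟩, hx.2.1⟩, ⟨⟨hx.1.1.2, hx.1.2.2⟩, hx.2.2⟩⟩

theorem VectorialBundle.Iso.sum {X : Type u} [TopologicalSpace X]
    {E' E F' F : VectorialBundle X} (h : E'.Iso E) (k : F'.Iso F) :
    (E'.sum F').Iso (E.sum F) := by
  obtain ⟨ψ, χ, h1, h2, h3, h4⟩ := h
  obtain ⟨ψ', χ', k1, k2, k3, k4⟩ := k
  refine ⟨_, _, h1.sum k1, h2.sum k2, fun i j k => ?_, fun i j k => ?_⟩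
  · exact (h3 i.1 j.1 k.1).sum (k3 i.2 j.2 k.2)
      fun _ hx => ⟨⟨⟨hx.1.1.1, hx.1.2.1⟩, hx.2.1⟩, ⟨⟨hx.1.1.2, hx.1.2.2⟩, hx.2.2⟩⟩
  · exact (h4 i.1 j.1 k.1).sum (k4 i.2 j.2 k.2)
      fun _ hx => ⟨⟨⟨hx.1.1.1, hx.1.2.1⟩, hx.2.1⟩, ⟨⟨hx.1.1.2, hx.1.2.2⟩, hx.2.2⟩⟩

theorem VectorialBundle.supp_sum_subset {X : Type u} [TopologicalSpace X]
    (E F : VectorialBundle X) : (E.sum F).supp ⊆ E.supp ∪ F.supp := by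
  unfold VectorialBundle.supp
  rw [← closure_union]
  refine closure_mono ?_
  rintro x ⟨i, hi, hn⟩
  by_contra hcon
  simp only [mem_union, mem_ofPred_eq, not_or, not_exists, not_and, not_not] at hcon
  have hE := hcon.1 i.1 hi.1
  have hF := hcon.2 i.2 hi.2
  exact hn ⟨hE.1.prodMap hF.1, hE.2.prodMap hF.2⟩

theorem VectorialBundle.supp_comap_subset {X X' : Type u} [TopologicalSpace X]
    [TopologicalSpace X'] (E : VectorialBundle X) (f : C(X', X)) :
    (E.comap f).supp ⊆ f ⁻¹' E.supp :=
  (closure_mono fun _ hx => hx).trans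
    (f.continuous.closure_preimage_subset {x | ∃ i, x ∈ E.U i ∧ ¬ (E.obj i).InvertibleAt x})

/-! ### The groups `KF(X, Y)` -/

/-- Vectorial bundles over `X` whose support does not meet `Y`. -/
def RelVectorialBundle (X : Type u) [TopologicalSpace X] (Y : Set X) :=
  {E : VectorialBundle X // E.supp ∩ Y = ∅}

/-- The inclusion `X → X × [0,1]`, `x ↦ (x, t)`. -/
def sliceMap (X : Type u) [TopologicalSpace X] (t : unitInterval) : C(X, X × unitInterval) :=
  ⟨fun x => (x, t), by fun_prop⟩

/-- Homotopy: a vectorial bundle over `X × [0,1]` whose support does not meet `Y × [0,1]` and whose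
restrictions to `X × {0}` and `X × {1}` are isomorphic to the given ones. -/
def RelVectorialBundle.Homotopic {X : Type u} [TopologicalSpace X] {Y : Set X}
    (E₀ E₁ : RelVectorialBundle X Y) : Prop :=
  ∃ H : RelVectorialBundle (X × unitInterval) (Y ×ˢ (univ : Set unitInterval)),
    (H.1.comap (sliceMap X 0)).Iso E₀.1 ∧ (H.1.comap (sliceMap X 1)).Iso E₁.1

/-- `KF(X, Y)`: homotopy classes of vectorial bundles with support off `Y`.  The case `Y = ∅` is
`KF(X)`. -/
def KF (X : Type u) [TopologicalSpace X] (Y : Set X) :=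
  Quot (RelVectorialBundle.Homotopic (X := X) (Y := Y))

/-- The class of a vectorial bundle. -/
def KF.mk {X : Type u} [TopologicalSpace X] {Y : Set X} (E : VectorialBundle X)
    (h : E.supp ∩ Y = ∅) : KF X Y :=
  Quot.mk _ ⟨E, h⟩

/-- Direct sum. -/
noncomputable def RelVectorialBundle.sum {X : Type u} [TopologicalSpace X] {Y : Set X}
    (E F : RelVectorialBundle X Y) : RelVectorialBundle X Y :=
  ⟨E.1.sum F.1, by
    refine subset_empty_iff.1 fun x hx => ?_
    rcases VectorialBundle.supp_sum_subset _ _ hx.1 with h | h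
    · exact E.2.subset ⟨h, hx.2⟩
    · exact F.2.subset ⟨h, hx.2⟩⟩

/-- The constant homotopy. -/
def RelVectorialBundle.const {X : Type u} [TopologicalSpace X] {Y : Set X}
    (E : RelVectorialBundle X Y) :
    RelVectorialBundle (X × unitInterval) (Y ×ˢ (univ : Set unitInterval)) :=
  ⟨E.1.comap ⟨Prod.fst, continuous_fst⟩, by
    refine subset_empty_iff.1 fun x hx => ?_
    exact E.2.subset ⟨VectorialBundle.supp_comap_subset _ _ hx.1, hx.2.1⟩⟩

theorem RelVectorialBundle.Homotopic.sum_left {X : Type u} [TopologicalSpace X] {Y : Set X}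
    (C : RelVectorialBundle X Y) {E F : RelVectorialBundle X Y} (h : E.Homotopic F) :
    (C.sum E).Homotopic (C.sum F) := by
  obtain ⟨H, h0, h1⟩ := h
  exact ⟨C.const.sum H, (VectorialBundle.Iso.refl C.1).sum h0,
    (VectorialBundle.Iso.refl C.1).sum h1⟩

theorem RelVectorialBundle.Homotopic.sum_right {X : Type u} [TopologicalSpace X] {Y : Set X}
    (C : RelVectorialBundle X Y) {E F : RelVectorialBundle X Y} (h : E.Homotopic F) :
    (E.sum C).Homotopic (F.sum C) := by
  obtain ⟨H, h0, h1⟩ := h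
  exact ⟨H.sum C.const, h0.sum (VectorialBundle.Iso.refl C.1),
    h1.sum (VectorialBundle.Iso.refl C.1)⟩

/-- The addition of `KF(X, Y)`, induced by the direct sum. -/
noncomputable instance KF.instAdd {X : Type u} [TopologicalSpace X] {Y : Set X} : Add (KF X Y) where
  add := Quot.map₂ RelVectorialBundle.sum
    (fun C _ _ h => h.sum_left C) (fun _ _ C h => h.sum_right C)

/-! ### From vector bundles to vectorial bundles -/

/-- An object `(E, h)` over the whole space, as a vectorial bundle with cover `{X}`. -/
def HFObj.toVectorial {X : Type u} [TopologicalSpace X] (E : HFObj (univ : Set X)) :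
    VectorialBundle X where
  Idx := PUnit
  U _ := univ
  isOpen _ := isOpen_univ
  cover _ := ⟨PUnit.unit, trivial⟩
  obj _ := E
  φ _ _ := HFMap.id E
  isHom _ _ :=
    ⟨E.even.toCBundle.contMap_id (subset_univ _), E.odd.toCBundle.contMap_id (subset_univ _),
      fun _ _ _ => rfl, fun _ _ _ => rfl⟩
  inverse _ _ := fun _ _ => ⟨1, one_pos, univ, isOpen_univ, trivial, fun _ _ =>
    ⟨fun _ _ => rfl, fun _ _ => rfl⟩⟩
  cocycle _ _ _ := fun _ _ => ⟨1, one_pos, univ, isOpen_univ, trivial, fun _ _ =>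
    ⟨fun _ _ => rfl, fun _ _ => rfl⟩⟩

/-- If `h` is invertible along `Y`, the underlying triple `(E⁰, E¹, h₁₀|_Y)` of `(E, h)`. -/
def HFObj.toTriple {X : Type u} [TopologicalSpace X] {Y : Set X} (E : HFObj (univ : Set X))
    (h : E.toVectorial.supp ∩ Y = ∅) : KTriple Y where
  E₀ := E.even.toCBundle
  E₁ := E.odd.toCBundle
  α := E.h₁₀
  cont := E.cont₁₀.mono (subset_univ Y)
  bij x hx := by
    by_contra hb
    exact h.subset ⟨subset_closure ⟨PUnit.unit, trivial, fun hi => hb hi.1⟩, hx⟩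

/-- The object `(E⁰ ⊕ E¹, h = 0)`. -/
def HFObj.ofZero {X : Type u} [TopologicalSpace X] (E₀ E₁ : HBundle (univ : Set X)) :
    HFObj (univ : Set X) where
  even := E₀
  odd := E₁
  h₁₀ _ := 0
  h₀₁ _ := 0
  cont₁₀ a b v := by simpa using continuousOn_const
  cont₀₁ a b v := by simpa using continuousOn_const
  hermitian x _ v w := by
    have h1 : (E₁.metric x).inner (0 : E₁.Fib x) w = 0 := by
      have := (E₁.metric x).smul_left (0 : E₁.Fib x) w 0
      simpa using this
    have h2 : (E₀.metric x).inner v (0 : E₀.Fib x) = 0 := by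
      have := (E₀.metric x).smul_left (0 : E₀.Fib x) v 0
      rw [← (E₀.metric x).conj_inner_symm]
      simpa using this
    simpa [h1] using h2.symm

/-! The heart of the matter is that over a compact Hausdorff base every vectorial bundle is
isomorphic to a single pair (E, h) on the whole space (`VectorialBundle.exists_global`). By
compactness a finite refinement of the cover has one bound μ below which all cocycle identities hold
exactly (`VectorialBundle.exists_framing`). The transition maps, weighted by functions with Σ r_k² =
1 and read in orthonormal frames, embed the part of each (E_j, h_j) below μ in a fixed space W₀ ⊕
W₁, independently of j. Put s = √(2/μ). On an eigenvector of h² for r ≤ μ/2 regard s√r as the sine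
of an angle; the graph of all (cos · v, s h v) is the range of a projection with diagonal entries
cos² and sin² and off-diagonal entries s · cos · h. For larger r the projection is the one to W₁.
The local formulas agree and give a continuous family P of projections of W₀ ⊕ W₁. Take Im P as even
part, the trivial bundle W₁ as odd part, and s⁻¹ times the second coordinate as map of degree one.
This object has the eigenvalues of h² below μ/2, and otherwise only the eigenvalue μ/2, which
equality in HF does not see. A modified metric on W₀ ⊕ W₁ makes P self-adjoint, so that the map is
Hermitian.

Next, global objects E and F whose vectorial bundles are isomorphic have the same class in K(X, Y).
Let ψ and χ be the mutually inverse homomorphisms. The matrix from E⁰ ⊕ F¹ to E¹ ⊕ F⁰ with diagonal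
h, −h' and off-diagonal tχ, tψ (cut off to low energies) is bijective everywhere for t ≠ 0 and over
Y also for t = 0 (`HFMap.cross_bijective`). Hence the triple of E plus the reversed triple of F is
homotopic to one whose isomorphism extends to X, and such a triple is zero. Taking E = F gives the
inverses in both groups. Homotopy invariance of K(X, Y) (`RelKGroup.mk_slice_eq`) rests on extending
bundle maps from closed subsets.

So passing to the underlying triple of a global representative is well defined from KF(X, Y) to K(X,
Y); for homotopies one represents the bundle over X × [0,1] globally. In the other direction α is
extended to X and metrics are chosen, and straight paths of maps and metrics show that the choices
do not matter (`KF.mk_congr`). The two maps are inverse to each other. Every class in K(X, Y) is the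
class of one triple, and hence comes from a global object, so the normalization determines Φ. The
absolute statement is the case Y = ∅ together with K(X) ≅ K(X, ∅). -/

/-! ### Continuous sections -/

namespace CBundle

variable {X : Type u} [TopologicalSpace X] {U V W W' : Set X}

/-- A section is continuous within `W` at a point: its coordinates are. -/
def ContSecAt (E : CBundle U) (s : ∀ x, E.Fib x) (W : Set X) (x₀ : X) : Prop :=
  ∀ a, x₀ ∈ (E.chart a).dom → ContinuousWithinAt (fun x => (E.chart a).coord x (s x)) W x₀

/-- A section is continuous over `W`. -/
def ContSec (E : CBundle U) (s : ∀ x, E.Fib x) (W : Set X) : Prop :=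
  ∀ x₀ ∈ W, E.ContSecAt s W x₀

theorem ContSecAt.mono {E : CBundle U} {s : ∀ x, E.Fib x} {x₀ : X} (h : E.ContSecAt s W x₀)
    (hW : W' ⊆ W) : E.ContSecAt s W' x₀ :=
  fun a ha => (h a ha).mono hW

theorem ContSec.mono {E : CBundle U} {s : ∀ x, E.Fib x} (h : E.ContSec s W)
    (hW : W' ⊆ W) : E.ContSec s W' :=
  fun x hx => (h x (hW hx)).mono hW

theorem ContSecAt.congr_nhds {E : CBundle U} {s : ∀ x, E.Fib x} {N : Set X} {x₀ : X}
    (h : E.ContSecAt s (N ∩ W) x₀) (hN : N ∈ 𝓝 x₀) : E.ContSecAt s W x₀ :=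
  fun a ha => (continuousWithinAt_inter' (mem_nhdsWithin_of_mem_nhds hN)).1
    ((inter_comm N W) ▸ h a ha)

theorem ContSec.of_local {E : CBundle U} {s : ∀ x, E.Fib x}
    (h : ∀ x ∈ W, ∃ N, N ∈ 𝓝 x ∧ E.ContSec s (N ∩ W)) : E.ContSec s W := by
  intro x hx
  obtain ⟨N, hN, hs⟩ := h x hx
  exact (hs x ⟨mem_of_mem_nhds hN, hx⟩).congr_nhds hN

theorem ContSec.congr {E : CBundle U} {s t : ∀ x, E.Fib x} (h : E.ContSec s W)
    (hst : ∀ x ∈ W, t x = s x) : E.ContSec t W := fun x hx a ha =>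
  (h x hx a ha).congr (fun y hy => by rw [hst y hy]) (by rw [hst x hx])

theorem ContMap.congr {E : CBundle U} {F : CBundle V} {f g : ∀ x, E.Fib x →ₗ[ℂ] F.Fib x}
    (h : E.ContMap F W f) (hfg : ∀ x ∈ W, ∀ v, g x v = f x v) : E.ContMap F W g :=
  fun a b v => (h a b v).congr fun x hx => by rw [hfg x hx.2]

/-- Evaluating on the constant sections of a chart replaces matrices by sections, a form in which
sums, composites and cut-offs are easy to treat. -/
theorem contMap_iff {E : CBundle U} {F : CBundle V} {f : ∀ x, E.Fib x →ₗ[ℂ] F.Fib x} :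
    E.ContMap F W f ↔
      ∀ a v, F.ContSec (fun x => f x ((E.chart a).lift x v)) ((E.chart a).dom ∩ W) := by
  constructor
  · intro h a v x hx b hb
    have := h a b v x ⟨⟨hx.1, hb⟩, hx.2⟩
    rw [inter_right_comm] at this
    exact (continuousWithinAt_inter ((F.chart b).isOpen_dom.mem_nhds hb)).1 this
  · intro h a b v x hx
    exact (h a v x ⟨hx.1.1, hx.2⟩ b hx.1.2).mono fun y hy => ⟨hy.1.1, hy.2⟩

theorem contSec_lift (E : CBundle U) (a : E.Idx) (v : (E.chart a).Model) (hW : W ⊆ U) :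
    E.ContSec (fun x => (E.chart a).lift x v) ((E.chart a).dom ∩ W) :=
  contMap_iff.1 (E.contMap_id hW) a v

/-- The matrix of a fibrewise linear map in charts. -/
noncomputable def chartMap (E : CBundle U) (F : CBundle V) (f : ∀ x, E.Fib x →ₗ[ℂ] F.Fib x)
    (a : E.Idx) (b : F.Idx) (x : X) : (E.chart a).Model →L[ℂ] (F.chart b).Model :=
  LinearMap.toContinuousLinearMap ((F.chart b).coord x ∘ₗ f x ∘ₗ (E.chart a).lift x)

theorem ContMap.continuousOn_chartMap {E : CBundle U} {F : CBundle V}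
    {f : ∀ x, E.Fib x →ₗ[ℂ] F.Fib x} (h : E.ContMap F W f) (a : E.Idx) (b : F.Idx) :
    ContinuousOn (E.chartMap F f a b) ((E.chart a).dom ∩ (F.chart b).dom ∩ W) :=
  continuousOn_clm_apply.2 fun v => h a b v

theorem ContMap.contSecAt {E : CBundle U} {F : CBundle V} {f : ∀ x, E.Fib x →ₗ[ℂ] F.Fib x}
    (h : E.ContMap F W f) (a : E.Idx) {s : ∀ x, E.Fib x} {x₀ : X} (hx₀ : x₀ ∈ W)
    (ha : x₀ ∈ (E.chart a).dom)
    (hs : ContinuousWithinAt (fun x => (E.chart a).coord x (s x)) W x₀) :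
    F.ContSecAt (fun x => f x (s x)) W x₀ := by
  intro b hb
  have hd : (E.chart a).dom ∩ (F.chart b).dom ∈ 𝓝 x₀ :=
    (((E.chart a).isOpen_dom.inter (F.chart b).isOpen_dom).mem_nhds ⟨ha, hb⟩)
  have h1 := h.continuousOn_chartMap a b x₀ ⟨⟨ha, hb⟩, hx₀⟩
  rw [inter_comm] at h1
  have h2 := ((continuousWithinAt_inter hd).1 h1).clm_apply hs
  refine h2.congr_of_eventuallyEq ?_ ?_
  · filter_upwards [mem_nhdsWithin_of_mem_nhds hd] with x hx
    simp [chartMap, (E.chart a).lift_coord x hx.1]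
  · simp [chartMap, (E.chart a).lift_coord x₀ ha]

theorem ContMap.contSec {E : CBundle U} {F : CBundle V} {f : ∀ x, E.Fib x →ₗ[ℂ] F.Fib x}
    (h : E.ContMap F W f) (hW : W ⊆ U) {s : ∀ x, E.Fib x} (hs : E.ContSec s W) :
    F.ContSec (fun x => f x (s x)) W := fun x hx => by
  obtain ⟨a, ha⟩ := E.cover x (hW hx)
  exact h.contSecAt a hx ha (hs x hx a ha)

theorem ContMap.contSec' {E : CBundle U} {F : CBundle V} {f : ∀ x, E.Fib x →ₗ[ℂ] F.Fib x}
    (h : E.ContMap F W f) (hW : W' ⊆ U) (hW' : W' ⊆ W) {s : ∀ x, E.Fib x} (hs : E.ContSec s W') :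
    F.ContSec (fun x => f x (s x)) W' :=
  (h.mono hW').contSec hW hs

theorem ContMap.comp {U' : Set X} {E : CBundle U} {F : CBundle V} {G : CBundle U'}
    {g : ∀ x, F.Fib x →ₗ[ℂ] G.Fib x} {f : ∀ x, E.Fib x →ₗ[ℂ] F.Fib x}
    (hg : F.ContMap G W g) (hf : E.ContMap F W f) (hW : W ⊆ V) :
    E.ContMap G W (fun x => g x ∘ₗ f x) :=
  contMap_iff.2 fun a v => hg.contSec' (inter_subset_right.trans hW) inter_subset_right
    (contMap_iff.1 hf a v)

theorem ContMap.of_contSec {E : CBundle U} {F : CBundle V} {f : ∀ x, E.Fib x →ₗ[ℂ] F.Fib x}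
    (hW : W ⊆ U)
    (h : ∀ W' ⊆ W, ∀ s, E.ContSec s W' → F.ContSec (fun x => f x (s x)) W') :
    E.ContMap F W f :=
  contMap_iff.2 fun a v => h _ inter_subset_right _ (E.contSec_lift a v hW)

theorem ContMap.of_local {E : CBundle U} {F : CBundle V} {f : ∀ x, E.Fib x →ₗ[ℂ] F.Fib x}
    (h : ∀ x ∈ W, ∃ N, N ∈ 𝓝 x ∧ E.ContMap F (N ∩ W) f) : E.ContMap F W f :=
  contMap_iff.2 fun a v => ContSec.of_local fun x hx => by
    obtain ⟨N, hN, hs⟩ := h x hx.2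
    exact ⟨N, hN, (contMap_iff.1 hs a v).mono fun y hy => ⟨hy.2.1, hy.1, hy.2.2⟩⟩

theorem ContSec.add {E : CBundle U} {s t : ∀ x, E.Fib x} (hs : E.ContSec s W)
    (ht : E.ContSec t W) : E.ContSec (fun x => s x + t x) W := fun x hx a ha => by
  simp only [map_add]
  exact (hs x hx a ha).add (ht x hx a ha)

theorem ContSec.sub {E : CBundle U} {s t : ∀ x, E.Fib x} (hs : E.ContSec s W)
    (ht : E.ContSec t W) : E.ContSec (fun x => s x - t x) W := fun x hx a ha => by
  simp only [map_sub]
  exact (hs x hx a ha).sub (ht x hx a ha)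

theorem ContSec.smul {E : CBundle U} {s : ∀ x, E.Fib x} {c : X → ℂ} (hc : ContinuousOn c W)
    (hs : E.ContSec s W) : E.ContSec (fun x => c x • s x) W := fun x hx a ha => by
  simp only [map_smul]
  exact (hc x hx).smul (hs x hx a ha)

theorem contSec_zero (E : CBundle U) : E.ContSec (fun _ => 0) W := fun x hx a ha => by
  simpa using continuousWithinAt_const

theorem ContSec.sum {E : CBundle U} {ι : Type*} {t : Finset ι} {s : ι → ∀ x, E.Fib x}
    (hs : ∀ i ∈ t, E.ContSec (s i) W) : E.ContSec (fun x => ∑ i ∈ t, s i x) W := by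
  classical
  induction t using Finset.induction_on with
  | empty => simpa using E.contSec_zero
  | insert i t hi ih =>
    simp only [Finset.sum_insert hi]
    exact (hs i (Finset.mem_insert_self i t)).add
      (ih fun j hj => hs j (Finset.mem_insert_of_mem hj))

theorem ContMap.add {E : CBundle U} {F : CBundle V} {f g : ∀ x, E.Fib x →ₗ[ℂ] F.Fib x}
    (hf : E.ContMap F W f) (hg : E.ContMap F W g) : E.ContMap F W (fun x => f x + g x) :=
  contMap_iff.2 fun a v => (contMap_iff.1 hf a v).add (contMap_iff.1 hg a v)

theorem ContMap.sub {E : CBundle U} {F : CBundle V} {f g : ∀ x, E.Fib x →ₗ[ℂ] F.Fib x}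
    (hf : E.ContMap F W f) (hg : E.ContMap F W g) : E.ContMap F W (fun x => f x - g x) :=
  contMap_iff.2 fun a v => (contMap_iff.1 hf a v).sub (contMap_iff.1 hg a v)

theorem ContMap.smul {E : CBundle U} {F : CBundle V} {f : ∀ x, E.Fib x →ₗ[ℂ] F.Fib x} {c : X → ℂ}
    (hc : ContinuousOn c W) (hf : E.ContMap F W f) : E.ContMap F W (fun x => c x • f x) :=
  contMap_iff.2 fun a v =>
    ContSec.smul (hc.mono inter_subset_right) (contMap_iff.1 hf a v)

theorem ContMap.neg {E : CBundle U} {F : CBundle V} {f : ∀ x, E.Fib x →ₗ[ℂ] F.Fib x}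
    (hf : E.ContMap F W f) : E.ContMap F W (fun x => -f x) :=
  (hf.smul (c := fun _ => -1) continuousOn_const).congr fun x _ v => by simp

theorem contMap_zero (E : CBundle U) (F : CBundle V) : E.ContMap F W (fun _ => 0) :=
  contMap_iff.2 fun _ _ => F.contSec_zero

theorem ContMap.sum_finset {E : CBundle U} {F : CBundle V} {ι : Type*} {t : Finset ι}
    {f : ι → ∀ x, E.Fib x →ₗ[ℂ] F.Fib x} (hf : ∀ i ∈ t, E.ContMap F W (f i)) :
    E.ContMap F W (fun x => ∑ i ∈ t, f i x) :=
  contMap_iff.2 fun a v =>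
    (ContSec.sum fun i hi => contMap_iff.1 (hf i hi) a v).congr fun x _ => by
      simp

/-- Extension by zero of a section multiplied by a cut-off function. -/
theorem ContSec.smul_of_tsupport {E : CBundle U} {s : ∀ x, E.Fib x} {c : X → ℂ} {N : Set X}
    (hc : Continuous c) (hN : IsOpen N) (hcN : tsupport c ⊆ N) (hs : E.ContSec s (N ∩ W)) :
    E.ContSec (fun x => c x • s x) W := by
  refine ContSec.of_local fun x hx => ?_
  by_cases hxN : x ∈ N
  · exact ⟨N, hN.mem_nhds hxN, hs.smul hc.continuousOn⟩
  · refine ⟨(tsupport c)ᶜ, (isClosed_tsupport c).isOpen_compl.mem_nhds fun h => hxN (hcN h), ?_⟩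
    refine E.contSec_zero.congr fun y hy => ?_
    rw [image_eq_zero_of_notMem_tsupport hy.1, zero_smul]

theorem ContMap.smul_of_tsupport {E : CBundle U} {F : CBundle V}
    {f : ∀ x, E.Fib x →ₗ[ℂ] F.Fib x} {c : X → ℂ} {N : Set X}
    (hc : Continuous c) (hN : IsOpen N) (hcN : tsupport c ⊆ N) (hf : E.ContMap F (N ∩ W) f) :
    E.ContMap F W (fun x => c x • f x) :=
  contMap_iff.2 fun a v => ContSec.smul_of_tsupport hc hN hcN
    ((contMap_iff.1 hf a v).mono fun _ hy => ⟨hy.2.1, hy.1, hy.2.2⟩)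

theorem finiteDimensional_fib (E : CBundle U) {x : X} (hx : x ∈ U) :
    FiniteDimensional ℂ (E.Fib x) := by
  obtain ⟨a, ha⟩ := E.cover x hx
  exact Module.Finite.of_surjective ((E.chart a).lift x)
    fun v => ⟨(E.chart a).coord x v, (E.chart a).lift_coord x ha v⟩

end CBundle

/-! ### Hermitian inner products -/

namespace InnerProductSpace.Core

variable {V W : Type} [AddCommGroup V] [Module ℂ V] [AddCommGroup W] [Module ℂ W]
  (c : InnerProductSpace.Core ℂ V)

/-- The inner product as a linear map in the second argument. -/
noncomputable def right (v : V) : V →ₗ[ℂ] ℂ where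
  toFun w := c.inner v w
  map_add' w w' := by
    rw [← c.conj_inner_symm, c.add_left, map_add, c.conj_inner_symm, c.conj_inner_symm]
  map_smul' r w := by
    rw [← c.conj_inner_symm, c.smul_left, map_mul, c.conj_inner_symm]; simp

theorem inner_add_right' (u v w : V) : c.inner u (v + w) = c.inner u v + c.inner u w :=
  (c.right u).map_add v w

theorem inner_smul_right' (u v : V) (r : ℂ) : c.inner u (r • v) = r * c.inner u v :=
  (c.right u).map_smul r v

theorem inner_sub_right' (u v w : V) : c.inner u (v - w) = c.inner u v - c.inner u w :=
  (c.right u).map_sub v w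

theorem inner_zero_right' (u : V) : c.inner u 0 = 0 :=
  (c.right u).map_zero

theorem inner_sum_right' {ι : Type*} (t : Finset ι) (u : V) (f : ι → V) :
    c.inner u (∑ i ∈ t, f i) = ∑ i ∈ t, c.inner u (f i) :=
  map_sum (c.right u) f t

theorem inner_sum_left' {ι : Type*} (t : Finset ι) (u : V) (f : ι → V) :
    c.inner (∑ i ∈ t, f i) u = ∑ i ∈ t, c.inner (f i) u := by
  rw [← c.conj_inner_symm, c.inner_sum_right', map_sum]
  simp only [c.conj_inner_symm]

theorem ext_inner (v w : V) (h : ∀ u, c.inner u v = c.inner u w) : v = w := by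
  refine sub_eq_zero.1 (c.definite _ ?_)
  have := h (v - w)
  rwa [← sub_eq_zero, ← c.inner_sub_right'] at this

/-- The pullback of an inner product along an injective linear map. -/
@[reducible]
noncomputable def comap (c : InnerProductSpace.Core ℂ W) (L : V →ₗ[ℂ] W)
    (hL : Function.Injective L) : InnerProductSpace.Core ℂ V where
  inner v w := c.inner (L v) (L w)
  conj_inner_symm _ _ := c.conj_inner_symm _ _
  re_inner_nonneg _ := c.re_inner_nonneg _
  add_left u v w := by simp only [map_add, c.add_left]
  smul_left u v r := by simp only [map_smul, c.smul_left]
  definite v hv := hL (by rw [c.definite _ hv, map_zero])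

/-- The inner product of a Hilbert space. -/
@[reducible]
noncomputable def std (H : Type) [NormedAddCommGroup H] [InnerProductSpace ℂ H] :
    InnerProductSpace.Core ℂ H where
  inner v w := inner ℂ v w
  conj_inner_symm v w := _root_.inner_conj_symm v w
  re_inner_nonneg _ := _root_.inner_self_nonneg
  add_left u v w := _root_.inner_add_left u v w
  smul_left u v r := _root_.inner_smul_left u v r
  definite _ hv := (_root_.inner_self_eq_zero (𝕜 := ℂ) (E := H)).1 hv

end InnerProductSpace.Core

/-! ### Functional calculus of diagonalizable endomorphisms -/

section FunctionalCalculus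

variable {V W : Type} [AddCommGroup V] [Module ℂ V] [AddCommGroup W] [Module ℂ W]

/-- An endomorphism is diagonalizable with real eigenvalues. -/
def RealDiag (M : Module.End ℂ V) : Prop := (⨆ r : ℝ, M.eigenspace (r : ℂ)) = ⊤

theorem RealDiag.ext {M : Module.End ℂ V} (hM : RealDiag M) {N N' : V →ₗ[ℂ] W}
    (h : ∀ r : ℝ, ∀ v, M v = (r : ℂ) • v → N v = N' v) : N = N' := by
  have : (⨆ r : ℝ, M.eigenspace (r : ℂ)) ≤ LinearMap.eqLocus N N' :=
    iSup_le fun r v hv => h r v (Module.End.mem_eigenspace_iff.1 hv)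
  rw [hM] at this
  exact LinearMap.ext fun v => this (Submodule.mem_top (x := v))

/-- The spectral theorem for the Hilbert space that `c` makes of `V`; the eigenvalues are
self-conjugate, hence real. -/
theorem realDiag_of_symmetric [FiniteDimensional ℂ V] (c : InnerProductSpace.Core ℂ V)
    {M : Module.End ℂ V} (hM : ∀ v w, c.inner (M v) w = c.inner v (M w)) : RealDiag M := by
  let _ : NormedAddCommGroup V := c.toNormedAddCommGroup
  let _ : InnerProductSpace ℂ V := InnerProductSpace.ofCore c.toCore
  have hs : LinearMap.IsSymmetric M := hM
  have h1 := hs.orthogonalComplement_iSup_eigenspaces_eq_bot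
  rw [Submodule.orthogonal_eq_bot_iff] at h1
  refine eq_top_iff.2 (h1.symm.le.trans (iSup_le fun μ v hv => ?_))
  by_cases hv0 : v = 0
  · rw [hv0]; exact Submodule.zero_mem _
  have hr := hs.conj_eigenvalue_eq_self (Module.End.hasEigenvalue_of_hasEigenvector ⟨hv, hv0⟩)
  rw [Complex.conj_eq_iff_re] at hr
  exact Submodule.mem_iSup_of_mem μ.re (by rwa [hr])

open Classical in
/-- The endomorphism acting as `f r` on the eigenspace of `M` for the real eigenvalue `r`. -/
noncomputable def fc (f : ℝ → ℝ) (M : Module.End ℂ V) : Module.End ℂ V :=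
  if h : ∃ N : Module.End ℂ V, ∀ r : ℝ, ∀ v, M v = (r : ℂ) • v → N v = (f r : ℂ) • v then
    h.choose else 0

/-- Such an endomorphism exists because there are finitely many real eigenvalues: take p(M) for the
Lagrange interpolation polynomial p of f at them. So the default 0 in `fc` is never met in finite
dimension; `RealDiag` is what makes the endomorphism unique. -/
theorem fc_apply [FiniteDimensional ℂ V] (f : ℝ → ℝ) {M : Module.End ℂ V} {r : ℝ} {v : V}
    (hv : M v = (r : ℂ) • v) : fc f M v = (f r : ℂ) • v := by
  have h : ∃ N : Module.End ℂ V, ∀ r : ℝ, ∀ v, M v = (r : ℂ) • v → N v = (f r : ℂ) • v := by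
    have hfin : {r : ℝ | (r : ℂ) ∈ spectrum ℂ M}.Finite :=
      (Module.End.finite_spectrum M).preimage Complex.ofReal_injective.injOn
    refine ⟨Polynomial.aeval M (Lagrange.interpolate hfin.toFinset (fun r : ℝ => (r : ℂ))
      (fun r => (f r : ℂ))), fun r v hv => ?_⟩
    by_cases hv0 : v = 0
    · simp [hv0]
    have hev : M.HasEigenvector (r : ℂ) v := ⟨Module.End.mem_eigenspace_iff.2 hv, hv0⟩
    rw [Module.End.aeval_apply_of_hasEigenvector hev]
    congr 1
    exact Lagrange.eval_interpolate_at_node _ Complex.ofReal_injective.injOn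
      (hfin.mem_toFinset.2 (Module.End.hasEigenvalue_of_hasEigenvector hev).mem_spectrum)
  rw [fc, dif_pos h]
  exact h.choose_spec r v hv

theorem RealDiag.eq_fc [FiniteDimensional ℂ V] {M N : Module.End ℂ V} (hM : RealDiag M)
    {f : ℝ → ℝ} (h : ∀ r : ℝ, ∀ v, M v = (r : ℂ) • v → N v = (f r : ℂ) • v) : N = fc f M :=
  hM.ext fun r v hv => by rw [h r v hv, fc_apply f hv]

theorem RealDiag.fc_mul [FiniteDimensional ℂ V] {M : Module.End ℂ V} (hM : RealDiag M)
    (f g : ℝ → ℝ) (v : V) : fc f M (fc g M v) = fc (fun r => f r * g r) M v :=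
  LinearMap.congr_fun (hM.ext (N := fc f M ∘ₗ fc g M) fun r v hv => by
    simp only [LinearMap.comp_apply, fc_apply _ hv, map_smul, smul_smul, Complex.ofReal_mul]
    rw [mul_comm]) v

/-- An intertwiner takes r-eigenvectors to r-eigenvectors. This is how functions of h² pass through
h itself and through every homomorphism of HF. -/
theorem RealDiag.fc_intertwine [FiniteDimensional ℂ V] [FiniteDimensional ℂ W]
    {M : Module.End ℂ V} {M' : Module.End ℂ W} (hM : RealDiag M) (φ : V →ₗ[ℂ] W)
    (h : ∀ v, φ (M v) = M' (φ v)) (f : ℝ → ℝ) (v : V) : φ (fc f M v) = fc f M' (φ v) :=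
  LinearMap.congr_fun (hM.ext (N := φ ∘ₗ fc f M) (N' := fc f M' ∘ₗ φ) fun r v hv => by
    have : M' (φ v) = (r : ℂ) • φ v := by rw [← h, hv, map_smul]
    simp only [LinearMap.comp_apply, fc_apply f hv, fc_apply f this, map_smul]) v

/-- The sum of the eigenspaces for the eigenvalues below `μ`. -/
def lowPart (M : Module.End ℂ V) (μ : ℝ) : Submodule ℂ V :=
  ⨆ (r : ℝ) (_ : r < μ), M.eigenspace (r : ℂ)

theorem mem_lowPart_of_eigen {M : Module.End ℂ V} {μ r : ℝ} (hr : r < μ) {v : V}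
    (hv : M v = (r : ℂ) • v) : v ∈ lowPart M μ :=
  Submodule.mem_iSup_of_mem r (Submodule.mem_iSup_of_mem hr (Module.End.mem_eigenspace_iff.2 hv))

theorem lowPart_mono (M : Module.End ℂ V) {μ ν : ℝ} (h : μ ≤ ν) : lowPart M μ ≤ lowPart M ν :=
  iSup₂_le fun _ hr _ hv =>
    mem_lowPart_of_eigen (hr.trans_le h) (Module.End.mem_eigenspace_iff.1 hv)

/-- Linear maps which agree on low eigenvectors agree on the low part. -/
theorem eqOn_lowPart {M : Module.End ℂ V} {μ : ℝ} {N N' : V →ₗ[ℂ] W}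
    (h : ∀ r : ℝ, r < μ → ∀ v, M v = (r : ℂ) • v → N v = N' v) {v : V}
    (hv : v ∈ lowPart M μ) : N v = N' v := by
  have : lowPart M μ ≤ LinearMap.eqLocus N N' :=
    iSup₂_le fun r hr v hv => h r hr v (Module.End.mem_eigenspace_iff.1 hv)
  exact this hv

theorem map_mem_lowPart {M : Module.End ℂ V} {M' : Module.End ℂ W} {φ : V →ₗ[ℂ] W}
    (h : ∀ v, φ (M v) = M' (φ v)) {μ : ℝ} {v : V} (hv : v ∈ lowPart M μ) :
    φ v ∈ lowPart M' μ := by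
  have : lowPart M μ ≤ (lowPart M' μ).comap φ :=
    iSup₂_le fun _ hr _ hv => mem_lowPart_of_eigen hr (by
      rw [← h, Module.End.mem_eigenspace_iff.1 hv, map_smul])
  exact this hv

/-- Cut-offs that vanish from μ on push arbitrary vectors into the region where identities in HF
hold exactly. -/
theorem RealDiag.fc_mem_lowPart [FiniteDimensional ℂ V] {M : Module.End ℂ V} (hM : RealDiag M)
    {f : ℝ → ℝ} {μ : ℝ} (hf : ∀ r, μ ≤ r → f r = 0) (v : V) : fc f M v ∈ lowPart M μ := by
  have : (⨆ r : ℝ, M.eigenspace (r : ℂ)) ≤ (lowPart M μ).comap (fc f M) := by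
    refine iSup_le fun r v hv => ?_
    have hv := Module.End.mem_eigenspace_iff.1 hv
    rw [Submodule.mem_comap, fc_apply f hv]
    rcases lt_or_ge r μ with h | h
    · exact Submodule.smul_mem _ _ (mem_lowPart_of_eigen h hv)
    · simp [hf r h]
  rw [hM] at this
  exact this Submodule.mem_top

theorem fc_of_mem_lowPart [FiniteDimensional ℂ V] {M : Module.End ℂ V} {f : ℝ → ℝ} {μ : ℝ}
    (hf : ∀ r < μ, f r = 1) {v : V} (hv : v ∈ lowPart M μ) : fc f M v = v :=
  eqOn_lowPart (N := fc f M) (N' := LinearMap.id) (fun r hr v hv => by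
    simp [fc_apply f hv, hf r hr]) hv

theorem RealDiag.fc_injective [FiniteDimensional ℂ V] {M : Module.End ℂ V} (hM : RealDiag M)
    {f : ℝ → ℝ} (hf : ∀ r : ℝ, (∃ v ≠ 0, M v = (r : ℂ) • v) → f r ≠ 0) :
    Function.Injective (fc f M) := by
  have h : (fc (fun r => (f r)⁻¹) M) ∘ₗ fc f M = LinearMap.id := hM.ext fun r v hv => by
    by_cases hv0 : v = 0
    · simp [hv0]
    have := hf r ⟨v, hv0, hv⟩
    simp only [LinearMap.comp_apply, fc_apply _ hv, map_smul, smul_smul, LinearMap.id_apply]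
    rw [← Complex.ofReal_mul, mul_inv_cancel₀ this, Complex.ofReal_one, one_smul]
  exact fun v w hvw => by
    rw [← LinearMap.id_apply (R := ℂ) v, ← LinearMap.id_apply (R := ℂ) w, ← h,
      LinearMap.comp_apply, LinearMap.comp_apply, hvw]

end FunctionalCalculus

section EuclideanFC

/-- The calculus `fc` is purely algebraic; its continuity in the operator is borrowed from the
continuous functional calculus. The two agree because on a finite spectrum f coincides with a
polynomial. -/
theorem cfc_apply_eigenvector {H : Type} [NormedAddCommGroup H] [InnerProductSpace ℂ H]
    [FiniteDimensional ℂ H] [CompleteSpace H] {A : H →L[ℂ] H} (hA : IsSelfAdjoint A) (f : ℝ → ℝ)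
    {r : ℝ} {v : H} (hv : A v = (r : ℂ) • v) : cfc f A v = (f r : ℂ) • v := by
  by_cases hv0 : v = 0
  · simp [hv0]
  have hspec : spectrum ℂ A = spectrum ℂ (A : H →ₗ[ℂ] H) :=
    AlgEquiv.spectrum_eq (Module.End.toContinuousLinearMap H (𝕜 := ℂ)) (A : H →ₗ[ℂ] H)
  have hfin : (spectrum ℝ A).Finite := by
    refine ((Module.End.finite_spectrum (A : H →ₗ[ℂ] H)).preimage
      Complex.ofReal_injective.injOn).subset fun r hr => ?_
    rw [mem_preimage, ← hspec]
    exact (spectrum.algebraMap_mem_iff ℂ).2 hr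
  have hr : r ∈ spectrum ℝ A := by
    rw [← spectrum.algebraMap_mem_iff ℂ, hspec]
    exact (Module.End.hasEigenvalue_of_hasEigenvector
      ⟨Module.End.mem_eigenspace_iff.2 hv, hv0⟩).mem_spectrum
  set q : Polynomial ℝ := Lagrange.interpolate hfin.toFinset id f with hq
  have heq : (spectrum ℝ A).EqOn f q.eval := fun t ht =>
    (Lagrange.eval_interpolate_at_node (v := id) f Function.injective_id.injOn
      (hfin.mem_toFinset.2 ht)).symm
  rw [cfc_congr heq, cfc_polynomial q A, heq hr]
  induction q using Polynomial.induction_on' with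
  | add p q hp hq =>
    simp only [map_add, Polynomial.eval_add, Complex.ofReal_add, add_smul,
      add_apply, hp, hq]
  | monomial n t =>
    have hpow : (A ^ n) v = ((r ^ n : ℝ) : ℂ) • v := by
      induction n with
      | zero => simp
      | succ n ih =>
        rw [pow_succ, mul_apply_eq_comp, hv, map_smul, ih, smul_smul,
          ← Complex.ofReal_mul, pow_succ']
    rw [Polynomial.aeval_monomial, mul_apply_eq_comp, hpow]
    simp only [Polynomial.eval_monomial]
    rw [Complex.ofReal_mul, mul_smul, Algebra.algebraMap_eq_smul_one, smul_apply, one_apply_eq_self]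
    rfl

end EuclideanFC

/-! ### Orthonormal frames -/

/-- An orthonormal basis for an inner product. -/
structure IsFrame {V : Type} [AddCommGroup V] [Module ℂ V] (c : InnerProductSpace.Core ℂ V)
    {ι : Type} [Fintype ι] [DecidableEq ι] (e : ι → V) : Prop where
  orth : ∀ i j, c.inner (e i) (e j) = if i = j then 1 else 0
  expand : ∀ v, v = ∑ i, c.inner (e i) v • e i

section Frame

variable {V W : Type} [AddCommGroup V] [Module ℂ V] [AddCommGroup W] [Module ℂ W]
  {ι : Type} [Fintype ι] [DecidableEq ι] {c : InnerProductSpace.Core ℂ V}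
  {d : InnerProductSpace.Core ℂ W} {e : ι → V}

theorem isFrame_of_card [FiniteDimensional ℂ V]
    (he : ∀ i j, c.inner (e i) (e j) = if i = j then 1 else 0)
    (hcard : Fintype.card ι = Module.finrank ℂ V) : IsFrame c e := by
  have hli : LinearIndependent ℂ e := by
    rw [Fintype.linearIndependent_iff]
    intro g hg i
    have := congrArg (c.inner (e i)) hg
    simpa [c.inner_sum_right', c.inner_smul_right', c.inner_zero_right', he] using this
  have hspan := hli.span_eq_top_of_card_eq_finrank' hcard
  refine ⟨he, fun v => ?_⟩
  rw [← sub_eq_zero]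
  refine c.definite _ ?_
  set w := v - ∑ i, c.inner (e i) v • e i with hw
  have horth : ∀ i, c.inner w (e i) = 0 := fun i => by
    rw [← c.conj_inner_symm, hw]
    simp [c.inner_sub_right', c.inner_sum_right', c.inner_smul_right', he]
  have : (⊤ : Submodule ℂ V) ≤ LinearMap.ker (c.right w) := by
    rw [← hspan, Submodule.span_le]
    rintro _ ⟨i, rfl⟩
    exact horth i
  exact this (Submodule.mem_top (x := w))

theorem IsFrame.inner_eq (he : IsFrame c e) (v w : V) :
    c.inner v w = ∑ i, c.inner v (e i) * c.inner (e i) w := by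
  conv_lhs => rw [he.expand w]
  simp [c.inner_sum_right', c.inner_smul_right', mul_comm]

theorem IsFrame.map_expand (he : IsFrame c e) (f : V →ₗ[ℂ] W) (v : V) :
    f v = ∑ i, c.inner (e i) v • f (e i) := by
  conv_lhs => rw [he.expand v]
  simp

/-- The isomorphism from a Euclidean space given by a frame. -/
noncomputable def frameMap (e : ι → V) : EuclideanSpace ℂ ι →ₗ[ℂ] V where
  toFun w := ∑ i, w i • e i
  map_add' v w := by simp [add_smul, Finset.sum_add_distrib]
  map_smul' r w := by simp [Finset.smul_sum, smul_smul]

/-- The coordinates with respect to a frame. -/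
noncomputable def frameCoord (c : InnerProductSpace.Core ℂ V) (e : ι → V) :
    V →ₗ[ℂ] EuclideanSpace ℂ ι where
  toFun v := WithLp.toLp 2 fun i => c.inner (e i) v
  map_add' v w := by ext i; simp [c.inner_add_right']
  map_smul' r w := by ext i; simp [c.inner_smul_right']

theorem IsFrame.frameMap_coord (he : IsFrame c e) (v : V) : frameMap e (frameCoord c e v) = v :=
  (he.expand v).symm

theorem IsFrame.frameCoord_map (he : IsFrame c e) (w : EuclideanSpace ℂ ι) :
    frameCoord c e (frameMap e w) = w := by
  ext i
  change c.inner (e i) (∑ j, w j • e j) = w i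
  simp [he.orth, c.inner_sum_right', c.inner_smul_right']

theorem IsFrame.inner_frameCoord (he : IsFrame c e) (v w : V) :
    inner ℂ (frameCoord c e v) (frameCoord c e w) = c.inner v w := by
  rw [he.inner_eq v w]
  simp [PiLp.inner_apply, frameCoord, c.conj_inner_symm, mul_comm]

end Frame

/-! ### Continuous frames, adjoints and functional calculus in Hermitian bundles. -/

namespace HBundle

variable {X : Type u} [TopologicalSpace X] {U V W : Set X}

theorem _root_.CBundle.ContSec.inner {E : HBundle U} {s t : ∀ x, E.Fib x}
    (hs : E.ContSec s W) (ht : E.ContSec t W) (hW : W ⊆ U) :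
    ContinuousOn (fun x => (E.metric x).inner (s x) (t x)) W := by
  intro x hx
  obtain ⟨a, ha⟩ := E.cover x (hW hx)
  have hN : (E.chart a).dom ∈ 𝓝 x := (E.chart a).isOpen_dom.mem_nhds ha
  let b := Module.finBasis ℂ (E.chart a).Model
  have hc : ∀ (u : ∀ x, E.Fib x) (_ : E.ContSec u W) i,
      ContinuousWithinAt (fun x => b.repr ((E.chart a).coord x (u x)) i) W x := fun u hu i =>
    (LinearMap.continuous_of_finiteDimensional (b.coord i)).continuousAt.comp_continuousWithinAt
      (hu x hx a ha)
  have hg : ∀ v w, ContinuousWithinAt (fun x => (E.metric x).inner ((E.chart a).lift x v)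
      ((E.chart a).lift x w)) W x := fun v w => by
    have := E.cont_metric a v w x ⟨ha, hW hx⟩
    rw [inter_comm] at this
    exact ((continuousWithinAt_inter hN).1 this).mono hW
  have key : ContinuousWithinAt (fun x => ∑ i, ∑ j,
      (starRingEnd ℂ) (b.repr ((E.chart a).coord x (s x)) i) *
        (b.repr ((E.chart a).coord x (t x)) j *
      (E.metric x).inner ((E.chart a).lift x (b i)) ((E.chart a).lift x (b j)))) W x := by
    refine tendsto_finsetSum _ fun i _ => tendsto_finsetSum _ fun j _ => ?_
    exact (Complex.continuous_conj.continuousAt.comp_continuousWithinAt (hc s hs i)).mul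
      ((hc t ht j).mul (hg _ _))
  have hexp : ∀ y ∈ (E.chart a).dom, ∀ u : E.Fib y,
      u = ∑ i, b.repr ((E.chart a).coord y u) i • (E.chart a).lift y (b i) := fun y hy u => by
    conv_lhs => rw [← (E.chart a).lift_coord y hy u, ← b.sum_repr ((E.chart a).coord y u)]
    rw [map_sum]
    simp only [map_smul]
  have heq : ∀ y ∈ (E.chart a).dom, (E.metric y).inner (s y) (t y) = ∑ i, ∑ j,
      (starRingEnd ℂ) (b.repr ((E.chart a).coord y (s y)) i) *
        (b.repr ((E.chart a).coord y (t y)) j *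
      (E.metric y).inner ((E.chart a).lift y (b i)) ((E.chart a).lift y (b j))) := fun y hy => by
    conv_lhs => rw [hexp y hy (s y), hexp y hy (t y)]
    simp only [InnerProductSpace.Core.inner_sum_left', InnerProductSpace.Core.inner_sum_right',
      (E.metric y).smul_left, InnerProductSpace.Core.inner_smul_right', Finset.mul_sum]
    rw [Finset.sum_comm]
    exact Finset.sum_congr rfl fun i _ => Finset.sum_congr rfl fun j _ => by ring
  refine key.congr_of_eventuallyEq ?_ (heq x ha)
  filter_upwards [mem_nhdsWithin_of_mem_nhds hN] with y hy using heq y hy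

/-- Gram-Schmidt with parameters: the coefficients are continuous on W and the residual vector
vanishes nowhere, by linear independence. The clause about spans is carried along because the next
step needs it to see that its residual is nonzero. -/
theorem exists_orthonormal (E : HBundle U) (hW : W ⊆ U) : ∀ (n : ℕ) (s : Fin n → ∀ x, E.Fib x),
    (∀ i, E.ContSec (s i) W) → (∀ x ∈ W, LinearIndependent ℂ fun i => s i x) →
    ∃ e : Fin n → ∀ x, E.Fib x, (∀ i, E.ContSec (e i) W) ∧ ∀ x ∈ W,
      (∀ i j, (E.metric x).inner (e i x) (e j x) = if i = j then 1 else 0) ∧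
      ∀ i, e i x ∈ Submodule.span ℂ (range fun i => s i x) := by
  intro n
  induction n with
  | zero => exact fun s _ _ => ⟨s, fun i => i.elim0, fun _ _ => ⟨fun i => i.elim0, fun i => i.elim0⟩⟩
  | succ n ih =>
    intro s hs hli
    obtain ⟨e, he, ho⟩ := ih (fun i => s i.castSucc) (fun i => hs _)
      (fun x hx => (hli x hx).comp _ (Fin.castSucc_injective n))
    let w : ∀ x, E.Fib x := fun x =>
      s (Fin.last n) x - ∑ i, (E.metric x).inner (e i x) (s (Fin.last n) x) • e i x
    have hw : E.ContSec w W := (hs _).sub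
      (CBundle.ContSec.sum fun i _ => CBundle.ContSec.smul ((he i).inner (hs _) hW) (he i))
    have hspan : ∀ x ∈ W, ∀ i, e i x ∈ Submodule.span ℂ (range fun i => s i x) := fun x hx i =>
      Submodule.span_mono (by rintro _ ⟨j, rfl⟩; exact ⟨j.castSucc, rfl⟩) ((ho x hx).2 i)
    have hwspan : ∀ x ∈ W, w x ∈ Submodule.span ℂ (range fun i => s i x) := fun x hx =>
      Submodule.sub_mem _ (Submodule.subset_span ⟨Fin.last n, rfl⟩)
        (Submodule.sum_mem _ fun i _ => Submodule.smul_mem _ _ (hspan x hx i))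
    have hw0 : ∀ x ∈ W, w x ≠ 0 := fun x hx h0 => by
      have hn : Fin.last n ∉ range (Fin.castSucc : Fin n → Fin (n + 1)) := by
        rintro ⟨j, hj⟩; exact (Fin.castSucc_lt_last j).ne hj
      refine (hli x hx).notMem_span_image hn ?_
      rw [← range_comp]
      have : s (Fin.last n) x = ∑ i, (E.metric x).inner (e i x) (s (Fin.last n) x) • e i x :=
        sub_eq_zero.1 h0
      change s (Fin.last n) x ∈ _
      rw [this]
      exact Submodule.sum_mem _ fun i _ => Submodule.smul_mem _ _ ((ho x hx).2 i)
    have hew : ∀ x ∈ W, ∀ i, (E.metric x).inner (e i x) (w x) = 0 := fun x hx i => by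
      simp only [w, InnerProductSpace.Core.inner_sub_right', InnerProductSpace.Core.inner_sum_right',
        InnerProductSpace.Core.inner_smul_right', (ho x hx).1]
      simp
    have hwe : ∀ x ∈ W, ∀ i, (E.metric x).inner (w x) (e i x) = 0 := fun x hx i => by
      rw [← (E.metric x).conj_inner_symm, hew x hx i, map_zero]
    let q : X → ℝ := fun x => ((E.metric x).inner (w x) (w x)).re
    have hq : ContinuousOn q W := Complex.continuous_re.comp_continuousOn (hw.inner hw hW)
    have hwq : ∀ x, (E.metric x).inner (w x) (w x) = (q x : ℂ) := fun x =>
      (Complex.conj_eq_iff_re.1 ((E.metric x).conj_inner_symm (w x) (w x))).symm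
    have hqpos : ∀ x ∈ W, 0 < q x := fun x hx =>
      lt_of_le_of_ne ((E.metric x).re_inner_nonneg (w x)) fun h =>
        hw0 x hx ((E.metric x).definite _ (by rw [hwq, ← h, Complex.ofReal_zero]))
    let r : X → ℝ := fun x => (√(q x))⁻¹
    have hr : ContinuousOn r W :=
      (Real.continuous_sqrt.comp_continuousOn hq).inv₀ fun x hx => (Real.sqrt_pos.2 (hqpos x hx)).ne'
    have hrq : ∀ x ∈ W, r x * (r x * q x) = 1 := fun x hx => by
      have h1 := Real.mul_self_sqrt (hqpos x hx).le
      have h2 := (Real.sqrt_pos.2 (hqpos x hx)).ne'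
      change (√(q x))⁻¹ * ((√(q x))⁻¹ * q x) = 1
      field_simp
      rw [sq, h1]
    let u : ∀ x, E.Fib x := fun x => (r x : ℂ) • w x
    refine ⟨Fin.snoc (α := fun _ => ∀ x, E.Fib x) e u, ?_, fun x hx => ⟨?_, ?_⟩⟩
    · refine Fin.lastCases ?_ fun i => ?_
      · rw [Fin.snoc_last]
        exact CBundle.ContSec.smul (Complex.continuous_ofReal.comp_continuousOn hr) hw
      · rw [Fin.snoc_castSucc]; exact he i
    · have hlast : ∀ i : Fin n, i.castSucc ≠ Fin.last n := fun i => (Fin.castSucc_lt_last i).ne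
      refine Fin.lastCases (Fin.lastCases ?_ fun j => ?_) fun i => Fin.lastCases ?_ fun j => ?_
      · simp only [Fin.snoc_last, if_true, u, (E.metric x).smul_left,
          InnerProductSpace.Core.inner_smul_right', hwq, Complex.conj_ofReal]
        exact_mod_cast hrq x hx
      · simp only [Fin.snoc_last, Fin.snoc_castSucc, u, (E.metric x).smul_left, hwe x hx,
          (hlast j).symm, mul_zero, if_false]
      · simp only [Fin.snoc_last, Fin.snoc_castSucc, u, InnerProductSpace.Core.inner_smul_right',
          hew x hx, hlast i, mul_zero, if_false]
      · simp only [Fin.snoc_castSucc, (ho x hx).1, Fin.castSucc_inj]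
    · refine Fin.lastCases ?_ fun i => ?_
      · simp only [Fin.snoc_last]; exact Submodule.smul_mem _ _ (hwspan x hx)
      · simp only [Fin.snoc_castSucc]; exact hspan x hx i

theorem exists_frame (E : HBundle U) {x₀ : X} (hx₀ : x₀ ∈ U) :
    ∃ (n : ℕ) (e : Fin n → ∀ x, E.Fib x) (N : Set X), IsOpen N ∧ x₀ ∈ N ∧
      (∀ i, E.ContSec (e i) (N ∩ U)) ∧ ∀ x ∈ N ∩ U, IsFrame (E.metric x) fun i => e i x := by
  obtain ⟨a, ha⟩ := E.cover x₀ hx₀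
  let b := Module.finBasis ℂ (E.chart a).Model
  have hinj : ∀ x ∈ (E.chart a).dom, Function.Injective ((E.chart a).lift x) := fun x hx =>
    Function.LeftInverse.injective ((E.chart a).coord_lift x hx)
  obtain ⟨e, he, ho⟩ := E.exists_orthonormal (W := (E.chart a).dom ∩ U) inter_subset_right _
    (fun i x => (E.chart a).lift x (b i)) (fun i => E.contSec_lift a (b i) subset_rfl)
    (fun x hx => b.linearIndependent.map' _ (LinearMap.ker_eq_bot.2 (hinj x hx.1)))
  refine ⟨_, e, (E.chart a).dom, (E.chart a).isOpen_dom, ha, he, fun x hx => ?_⟩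
  have := E.finiteDimensional_fib hx.2
  refine isFrame_of_card (ho x hx).1 ?_
  rw [Fintype.card_fin]
  exact (LinearEquiv.ofBijective ((E.chart a).lift x) ⟨hinj x hx.1, fun v =>
    ⟨(E.chart a).coord x v, (E.chart a).lift_coord x hx.1 v⟩⟩).finrank_eq

/-- A map into any bundle is continuous if its values on a frame are. -/
theorem contMap_of_frame {E : HBundle U} {F : CBundle V} {f : ∀ x, E.Fib x →ₗ[ℂ] F.Fib x}
    {ι : Type} [Fintype ι] [DecidableEq ι] {e : ι → ∀ x, E.Fib x} (hW : W ⊆ U)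
    (he : ∀ i, E.ContSec (e i) W) (hfr : ∀ x ∈ W, IsFrame (E.metric x) fun i => e i x)
    (hf : ∀ i, F.ContSec (fun x => f x (e i x)) W) : E.ContMap F W f :=
  CBundle.ContMap.of_contSec hW fun W' hW' s hs => by
    refine CBundle.ContSec.congr (CBundle.ContSec.sum (t := Finset.univ) fun i _ =>
      CBundle.ContSec.smul (((he i).mono hW').inner hs (hW'.trans hW)) ((hf i).mono hW')) ?_
    exact fun x hx => (hfr x (hW' hx)).map_expand _ _

theorem contSec_of_frame {E : HBundle U} {s : ∀ x, E.Fib x}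
    {ι : Type} [Fintype ι] [DecidableEq ι] {e : ι → ∀ x, E.Fib x}
    (he : ∀ i, E.ContSec (e i) W) (hfr : ∀ x ∈ W, IsFrame (E.metric x) fun i => e i x)
    (hs : ∀ i, ContinuousOn (fun x => (E.metric x).inner (e i x) (s x)) W) : E.ContSec s W :=
  (CBundle.ContSec.sum (t := Finset.univ) fun i _ => CBundle.ContSec.smul (hs i) (he i)).congr
    fun x hx => (hfr x hx).expand _

/-- In an orthonormal basis e the adjoint is w ↦ Σ ⟨f eᵢ, w⟩ eᵢ. -/
theorem exists_adjoint (E : HBundle U) (F : HBundle V) {x : X} (hx : x ∈ U)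
    (f : E.Fib x →ₗ[ℂ] F.Fib x) : ∃ g : F.Fib x →ₗ[ℂ] E.Fib x,
      ∀ v w, (F.metric x).inner (f v) w = (E.metric x).inner v (g w) := by
  obtain ⟨n, e, N, -, hxN, -, hfr⟩ := E.exists_frame hx
  have hfr := hfr x ⟨hxN, hx⟩
  refine ⟨∑ i, ((F.metric x).right (f (e i x))).smulRight (e i x), fun v w => ?_⟩
  conv_lhs => rw [hfr.expand v]
  simp only [map_sum, map_smul, InnerProductSpace.Core.inner_sum_left', (F.metric x).smul_left,
    (E.metric x).conj_inner_symm, LinearMap.sum_apply, LinearMap.smulRight_apply,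
    InnerProductSpace.Core.inner_sum_right', InnerProductSpace.Core.inner_smul_right']
  exact Finset.sum_congr rfl fun i _ => mul_comm _ _

open Classical in
/-- The adjoint of a family of maps between Hermitian bundles. -/
noncomputable def adj (E : HBundle U) (F : HBundle V) (f : ∀ x, E.Fib x →ₗ[ℂ] F.Fib x) (x : X) :
    F.Fib x →ₗ[ℂ] E.Fib x :=
  if h : x ∈ U then (E.exists_adjoint F h (f x)).choose else 0

theorem inner_adj (E : HBundle U) (F : HBundle V) (f : ∀ x, E.Fib x →ₗ[ℂ] F.Fib x) {x : X}
    (hx : x ∈ U) (v w) :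
    (F.metric x).inner (f x v) w = (E.metric x).inner v (E.adj F f x w) := by
  rw [adj, dif_pos hx]
  exact (E.exists_adjoint F hx (f x)).choose_spec v w

/-- The coefficients of g s in a frame e of E are ⟨f eᵢ, s⟩, which are continuous because f is. -/
theorem contMap_of_adjoint {E : HBundle U} {F : HBundle V} {f : ∀ x, E.Fib x →ₗ[ℂ] F.Fib x}
    {g : ∀ x, F.Fib x →ₗ[ℂ] E.Fib x} (hU : W ⊆ U) (hV : W ⊆ V)
    (hf : E.ContMap F.toCBundle W f)
    (h : ∀ x ∈ W, ∀ v w, (F.metric x).inner (f x v) w = (E.metric x).inner v (g x w)) :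
    F.ContMap E.toCBundle W g := by
  refine CBundle.ContMap.of_local fun x hx => ?_
  obtain ⟨n, e, N, hN, hxN, he, hfr⟩ := E.exists_frame (hU hx)
  refine ⟨N, hN.mem_nhds hxN, ?_⟩
  have hNW : N ∩ W ⊆ N ∩ U := inter_subset_inter_right _ hU
  refine CBundle.ContMap.of_contSec (inter_subset_right.trans hV) fun W' hW' s hs => ?_
  refine contSec_of_frame (fun i => (he i).mono (hW'.trans hNW))
    (fun x hx => hfr x (hNW (hW' hx))) fun i => ?_
  refine ContinuousOn.congr (CBundle.ContSec.inner (hf.contSec' (hW'.trans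
    (inter_subset_right.trans hU)) (hW'.trans inter_subset_right)
    ((he i).mono (hW'.trans hNW))) hs (hW'.trans (inter_subset_right.trans hV))) fun y hy => ?_
  exact (h y (hW' hy).2 _ _).symm

/-- The functional calculus of a symmetric bundle endomorphism is continuous. -/
theorem contMap_fc {E : HBundle U} {M : ∀ x, E.Fib x →ₗ[ℂ] E.Fib x}
    (hM : E.ContMap E.toCBundle U M)
    (hsymm : ∀ x ∈ U, ∀ v w, (E.metric x).inner (M x v) w = (E.metric x).inner v (M x w))
    {f : ℝ → ℝ} (hf : Continuous f) : E.ContMap E.toCBundle U fun x => fc f (M x) := by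
  refine CBundle.ContMap.of_local fun x₀ hx₀ => ?_
  obtain ⟨n, e, N, hN, hxN, he, hfr⟩ := E.exists_frame hx₀
  refine ⟨N, hN.mem_nhds hxN, ?_⟩
  -- In an orthonormal frame M becomes a continuous family of self-adjoint matrices, to which the
  -- continuous functional calculus applies.
  let A : X → EuclideanSpace ℂ (Fin n) →L[ℂ] EuclideanSpace ℂ (Fin n) := fun x =>
    LinearMap.toContinuousLinearMap (frameCoord (E.metric x) (fun i => e i x) ∘ₗ M x ∘ₗ
      frameMap fun i => e i x)
  have hA : ContinuousOn A (N ∩ U) := by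
    rw [continuousOn_clm_apply]
    intro w
    refine (PiLp.continuous_toLp 2 _).comp_continuousOn (continuousOn_pi.2 fun i => ?_)
    refine (he i).inner (hM.contSec' inter_subset_right inter_subset_right ?_) inter_subset_right
    exact CBundle.ContSec.sum (t := Finset.univ) fun j _ =>
      CBundle.ContSec.smul (c := fun _ => w j) continuousOn_const (he j)
  have hsa : ∀ x ∈ N ∩ U, IsSelfAdjoint (A x) := fun x hx => by
    rw [ContinuousLinearMap.isSelfAdjoint_iff_isSymmetric]
    intro v w
    have hF := hfr x hx
    change inner ℂ (frameCoord _ _ (M x (frameMap (fun i => e i x) v))) w =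
      inner ℂ v (frameCoord _ _ (M x (frameMap (fun i => e i x) w)))
    conv_lhs => rw [← hF.frameCoord_map w]
    conv_rhs => rw [← hF.frameCoord_map v]
    rw [hF.inner_frameCoord, hF.inner_frameCoord, hsymm x hx.2]
  have hcfc : ContinuousOn (fun x => cfc f (A x)) (N ∩ U) := fun x hx => by
    -- Near x all spectra lie in one compact ball. The factor ‖1‖ in the radius allows for fibre
    -- dimension 0, where 1 = 0.
    refine ContinuousWithinAt.cfc (s := Metric.closedBall 0
      ((‖A x‖ + 1) * ‖(1 : EuclideanSpace ℂ (Fin n) →L[ℂ] EuclideanSpace ℂ (Fin n))‖))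
      (isCompact_closedBall _ _) f hx (hA x hx) ?_ ?_ hf.continuousOn
    · have := (hA x hx).norm.eventually_lt continuousWithinAt_const (lt_add_one ‖A x‖)
      filter_upwards [this] with y hy
      exact (spectrum.subset_closedBall_norm_mul (𝕜 := ℝ) (A y)).trans
        (Metric.closedBall_subset_closedBall (by gcongr))
    · filter_upwards [self_mem_nhdsWithin] with y hy using hsa y hy
  have hkey : ∀ x ∈ N ∩ U, ∀ i, fc f (M x) (e i x) =
      ∑ j, (cfc f (A x) (EuclideanSpace.single i 1)) j • e j x := fun x hx i => by
    have hF := hfr x hx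
    have := E.finiteDimensional_fib hx.2
    have hdiag : RealDiag (M x) := realDiag_of_symmetric (E.metric x) (hsymm x hx.2)
    have h1 : frameMap (fun i => e i x) ∘ₗ (cfc f (A x)).toLinearMap ∘ₗ
        frameCoord (E.metric x) (fun i => e i x) = fc f (M x) := hdiag.eq_fc fun r v hv => by
      have : A x (frameCoord (E.metric x) (fun i => e i x) v) =
          (r : ℂ) • frameCoord (E.metric x) (fun i => e i x) v := by
        change frameCoord _ _ (M x (frameMap _ (frameCoord _ _ v))) = _
        rw [hF.frameMap_coord, hv, map_smul]
      simp only [LinearMap.comp_apply, ContinuousLinearMap.coe_coe]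
      rw [cfc_apply_eigenvector (hsa x hx) f this, map_smul, hF.frameMap_coord]
    rw [← h1]
    have h2 : frameCoord (E.metric x) (fun i => e i x) (e i x) = EuclideanSpace.single i 1 := by
      ext j
      simp [frameCoord, hF.orth]
    simp only [LinearMap.comp_apply, h2]
    rfl
  refine contMap_of_frame inter_subset_right he hfr fun i => ?_
  refine CBundle.ContSec.congr (CBundle.ContSec.sum (t := Finset.univ) fun j _ =>
    CBundle.ContSec.smul ?_ (he j)) fun x hx => hkey x hx i
  exact (PiLp.continuous_apply 2 _ j).comp_continuousOn (hcfc.clm_apply continuousOn_const)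

end HBundle

/-! ### Partitions of unity, extensions, metrics and inverses -/

/-- The functions are square roots of a partition of unity. One factor `r k` goes into an embedding
in a product and the other into its left inverse, or into the second argument of an inner product;
the squares then sum to one. -/
theorem exists_finite_partition {X : Type u} [TopologicalSpace X] [CompactSpace X] [T2Space X]
    (N : X → Set X) (hN : ∀ x, IsOpen (N x)) (hxN : ∀ x, x ∈ N x) :
    ∃ (m : ℕ) (p : Fin m → X) (r : Fin m → X → ℝ), (∀ k, Continuous (r k)) ∧
      (∀ k, tsupport (r k) ⊆ N (p k)) ∧ ∀ x, ∑ k, r k x * r k x = 1 := by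
  obtain ⟨t, ht⟩ := isCompact_univ.elim_nhds_subcover N fun x _ => (hN x).mem_nhds (hxN x)
  let p : Fin t.card → X := fun k => t.equivFin.symm k
  have hcov : (univ : Set X) ⊆ ⋃ k, N (p k) := fun x hx => by
    obtain ⟨y, hy, hxy⟩ := mem_iUnion₂.1 (ht.2 hx)
    exact mem_iUnion.2 ⟨t.equivFin ⟨y, hy⟩, by simpa [p] using hxy⟩
  obtain ⟨f, hf⟩ := PartitionOfUnity.exists_isSubordinate isClosed_univ (fun k => N (p k))
    (fun k => hN _) hcov
  refine ⟨t.card, p, fun k x => √(f k x), fun k => Real.continuous_sqrt.comp (f k).continuous,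
    fun k => ?_, fun x => ?_⟩
  · refine (closure_mono fun x hx => ?_).trans (hf k)
    intro h0
    exact hx (by change √(f k x) = 0; rw [show f k x = 0 from h0, Real.sqrt_zero])
  · have h1 := f.sum_eq_one (mem_univ x)
    rw [finsum_eq_sum_of_fintype] at h1
    rw [← h1]
    exact Finset.sum_congr rfl fun k _ => Real.mul_self_sqrt (f.nonneg k x)

theorem tsupport_ofReal_subset {X : Type u} [TopologicalSpace X] (r : X → ℝ) :
    tsupport (fun x => (r x : ℂ)) ⊆ tsupport r :=
  closure_mono fun x hx h0 => hx (by
    change ((r x : ℝ) : ℂ) = 0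
    rw [show r x = 0 from h0, Complex.ofReal_zero])

theorem tsupport_ofReal_mul_subset {X : Type u} [TopologicalSpace X] (r s : X → ℝ) :
    tsupport (fun x => ((r x * s x : ℝ) : ℂ)) ⊆ tsupport r :=
  closure_mono fun x hx h0 => hx (by
    change ((r x * s x : ℝ) : ℂ) = 0
    rw [show r x = 0 from h0, zero_mul, Complex.ofReal_zero])

/-- The trivial bundle. -/
abbrev CBundle.triv (X : Type u) [TopologicalSpace X] (F : Type) [NormedAddCommGroup F]
    [NormedSpace ℂ F] [FiniteDimensional ℂ F] : CBundle (univ : Set X) where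
  Fib _ := F
  Idx := PUnit
  chart _ :=
    { Model := F
      dom := univ
      isOpen_dom := isOpen_univ
      coord := fun _ => LinearMap.id
      lift := fun _ => LinearMap.id
      coord_lift := fun _ _ _ => rfl
      lift_coord := fun _ _ _ => rfl }
  cover _ _ := ⟨PUnit.unit, trivial⟩
  compat _ _ _ := continuousOn_const

namespace CBundle

variable {X : Type u} [TopologicalSpace X] {U V W : Set X}

section Triv

variable {F : Type} [NormedAddCommGroup F] [NormedSpace ℂ F] [FiniteDimensional ℂ F]
  {G : Type} [NormedAddCommGroup G] [NormedSpace ℂ G] [FiniteDimensional ℂ G]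

theorem contSec_triv {s : X → F} : (triv X F).ContSec s W ↔ ContinuousOn s W :=
  ⟨fun h x hx => h x hx PUnit.unit trivial, fun h x hx _ _ => h x hx⟩

theorem contMap_triv_left {E : CBundle U} {f : ∀ x, F →ₗ[ℂ] E.Fib x} :
    (triv X F).ContMap E W f ↔ ∀ v, E.ContSec (fun x => f x v) W := by
  refine contMap_iff.trans ⟨fun h v => (h PUnit.unit v).mono fun x hx => ⟨trivial, hx⟩,
    fun h a v => (h v).mono inter_subset_right⟩

theorem contMap_triv {f : X → F →L[ℂ] G} :
    (triv X F).ContMap (triv X G) W (fun x => (f x : F →ₗ[ℂ] G)) ↔ ContinuousOn f W := by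
  refine contMap_triv_left.trans (Iff.trans ?_ continuousOn_clm_apply.symm)
  exact forall_congr' fun v => contSec_triv

theorem contMap_coord (E : CBundle U) (a : E.Idx) :
    E.ContMap (triv X (E.chart a).Model) ((E.chart a).dom ∩ U) (E.chart a).coord :=
  ContMap.of_contSec inter_subset_right fun _ hW' _ hs =>
    contSec_triv.2 fun x hx => hs x hx a (hW' hx).1

theorem contMap_lift (E : CBundle U) (a : E.Idx) :
    (triv X (E.chart a).Model).ContMap E ((E.chart a).dom ∩ U) (E.chart a).lift :=
  contMap_triv_left.2 fun v => E.contSec_lift a v subset_rfl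

end Triv

/-- A bundle map over a closed subset extends to the whole compact space. -/
theorem ContMap.exists_extension [CompactSpace X] [T2Space X] {E F : CBundle (univ : Set X)}
    {C : Set X} (hC : IsClosed C) {f : ∀ x, E.Fib x →ₗ[ℂ] F.Fib x} (hf : E.ContMap F C f) :
    ∃ g : ∀ x, E.Fib x →ₗ[ℂ] F.Fib x, E.ContMap F univ g ∧ ∀ x ∈ C, g x = f x := by
  choose a ha using fun x => E.cover x trivial
  choose b hb using fun x => F.cover x trivial
  have hK : ∀ x, ∃ K ∈ 𝓝 x, IsClosed K ∧ K ⊆ (E.chart (a x)).dom ∩ (F.chart (b x)).dom :=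
    fun x => exists_mem_nhds_isClosed_subset
      (((E.chart (a x)).isOpen_dom.inter (F.chart (b x)).isOpen_dom).mem_nhds ⟨ha x, hb x⟩)
  choose K hKx hKc hKs using hK
  have hT : ∀ x, ∃ g : X → (E.chart (a x)).Model →L[ℂ] (F.chart (b x)).Model, Continuous g ∧
      ∀ y ∈ C ∩ K x, g y = E.chartMap F f (a x) (b x) y := fun x => by
    have h1 : ContinuousOn (E.chartMap F f (a x) (b x)) (C ∩ K x) :=
      (hf.continuousOn_chartMap _ _).mono fun y hy => ⟨hKs x hy.2, hy.1⟩
    -- Tietze extension of the matrix of f from the closed set C ∩ K x, where K x is a closed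
    -- neighbourhood inside both chart domains.
    obtain ⟨g, hg⟩ := ContinuousMap.exists_restrict_eq (hC.inter (hKc x))
      ⟨_, continuousOn_iff_continuous_domRestrict.1 h1⟩
    exact ⟨g, g.continuous, fun y hy => congrArg (fun h => h ⟨y, hy⟩) hg⟩
  choose g hg hgf using hT
  obtain ⟨m, p, r, hr, hrs, hsum⟩ := exists_finite_partition (fun x => interior (K x))
    (fun x => isOpen_interior) fun x => mem_interior_iff_mem_nhds.2 (hKx x)
  refine ⟨fun x => ∑ k, ((r k x * r k x : ℝ) : ℂ) •
    ((F.chart (b (p k))).lift x ∘ₗ (g (p k) x : _ →ₗ[ℂ] _) ∘ₗ (E.chart (a (p k))).coord x),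
    ContMap.sum_finset fun k _ => ?_, fun x hx => ?_⟩
  · refine ContMap.smul_of_tsupport (N := interior (K (p k)))
      (Complex.continuous_ofReal.comp ((hr k).mul (hr k))) isOpen_interior
      ((tsupport_ofReal_mul_subset _ _).trans (hrs k)) ?_
    have hsub : interior (K (p k)) ∩ univ ⊆ (E.chart (a (p k))).dom ∩ (F.chart (b (p k))).dom :=
      inter_subset_left.trans (interior_subset.trans (hKs _))
    refine ContMap.comp (ContMap.mono (contMap_lift F _) fun y hy => ⟨(hsub hy).2, trivial⟩)
      (ContMap.comp (F := triv X _) (G := triv X _) (contMap_triv.2 (hg _).continuousOn)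
        (ContMap.mono (contMap_coord E _) fun y hy => ⟨(hsub hy).1, trivial⟩) ?_) ?_ <;>
      exact subset_univ _
  -- On C each local extension with nonzero weight equals f, so their convex combination does too.
  · have h1 : ∀ k, ((r k x * r k x : ℝ) : ℂ) •
        ((F.chart (b (p k))).lift x ∘ₗ (g (p k) x : _ →ₗ[ℂ] _) ∘ₗ (E.chart (a (p k))).coord x) =
        ((r k x * r k x : ℝ) : ℂ) • f x := fun k => by
      by_cases h0 : r k x = 0
      · simp [h0]
      have hxK : x ∈ K (p k) := interior_subset (hrs k (subset_tsupport _ h0))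
      congr 1
      ext v
      rw [LinearMap.comp_apply, LinearMap.comp_apply, ContinuousLinearMap.coe_coe,
        hgf _ x ⟨hx, hxK⟩]
      simp [chartMap, (E.chart (a (p k))).lift_coord x (hKs _ hxK).1,
        (F.chart (b (p k))).lift_coord x (hKs _ hxK).2]
    simp only [h1]
    rw [← Finset.sum_smul, ← Complex.ofReal_sum, hsum, Complex.ofReal_one, one_smul]

/-- Chart coordinates weighted by the r k embed E in a Hilbert space, whose inner product is pulled
back. At every point some weight is nonzero, which gives injectivity. -/
theorem exists_metric [CompactSpace X] [T2Space X] (E : CBundle (univ : Set X)) :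
    ∃ g : ∀ x, InnerProductSpace.Core ℂ (E.Fib x), ∀ a, ∀ v w : (E.chart a).Model,
      ContinuousOn (fun x => (g x).inner ((E.chart a).lift x v) ((E.chart a).lift x w))
        ((E.chart a).dom ∩ univ) := by
  choose a ha using fun x => E.cover x trivial
  obtain ⟨m, p, r, hr, hrs, hsum⟩ := exists_finite_partition (fun x => (E.chart (a x)).dom)
    (fun x => (E.chart (a x)).isOpen_dom) ha
  let H : Fin m → Type := fun k =>
    EuclideanSpace ℂ (Fin (Module.finrank ℂ (E.chart (a (p k))).Model))
  let i : ∀ k, (E.chart (a (p k))).Model ≃ₗ[ℂ] H k := fun k =>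
    LinearEquiv.ofFinrankEq _ _ (by simp [H])
  let l : ∀ k x, E.Fib x →ₗ[ℂ] H k := fun k x =>
    (r k x : ℂ) • ((i k).toLinearMap ∘ₗ (E.chart (a (p k))).coord x)
  let L : ∀ x, E.Fib x →ₗ[ℂ] PiLp 2 H := fun x =>
    (WithLp.linearEquiv 2 ℂ (∀ k, H k)).symm.toLinearMap ∘ₗ LinearMap.pi fun k => l k x
  have hl : ∀ k, E.ContMap (triv X (H k)) univ (l k) := fun k => by
    refine ContMap.smul_of_tsupport (Complex.continuous_ofReal.comp (hr k))
      (E.chart (a (p k))).isOpen_dom ((tsupport_ofReal_subset _).trans (hrs k)) ?_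
    refine ContMap.comp (F := triv X (E.chart (a (p k))).Model) (V := univ)
      (contMap_triv_left.2 fun v => contSec_triv.2 (continuousOn_const (c := i k v)))
      (contMap_coord E _) ?_
    exact subset_univ _
  have hL : ∀ x, Function.Injective (L x) := fun x => by
    rw [← LinearMap.ker_eq_bot, LinearMap.ker_eq_bot']
    intro v hv
    have hk : ∃ k, r k x ≠ 0 := by
      by_contra! h
      have := hsum x
      simp [h] at this
    obtain ⟨k, hk⟩ := hk
    have h1 : l k x v = 0 := congrArg (fun w : PiLp 2 H => w k) hv
    have h2 : (i k) ((E.chart (a (p k))).coord x v) = 0 :=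
      (smul_eq_zero.1 h1).resolve_left (Complex.ofReal_ne_zero.2 hk)
    rw [LinearEquiv.map_eq_zero_iff] at h2
    rw [← (E.chart (a (p k))).lift_coord x (hrs k (subset_tsupport _ hk)) v, h2, map_zero]
  refine ⟨fun x => (InnerProductSpace.Core.std (PiLp 2 H)).comap (L x) (hL x), fun b v w => ?_⟩
  have hc : ∀ v k, ContinuousOn (fun x => l k x ((E.chart b).lift x v)) ((E.chart b).dom ∩ univ) :=
    fun v k => contSec_triv.1 (contMap_iff.1 (hl k) b v)
  change ContinuousOn (fun x => inner ℂ (L x ((E.chart b).lift x v)) (L x ((E.chart b).lift x w)))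
    ((E.chart b).dom ∩ univ)
  simp only [PiLp.inner_apply]
  exact continuousOn_finsetSum _ fun k _ => (hc v k).inner (𝕜 := ℂ) (hc w k)

/-- A bundle over a compact Hausdorff space with a chosen Hermitian metric. -/
noncomputable def hermitian [CompactSpace X] [T2Space X] (E : CBundle (univ : Set X)) :
    HBundle (univ : Set X) where
  toCBundle := E
  metric := E.exists_metric.choose
  cont_metric := E.exists_metric.choose_spec

open Classical in
/-- The fibrewise inverse of a map, where it is bijective. -/
noncomputable def fibInv (E : CBundle U) (F : CBundle V) (f : ∀ x, E.Fib x →ₗ[ℂ] F.Fib x) (x : X) :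
    F.Fib x →ₗ[ℂ] E.Fib x :=
  if h : Function.Bijective (f x) then (LinearEquiv.ofBijective (f x) h).symm.toLinearMap else 0

theorem fibInv_apply {E : CBundle U} {F : CBundle V} {f : ∀ x, E.Fib x →ₗ[ℂ] F.Fib x} {x : X}
    (h : Function.Bijective (f x)) (v : E.Fib x) : E.fibInv F f x (f x v) = v := by
  rw [fibInv, dif_pos h]
  exact (LinearEquiv.ofBijective (f x) h).symm_apply_apply v

theorem apply_fibInv {E : CBundle U} {F : CBundle V} {f : ∀ x, E.Fib x →ₗ[ℂ] F.Fib x} {x : X}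
    (h : Function.Bijective (f x)) (v : F.Fib x) : f x (E.fibInv F f x v) = v := by
  rw [fibInv, dif_pos h]
  exact (LinearEquiv.ofBijective (f x) h).apply_symm_apply v

theorem bijective_chartMap {E : CBundle U} {F : CBundle V} {f : ∀ x, E.Fib x →ₗ[ℂ] F.Fib x}
    {a : E.Idx} {b : F.Idx} {x : X} (ha : x ∈ (E.chart a).dom) (hb : x ∈ (F.chart b).dom) :
    Function.Bijective (E.chartMap F f a b x) ↔ Function.Bijective (f x) := by
  have h1 : Function.Bijective ((F.chart b).coord x) := Function.bijective_iff_has_inverse.2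
    ⟨_, (F.chart b).lift_coord x hb, (F.chart b).coord_lift x hb⟩
  have h2 : Function.Bijective ((E.chart a).lift x) := Function.bijective_iff_has_inverse.2
    ⟨_, (E.chart a).coord_lift x ha, (E.chart a).lift_coord x ha⟩
  change Function.Bijective ((F.chart b).coord x ∘ (f x ∘ (E.chart a).lift x)) ↔ _
  rw [h1.of_comp_iff', Function.Bijective.of_comp_iff _ h2]

/-- In charts this is the openness of the set of invertible operators. -/
theorem ContMap.eventually_bijective {E : CBundle U} {F : CBundle V}
    {f : ∀ x, E.Fib x →ₗ[ℂ] F.Fib x} (hf : E.ContMap F W f) (hU : W ⊆ U) (hV : W ⊆ V) {x₀ : X}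
    (hx₀ : x₀ ∈ W) (h : Function.Bijective (f x₀)) :
    ∀ᶠ x in 𝓝[W] x₀, Function.Bijective (f x) := by
  obtain ⟨a, ha⟩ := E.cover x₀ (hU hx₀)
  obtain ⟨b, hb⟩ := F.cover x₀ (hV hx₀)
  have hd : (E.chart a).dom ∩ (F.chart b).dom ∈ 𝓝 x₀ :=
    (((E.chart a).isOpen_dom.inter (F.chart b).isOpen_dom).mem_nhds ⟨ha, hb⟩)
  have hc := hf.continuousOn_chartMap a b x₀ ⟨⟨ha, hb⟩, hx₀⟩
  rw [ContinuousWithinAt, nhdsWithin_inter_of_mem (mem_nhdsWithin_of_mem_nhds hd)] at hc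
  have h' := (bijective_chartMap ha hb).2 h
  let e := (LinearEquiv.ofBijective (E.chartMap F f a b x₀).toLinearMap h').toContinuousLinearEquiv
  have := FiniteDimensional.complete ℂ (E.chart a).Model
  have he : range ((↑) : ((E.chart a).Model ≃L[ℂ] (F.chart b).Model) → _) ∈
    𝓝 (E.chartMap F f a b x₀) := e.nhds
  filter_upwards [hc he, mem_nhdsWithin_of_mem_nhds hd] with x ⟨e', he'⟩ hx
  rw [← bijective_chartMap hx.1 hx.2, ← he']
  exact e'.bijective

/-- In charts this is the continuity of operator inversion at invertible operators. -/
theorem ContMap.fibInv {E : CBundle U} {F : CBundle V}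
    {f : ∀ x, E.Fib x →ₗ[ℂ] F.Fib x} (hf : E.ContMap F W f)
    (h : ∀ x ∈ W, Function.Bijective (f x)) : F.ContMap E W (E.fibInv F f) := by
  intro b a v x₀ hx₀
  have hc := hf.continuousOn_chartMap a b x₀ ⟨⟨hx₀.1.2, hx₀.1.1⟩, hx₀.2⟩
  rw [inter_comm (E.chart a).dom] at hc
  have hbij := fun x (hx : x ∈ (F.chart b).dom ∩ (E.chart a).dom ∩ W) =>
    (bijective_chartMap hx.1.2 hx.1.1).2 (h x hx.2)
  let e : ∀ x (_ : x ∈ (F.chart b).dom ∩ (E.chart a).dom ∩ W),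
      (E.chart a).Model ≃L[ℂ] (F.chart b).Model := fun x hx =>
    (LinearEquiv.ofBijective (E.chartMap F f a b x).toLinearMap (hbij x hx)).toContinuousLinearEquiv
  have he : ∀ x hx, ((e x hx : _ ≃L[ℂ] _) : _ →L[ℂ] _) = E.chartMap F f a b x := fun x hx => rfl
  have hci : ContinuousWithinAt (fun x => (E.chartMap F f a b x).inverse)
      ((F.chart b).dom ∩ (E.chart a).dom ∩ W) x₀ := by
    have := FiniteDimensional.complete ℂ (E.chart a).Model
    have h1 : ContinuousAt ContinuousLinearMap.inverse (E.chartMap F f a b x₀) :=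
      (contDiffAt_map_inverse (n := 0) (e x₀ hx₀)).continuousAt
    exact h1.comp_continuousWithinAt hc
  have heq : ∀ x ∈ (F.chart b).dom ∩ (E.chart a).dom ∩ W,
      (E.chart a).coord x (E.fibInv F f x ((F.chart b).lift x v)) =
        (E.chartMap F f a b x).inverse v := fun x hx => by
    rw [← he x hx, ContinuousLinearMap.inverse_equiv]
    refine (e x hx).injective ?_
    rw [ContinuousLinearEquiv.coe_coe, (e x hx).apply_symm_apply]
    change E.chartMap F f a b x _ = v
    simp [chartMap, (E.chart a).lift_coord x hx.1.2, apply_fibInv (h x hx.2),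
      (F.chart b).coord_lift x hx.1.1]
  exact (hci.clm_apply continuousWithinAt_const).congr heq (heq x₀ hx₀)

end CBundle

/-! ### Objects and homomorphisms of `HF(U)` -/

/-- Injections in both directions force equal dimensions. Bijectivity of h, and of the block matrix
in `HFMap.cross_bijective`, is obtained in this way without exhibiting an inverse. -/
theorem bijective_of_injective_injective {V W : Type} [AddCommGroup V] [Module ℂ V]
    [AddCommGroup W] [Module ℂ W] [FiniteDimensional ℂ V] [FiniteDimensional ℂ W]
    {f : V →ₗ[ℂ] W} {g : W →ₗ[ℂ] V} (hf : Function.Injective f) (hg : Function.Injective g) :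
    Function.Bijective f :=
  ⟨hf, (LinearMap.injective_iff_surjective_of_finrank_eq_finrank
    ((LinearMap.finrank_le_finrank_of_injective hf).antisymm
      (LinearMap.finrank_le_finrank_of_injective hg))).1 hf⟩

theorem exists_pos_le {ι : Type*} [Finite ι] (μ : ι → ℝ) (h : ∀ k, 0 < μ k) :
    ∃ ν > 0, ∀ k, ν ≤ μ k := by
  rcases isEmpty_or_nonempty ι with hι | hι
  · exact ⟨1, one_pos, fun k => hι.elim k⟩
  · obtain ⟨k, hk⟩ := Finite.exists_min μ
    exact ⟨μ k, h k, hk⟩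

namespace HFObj

variable {X : Type u} [TopologicalSpace X] {U V W : Set X}

/-- The even part of `h²`. -/
abbrev sqEven (E : HFObj U) (x : X) : Module.End ℂ (E.even.Fib x) := E.h₀₁ x ∘ₗ E.h₁₀ x

/-- The odd part of `h²`. -/
abbrev sqOdd (E : HFObj U) (x : X) : Module.End ℂ (E.odd.Fib x) := E.h₁₀ x ∘ₗ E.h₀₁ x

theorem hermitian' (E : HFObj U) {x : X} (hx : x ∈ U) (v w) :
    (E.even.metric x).inner (E.h₀₁ x v) w = (E.odd.metric x).inner v (E.h₁₀ x w) := by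
  rw [← (E.even.metric x).conj_inner_symm, ← E.hermitian x hx, (E.odd.metric x).conj_inner_symm]

theorem symm_sqEven (E : HFObj U) {x : X} (hx : x ∈ U) (v w) :
    (E.even.metric x).inner (E.sqEven x v) w = (E.even.metric x).inner v (E.sqEven x w) := by
  rw [LinearMap.comp_apply, E.hermitian' hx, E.hermitian x hx]; rfl

theorem symm_sqOdd (E : HFObj U) {x : X} (hx : x ∈ U) (v w) :
    (E.odd.metric x).inner (E.sqOdd x v) w = (E.odd.metric x).inner v (E.sqOdd x w) := by
  rw [LinearMap.comp_apply, E.hermitian x hx, E.hermitian' hx]; rfl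

theorem finiteDimensional_even (E : HFObj U) {x : X} (hx : x ∈ U) :
    FiniteDimensional ℂ (E.even.Fib x) := E.even.finiteDimensional_fib hx

theorem finiteDimensional_odd (E : HFObj U) {x : X} (hx : x ∈ U) :
    FiniteDimensional ℂ (E.odd.Fib x) := E.odd.finiteDimensional_fib hx

theorem realDiag_sqEven (E : HFObj U) {x : X} (hx : x ∈ U) : RealDiag (E.sqEven x) :=
  have := E.finiteDimensional_even hx
  realDiag_of_symmetric _ (E.symm_sqEven hx)

theorem realDiag_sqOdd (E : HFObj U) {x : X} (hx : x ∈ U) : RealDiag (E.sqOdd x) :=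
  have := E.finiteDimensional_odd hx
  realDiag_of_symmetric _ (E.symm_sqOdd hx)

theorem sqEven_nonneg (E : HFObj U) {x : X} (hx : x ∈ U) {r : ℝ} {v : E.even.Fib x} (hv : v ≠ 0)
    (h : E.sqEven x v = (r : ℂ) • v) : 0 ≤ r := by
  have h1 : (E.odd.metric x).inner (E.h₁₀ x v) (E.h₁₀ x v) =
      r * (E.even.metric x).inner v v := by
    rw [E.hermitian x hx, ← InnerProductSpace.Core.inner_smul_right', ← h]; rfl
  have h2 := (E.odd.metric x).re_inner_nonneg (E.h₁₀ x v)
  have h3 : (((E.even.metric x).inner v v).re : ℂ) = (E.even.metric x).inner v v :=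
    Complex.conj_eq_iff_re.1 ((E.even.metric x).conj_inner_symm v v)
  have h4 : 0 < ((E.even.metric x).inner v v).re :=
    lt_of_le_of_ne ((E.even.metric x).re_inner_nonneg v) fun h0 =>
      hv ((E.even.metric x).definite _ (by rw [← h3, ← h0, Complex.ofReal_zero]))
  rw [h1, ← h3, ← Complex.ofReal_mul] at h2
  exact nonneg_of_mul_nonneg_left (by simpa using h2) h4

/-- Exchange of the even and the odd part. -/
def swap (E : HFObj U) : HFObj U where
  even := E.odd
  odd := E.even
  h₁₀ := E.h₀₁
  h₀₁ := E.h₁₀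
  cont₁₀ := E.cont₀₁
  cont₀₁ := E.cont₁₀
  hermitian _ hx := E.hermitian' hx

theorem contMap_fc_sqEven (E : HFObj U) {f : ℝ → ℝ} (hf : Continuous f) :
    E.even.ContMap E.even.toCBundle U fun x => fc f (E.sqEven x) :=
  HBundle.contMap_fc (E.cont₀₁.comp E.cont₁₀ subset_rfl) (fun _ hx => E.symm_sqEven hx) hf

theorem contMap_fc_sqOdd (E : HFObj U) {f : ℝ → ℝ} (hf : Continuous f) :
    E.odd.ContMap E.odd.toCBundle U fun x => fc f (E.sqOdd x) :=
  E.swap.contMap_fc_sqEven hf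

theorem h₁₀_fc (E : HFObj U) {x : X} (hx : x ∈ U) (f : ℝ → ℝ) (v) :
    E.h₁₀ x (fc f (E.sqEven x) v) = fc f (E.sqOdd x) (E.h₁₀ x v) :=
  have := E.finiteDimensional_even hx
  have := E.finiteDimensional_odd hx
  (E.realDiag_sqEven hx).fc_intertwine (M' := E.sqOdd x) (E.h₁₀ x) (fun _ => rfl) f v

theorem h₀₁_fc (E : HFObj U) {x : X} (hx : x ∈ U) (f : ℝ → ℝ) (v) :
    E.h₀₁ x (fc f (E.sqOdd x) v) = fc f (E.sqEven x) (E.h₀₁ x v) :=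
  E.swap.h₁₀_fc hx f v

theorem invertibleAt_of_injective (E : HFObj U) {x : X} (hx : x ∈ U)
    (h₁ : Function.Injective (E.h₁₀ x)) (h₀ : Function.Injective (E.h₀₁ x)) : E.InvertibleAt x :=
  have := E.finiteDimensional_even hx
  have := E.finiteDimensional_odd hx
  ⟨bijective_of_injective_injective h₁ h₀, bijective_of_injective_injective h₀ h₁⟩

/-- The adjoint of a surjection is injective: if h₀₁ h₁₀ v = 0 then ⟨h₁₀ v, h₁₀ v⟩ = 0. -/
theorem invertibleAt_of_bijective (E : HFObj U) {x : X} (hx : x ∈ U)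
    (h : Function.Bijective (E.h₁₀ x)) : E.InvertibleAt x := by
  refine E.invertibleAt_of_injective hx h.1 ?_
  rw [← LinearMap.ker_eq_bot, LinearMap.ker_eq_bot']
  intro w hw
  obtain ⟨v, rfl⟩ := h.2 w
  have := E.hermitian x hx v (E.h₁₀ x v)
  rw [hw, InnerProductSpace.Core.inner_zero_right'] at this
  exact (E.odd.metric x).definite _ this

/-- Restriction of a Hermitian bundle to a smaller subset. -/
def _root_.HBundle.restrict (E : HBundle U) (h : V ⊆ U) : HBundle V where
  toCBundle := E.toCBundle.restrict h
  metric := E.metric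
  cont_metric a v w := (E.cont_metric a v w).mono (inter_subset_inter_right _ h)

/-- Restriction of an object to a smaller subset. -/
def restrict (E : HFObj U) (h : V ⊆ U) : HFObj V where
  even := E.even.restrict h
  odd := E.odd.restrict h
  h₁₀ := E.h₁₀
  h₀₁ := E.h₀₁
  cont₁₀ := E.cont₁₀.mono h
  cont₀₁ := E.cont₀₁.mono h
  hermitian x hx := E.hermitian x (h hx)

/-- The object given by a map between Hermitian bundles and its adjoint. -/
noncomputable def ofMap (E F : HBundle U) (f : ∀ x, E.Fib x →ₗ[ℂ] F.Fib x)
    (hf : E.ContMap F.toCBundle U f) : HFObj U where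
  even := E
  odd := F
  h₁₀ := f
  h₀₁ := E.adj F f
  cont₁₀ := hf
  cont₀₁ := HBundle.contMap_of_adjoint subset_rfl subset_rfl hf fun _ hx => E.inner_adj F f hx
  hermitian _ hx := E.inner_adj F f hx

/-- Direct sum of objects over the whole space. -/
noncomputable def gsum (E F : HFObj (univ : Set X)) : HFObj (univ : Set X) :=
  (E.sum F).restrict fun _ _ => ⟨trivial, trivial⟩

/-- For a global object the points of invertibility form an open set, so the closure in the
definition of the support adds nothing. -/
theorem supp_inter_eq_empty_iff (E : HFObj (univ : Set X)) {Y : Set X} :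
    E.toVectorial.supp ∩ Y = ∅ ↔ ∀ y ∈ Y, E.InvertibleAt y := by
  have hopen : IsOpen {x | E.InvertibleAt x} := by
    rw [isOpen_iff_mem_nhds]
    intro x hx
    have h1 := E.cont₁₀.eventually_bijective subset_rfl subset_rfl (mem_univ x) hx.1
    rw [nhdsWithin_univ] at h1
    filter_upwards [h1] with y hy using E.invertibleAt_of_bijective trivial hy
  have hsupp : E.toVectorial.supp = {x | E.InvertibleAt x}ᶜ := by
    rw [← hopen.isClosed_compl.closure_eq]
    refine congrArg closure (ext fun x => ⟨?_, fun h => ⟨PUnit.unit, trivial, h⟩⟩)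
    rintro ⟨_, _, h⟩
    exact h
  rw [hsupp, ← disjoint_iff_inter_eq_empty, disjoint_compl_left_iff_subset]
  rfl

end HFObj

/-! ### Homomorphisms up to agreement at low energies. -/

namespace HFMap

variable {X : Type u} [TopologicalSpace X] {U V U' V' W W' : Set X} {E : HFObj U} {F : HFObj V}
  {G : HFObj U'}

theorem IsHom.mono {φ : HFMap E F} (h : φ.IsHom W) (hW : W' ⊆ W) : φ.IsHom W' where
  cont_even := h.cont_even.mono hW
  cont_odd := h.cont_odd.mono hW
  comm₁₀ x hx := h.comm₁₀ x (hW hx)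
  comm₀₁ x hx := h.comm₀₁ x (hW hx)

theorem isHom_id (E : HFObj U) (hW : W ⊆ U) : (HFMap.id E).IsHom W where
  cont_even := E.even.contMap_id hW
  cont_odd := E.odd.contMap_id hW
  comm₁₀ _ _ _ := rfl
  comm₀₁ _ _ _ := rfl

theorem IsHom.comp {φ : HFMap F G} {ψ : HFMap E F} (h : φ.IsHom W) (k : ψ.IsHom W) (hW : W ⊆ V) :
    (φ.comp ψ).IsHom W where
  cont_even := h.cont_even.comp k.cont_even hW
  cont_odd := h.cont_odd.comp k.cont_odd hW
  comm₁₀ x hx v := by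
    change φ.odd x (ψ.odd x _) = G.h₁₀ x (φ.even x (ψ.even x v))
    rw [k.comm₁₀ x hx, h.comm₁₀ x hx]
  comm₀₁ x hx v := by
    change φ.even x (ψ.even x _) = G.h₀₁ x (φ.odd x (ψ.odd x v))
    rw [k.comm₀₁ x hx, h.comm₀₁ x hx]

theorem IsHom.sqEven {φ : HFMap E F} (h : φ.IsHom W) {x : X} (hx : x ∈ W) (v) :
    φ.even x (E.sqEven x v) = F.sqEven x (φ.even x v) := by
  rw [LinearMap.comp_apply, h.comm₀₁ x hx, h.comm₁₀ x hx]; rfl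

theorem IsHom.sqOdd {φ : HFMap E F} (h : φ.IsHom W) {x : X} (hx : x ∈ W) (v) :
    φ.odd x (E.sqOdd x v) = F.sqOdd x (φ.odd x v) := by
  rw [LinearMap.comp_apply, h.comm₁₀ x hx, h.comm₀₁ x hx]; rfl

theorem IsHom.fc_even {φ : HFMap E F} (h : φ.IsHom W) {x : X} (hx : x ∈ W) (hU : x ∈ U)
    (hV : x ∈ V) (f : ℝ → ℝ) (v) :
    φ.even x (fc f (E.sqEven x) v) = fc f (F.sqEven x) (φ.even x v) :=
  have := E.finiteDimensional_even hU
  have := F.finiteDimensional_even hV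
  (E.realDiag_sqEven hU).fc_intertwine _ (h.sqEven hx) f v

theorem IsHom.fc_odd {φ : HFMap E F} (h : φ.IsHom W) {x : X} (hx : x ∈ W) (hU : x ∈ U)
    (hV : x ∈ V) (f : ℝ → ℝ) (v) :
    φ.odd x (fc f (E.sqOdd x) v) = fc f (F.sqOdd x) (φ.odd x v) :=
  have := E.finiteDimensional_odd hU
  have := F.finiteDimensional_odd hV
  (E.realDiag_sqOdd hU).fc_intertwine _ (h.sqOdd hx) f v

/-- Two maps agree on the low part at a point. -/
def AgreeAt (φ ψ : HFMap E F) (μ : ℝ) (y : X) : Prop :=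
  (∀ ξ ∈ E.lowEven y μ, φ.even y ξ = ψ.even y ξ) ∧ (∀ ξ ∈ E.lowOdd y μ, φ.odd y ξ = ψ.odd y ξ)

theorem AgreeAt.mono {φ ψ : HFMap E F} {μ ν : ℝ} {y : X} (h : φ.AgreeAt ψ μ y) (hν : ν ≤ μ) :
    φ.AgreeAt ψ ν y :=
  ⟨fun ξ hξ => h.1 ξ (lowPart_mono _ hν hξ), fun ξ hξ => h.2 ξ (lowPart_mono _ hν hξ)⟩

theorem eqv_iff {φ ψ : HFMap E F} :
    φ.Eqv ψ W ↔ ∀ x ∈ W, ∃ μ : ℝ, 0 < μ ∧ ∀ᶠ y in 𝓝[W] x, φ.AgreeAt ψ μ y := by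
  refine forall₂_congr fun x hx => exists_congr fun μ => and_congr_right fun hμ => ?_
  constructor
  · rintro ⟨N, hN, hxN, H⟩
    exact mem_nhdsWithin.2 ⟨N, hN, hxN, fun y hy => H y hy⟩
  · intro h
    obtain ⟨N, hN, hxN, H⟩ := mem_nhdsWithin.1 h
    exact ⟨N, hN, hxN, fun y hy => H hy⟩

theorem Eqv.refl (φ : HFMap E F) (W : Set X) : φ.Eqv φ W :=
  fun _ _ => ⟨1, one_pos, univ, isOpen_univ, trivial, fun _ _ => ⟨fun _ _ => rfl, fun _ _ => rfl⟩⟩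

theorem Eqv.of_eq {φ ψ : HFMap E F} (h₀ : ∀ x ∈ W, ∀ v, φ.even x v = ψ.even x v)
    (h₁ : ∀ x ∈ W, ∀ v, φ.odd x v = ψ.odd x v) : φ.Eqv ψ W :=
  fun _ _ => ⟨1, one_pos, univ, isOpen_univ, trivial, fun _ hy =>
    ⟨fun _ _ => h₀ _ hy.2 _, fun _ _ => h₁ _ hy.2 _⟩⟩

theorem Eqv.symm {φ ψ : HFMap E F} (h : φ.Eqv ψ W) : ψ.Eqv φ W := fun x hx => by
  obtain ⟨μ, hμ, N, hN, hxN, H⟩ := h x hx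
  exact ⟨μ, hμ, N, hN, hxN, fun y hy =>
    ⟨fun ξ hξ => ((H y hy).1 ξ hξ).symm, fun ξ hξ => ((H y hy).2 ξ hξ).symm⟩⟩

theorem Eqv.trans {φ ψ χ : HFMap E F} (h : φ.Eqv ψ W) (k : ψ.Eqv χ W) : φ.Eqv χ W := by
  rw [eqv_iff] at *
  intro x hx
  obtain ⟨μ, hμ, H⟩ := h x hx
  obtain ⟨ν, hν, K⟩ := k x hx
  refine ⟨min μ ν, lt_min hμ hν, ?_⟩
  filter_upwards [H, K] with y hy ky
  have hy := hy.mono (min_le_left μ ν)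
  have ky := ky.mono (min_le_right μ ν)
  exact ⟨fun ξ hξ => (hy.1 ξ hξ).trans (ky.1 ξ hξ), fun ξ hξ => (hy.2 ξ hξ).trans (ky.2 ξ hξ)⟩

theorem Eqv.comp_left {φ ψ : HFMap E F} (h : φ.Eqv ψ W) (χ : HFMap F G) :
    (χ.comp φ).Eqv (χ.comp ψ) W := fun x hx => by
  obtain ⟨μ, hμ, N, hN, hxN, H⟩ := h x hx
  exact ⟨μ, hμ, N, hN, hxN, fun y hy => ⟨fun ξ hξ => congrArg (χ.even y) ((H y hy).1 ξ hξ),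
    fun ξ hξ => congrArg (χ.odd y) ((H y hy).2 ξ hξ)⟩⟩

/-- A homomorphism commutes with h² and therefore preserves low parts; this is why composition
descends to classes. -/
theorem Eqv.comp_right {φ ψ : HFMap F G} (h : φ.Eqv ψ W) {χ : HFMap E F} (hχ : χ.IsHom W) :
    (φ.comp χ).Eqv (ψ.comp χ) W := fun x hx => by
  obtain ⟨μ, hμ, N, hN, hxN, H⟩ := h x hx
  exact ⟨μ, hμ, N, hN, hxN, fun y hy =>
    ⟨fun ξ hξ => (H y hy).1 _ (map_mem_lowPart (hχ.sqEven hy.2) hξ),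
      fun ξ hξ => (H y hy).2 _ (map_mem_lowPart (hχ.sqOdd hy.2) hξ)⟩⟩

theorem Eqv.of_cover {φ ψ : HFMap E F} {ι : Type*} {N : ι → Set X} (hN : ∀ i, IsOpen (N i))
    (hcov : ∀ x ∈ W, ∃ i, x ∈ N i) (h : ∀ i, φ.Eqv ψ (N i ∩ W)) : φ.Eqv ψ W := by
  simp only [eqv_iff] at *
  intro x hx
  obtain ⟨i, hi⟩ := hcov x hx
  obtain ⟨μ, hμ, H⟩ := h i x ⟨hi, hx⟩
  refine ⟨μ, hμ, ?_⟩
  rwa [nhdsWithin_inter_of_mem (mem_nhdsWithin_of_mem_nhds ((hN i).mem_nhds hi))] at H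

/-- A finite subcover leaves finitely many local bounds. The low part shrinks with μ, so their
minimum works everywhere. -/
theorem Eqv.exists_uniform {φ ψ : HFMap E F} (h : φ.Eqv ψ W) {K : Set X} (hK : IsCompact K)
    (hKW : K ⊆ W) : ∃ μ : ℝ, 0 < μ ∧ ∀ y ∈ K, φ.AgreeAt ψ μ y := by
  choose! μ hμ N hN hxN H using h
  obtain ⟨t, ht⟩ := hK.elim_nhds_subcover' (fun x _ => N x)
    fun x hx => (hN x (hKW hx)).mem_nhds (hxN x (hKW hx))
  obtain ⟨ν, hν, hνμ⟩ := exists_pos_le (fun k : t => μ k) fun k => hμ _ (hKW k.1.2)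
  refine ⟨ν, hν, fun y hy => ?_⟩
  obtain ⟨k, hk, hyk⟩ := mem_iUnion₂.1 (ht hy)
  exact AgreeAt.mono (H k (hKW k.2) y ⟨hyk, hKW hy⟩) (hνμ ⟨k, hk⟩)

/-- Combination of homomorphisms with real functions as coefficients. -/
noncomputable def glue {m : ℕ} (c : Fin m → X → ℝ) (φ : Fin m → HFMap E F) : HFMap E F where
  even x := ∑ k, (c k x : ℂ) • (φ k).even x
  odd x := ∑ k, (c k x : ℂ) • (φ k).odd x

theorem isHom_glue {m : ℕ} {c : Fin m → X → ℝ} (hc : ∀ k, Continuous (c k)) {N : Fin m → Set X}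
    (hN : ∀ k, IsOpen (N k)) (hcN : ∀ k, tsupport (c k) ⊆ N k) {φ : Fin m → HFMap E F}
    (h : ∀ k, (φ k).IsHom (N k ∩ W)) : (glue c φ).IsHom W := by
  have hz : ∀ k x, x ∉ N k → c k x = 0 := fun k x hx =>
    image_eq_zero_of_notMem_tsupport fun hx' => hx (hcN k hx')
  refine ⟨CBundle.ContMap.sum_finset fun k _ => CBundle.ContMap.smul_of_tsupport
      (Complex.continuous_ofReal.comp (hc k)) (hN k)
      ((tsupport_ofReal_subset _).trans (hcN k)) (h k).cont_even,
    CBundle.ContMap.sum_finset fun k _ => CBundle.ContMap.smul_of_tsupport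
      (Complex.continuous_ofReal.comp (hc k)) (hN k)
      ((tsupport_ofReal_subset _).trans (hcN k)) (h k).cont_odd,
    fun x hx v => ?_, fun x hx v => ?_⟩
  all_goals
    simp only [glue, LinearMap.sum_apply, LinearMap.smul_apply, map_sum, map_smul]
    refine Finset.sum_congr rfl fun k _ => ?_
    by_cases hk : x ∈ N k
    · first | rw [(h k).comm₁₀ x ⟨hk, hx⟩] | rw [(h k).comm₀₁ x ⟨hk, hx⟩]
    · simp [hz k x hk]

theorem eqv_glue {m : ℕ} {c : Fin m → X → ℝ} {N : Fin m → Set X}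
    (hN : ∀ k, IsOpen (N k)) (hcN : ∀ k, tsupport (c k) ⊆ N k) (hsum : ∀ x, ∑ k, c k x = 1)
    {φ : Fin m → HFMap E F} {ψ : HFMap E F} (h : ∀ k, (φ k).Eqv ψ (N k ∩ W)) :
    (glue c φ).Eqv ψ W := by
  simp only [eqv_iff] at *
  intro x hx
  have key : ∀ k, ∃ μ : ℝ, 0 < μ ∧ ∀ᶠ y in 𝓝[W] x, c k y = 0 ∨ (φ k).AgreeAt ψ μ y := fun k => by
    by_cases hk : x ∈ N k
    · obtain ⟨μ, hμ, H⟩ := h k x ⟨hk, hx⟩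
      rw [nhdsWithin_inter_of_mem
        (mem_nhdsWithin_of_mem_nhds ((hN k).mem_nhds hk))] at H
      exact ⟨μ, hμ, H.mono fun y hy => Or.inr hy⟩
    · refine ⟨1, one_pos, mem_nhdsWithin_of_mem_nhds ?_⟩
      filter_upwards [(isClosed_tsupport (c k)).isOpen_compl.mem_nhds fun h' => hk (hcN k h')]
        with y hy
      exact Or.inl (image_eq_zero_of_notMem_tsupport hy)
  choose μ hμ H using key
  obtain ⟨ν, hν, hνμ⟩ := exists_pos_le μ hμ
  refine ⟨ν, hν, ?_⟩
  filter_upwards [Filter.eventually_all.2 H] with y hy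
  have hone : ∑ k, (c k y : ℂ) = 1 := by rw [← Complex.ofReal_sum, hsum, Complex.ofReal_one]
  constructor
  · intro ξ hξ
    rw [← one_smul ℂ (ψ.even y ξ), ← hone, Finset.sum_smul]
    simp only [glue, LinearMap.sum_apply, LinearMap.smul_apply]
    refine Finset.sum_congr rfl fun k _ => ?_
    rcases hy k with h0 | h0
    · simp [h0]
    · rw [(h0.mono (hνμ k)).1 ξ hξ]
  · intro ξ hξ
    rw [← one_smul ℂ (ψ.odd y ξ), ← hone, Finset.sum_smul]
    simp only [glue, LinearMap.sum_apply, LinearMap.smul_apply]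
    refine Finset.sum_congr rfl fun k _ => ?_
    rcases hy k with h0 | h0
    · simp [h0]
    · rw [(h0.mono (hνμ k)).2 ξ hξ]

end HFMap

/-! ### Composition, refinement and support of vectorial bundles. -/

namespace VectorialBundle

variable {X : Type u} [TopologicalSpace X]

/-- The product φᵢᵢ φᵢᵢ equals φᵢᵢ by the cocycle condition and the identity by the inverse
condition. -/
theorem φ_self_eqv (E : VectorialBundle X) (i : E.Idx) :
    (E.φ i i).Eqv (HFMap.id (E.obj i)) (E.U i) :=
  (((E.cocycle i i i).symm.mono fun _ h => ⟨⟨h, h⟩, h⟩)).trans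
    ((E.inverse i i).mono fun _ h => ⟨h, h⟩)

theorem Iso.symm {E F : VectorialBundle X} (h : E.Iso F) : F.Iso E := by
  obtain ⟨ψ, χ, h1, h2, h3, h4⟩ := h
  exact ⟨χ, ψ, h2, h1, h4, h3⟩

theorem Iso.comap {X' : Type u} [TopologicalSpace X'] {E F : VectorialBundle X} (h : E.Iso F)
    (f : C(X', X)) : (E.comap f).Iso (F.comap f) := by
  obtain ⟨ψ, χ, h1, h2, h3, h4⟩ := h
  exact ⟨fun i j => (ψ i j).comap f, fun i j => (χ i j).comap f,
    ⟨fun i j => (h1.isHom i j).comap f, fun i j k => (h1.source i j k).comap f,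
      fun i j k => (h1.target i j k).comap f⟩,
    ⟨fun i j => (h2.isHom i j).comap f, fun i j k => (h2.source i j k).comap f,
      fun i j k => (h2.target i j k).comap f⟩,
    fun i j k => (h3 i j k).comap f, fun i j k => (h4 i j k).comap f⟩

/-- Composition of homomorphisms of vectorial bundles. -/
theorem exists_comp [CompactSpace X] [T2Space X] {E F G : VectorialBundle X}
    {ψ : ∀ j i, HFMap (E.obj i) (F.obj j)} {χ : ∀ k j, HFMap (F.obj j) (G.obj k)}
    (hψ : E.IsHom F ψ) (hχ : F.IsHom G χ) :
    ∃ θ : ∀ k i, HFMap (E.obj i) (G.obj k), E.IsHom G θ ∧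
      ∀ i j k, (θ k i).Eqv ((χ k j).comp (ψ j i)) (F.U j ∩ (G.U k ∩ E.U i)) := by
  choose J hJ using F.cover
  obtain ⟨m, p, r, hr, hrs, hsum⟩ := exists_finite_partition (fun x => F.U (J x))
    (fun x => F.isOpen _) hJ
  let c : Fin m → X → ℝ := fun l x => r l x * r l x
  have hc : ∀ l, Continuous (c l) := fun l => (hr l).mul (hr l)
  have hcN : ∀ l, tsupport (c l) ⊆ F.U (J (p l)) := fun l =>
    tsupport_mul_subset_left.trans (hrs l)
  -- The composites through different intermediate indices agree only at low energies and live on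
  -- different open sets; the partition of unity averages them into one representative on G.U k ∩
  -- E.U i.
  let θ : ∀ k i, HFMap (E.obj i) (G.obj k) := fun k i =>
    HFMap.glue c fun l => (χ k (J (p l))).comp (ψ (J (p l)) i)
  have hθ : ∀ k i, (θ k i).IsHom (G.U k ∩ E.U i) := fun k i =>
    HFMap.isHom_glue hc (fun l => F.isOpen _) hcN fun l =>
      ((hχ.isHom k _).mono fun x hx => ⟨hx.2.1, hx.1⟩).comp
        ((hψ.isHom _ i).mono fun x hx => ⟨hx.1, hx.2.2⟩) fun x hx => hx.1
  have heq : ∀ i j k, (θ k i).Eqv ((χ k j).comp (ψ j i)) (F.U j ∩ (G.U k ∩ E.U i)) :=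
    fun i j k => HFMap.eqv_glue (fun l => F.isOpen _) hcN hsum fun l => by
      have h1 := (((hχ.source k j (J (p l))).mono (W' := F.U (J (p l)) ∩ (F.U j ∩ (G.U k ∩ E.U i)))
        fun x hx => ⟨⟨hx.2.2.1, hx.2.1⟩, hx.1⟩).symm).comp_right
        ((hψ.isHom (J (p l)) i).mono fun x hx => ⟨hx.1, hx.2.2.2⟩)
      have h2 := ((hψ.target j (J (p l)) i).mono
        (W' := F.U (J (p l)) ∩ (F.U j ∩ (G.U k ∩ E.U i)))
        fun x hx => ⟨⟨hx.2.1, hx.1⟩, hx.2.2.2⟩).comp_left (χ k j)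
      exact h1.trans h2
  refine ⟨θ, ⟨hθ, fun k i i' => ?_, fun k k' i => ?_⟩, heq⟩
  · refine HFMap.Eqv.of_cover F.isOpen (fun x _ => F.cover x) fun j => ?_
    have h1 := ((heq i j k).mono (W' := F.U j ∩ (G.U k ∩ E.U i ∩ E.U i'))
      fun x hx => ⟨hx.1, hx.2.1⟩).comp_right
      ((E.isHom i i').mono fun x hx => ⟨hx.2.1.2, hx.2.2⟩)
    have h2 := ((hψ.source j i i').mono (W' := F.U j ∩ (G.U k ∩ E.U i ∩ E.U i'))
      fun x hx => ⟨⟨hx.1, hx.2.1.2⟩, hx.2.2⟩).comp_left (χ k j)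
    exact (h1.trans h2).trans ((heq i' j k).symm.mono fun x hx => ⟨hx.1, hx.2.1.1, hx.2.2⟩)
  · refine HFMap.Eqv.of_cover F.isOpen (fun x _ => F.cover x) fun j => ?_
    have h1 := ((heq i j k').mono (W' := F.U j ∩ (G.U k ∩ G.U k' ∩ E.U i))
      fun x hx => ⟨hx.1, hx.2.1.2, hx.2.2⟩).comp_left (G.φ k k')
    have h2 := ((hχ.target k k' j).mono (W' := F.U j ∩ (G.U k ∩ G.U k' ∩ E.U i))
      fun x hx => ⟨hx.2.1, hx.1⟩).comp_right
      ((hψ.isHom j i).mono fun x hx => ⟨hx.1, hx.2.2⟩)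
    exact (h1.trans h2).trans ((heq i j k).symm.mono fun x hx => ⟨hx.1, hx.2.1.1, hx.2.2⟩)

/-- Over each F.U j the averaged composites may be replaced by those through j. There the middle
pair of inverse homomorphisms collapses to φ_jj, which the next homomorphism absorbs. -/
theorem Iso.trans [CompactSpace X] [T2Space X] {E F G : VectorialBundle X} (h : E.Iso F)
    (k : F.Iso G) : E.Iso G := by
  obtain ⟨ψ, ψ', h1, h2, h3, h4⟩ := h
  obtain ⟨χ, χ', k1, k2, k3, k4⟩ := k
  obtain ⟨θ, hθ, hθ'⟩ := exists_comp h1 k1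
  obtain ⟨η, hη, hη'⟩ := exists_comp k2 h2
  refine ⟨θ, η, hθ, hη, fun i a i' => ?_, fun a i a' => ?_⟩
  · refine HFMap.Eqv.of_cover F.isOpen (fun x _ => F.cover x) fun j => ?_
    have e1 := ((hη' a j i).mono (W' := F.U j ∩ (E.U i ∩ G.U a ∩ E.U i'))
      fun x hx => ⟨hx.1, hx.2.1⟩).comp_right
      ((hθ.isHom a i').mono fun x hx => ⟨hx.2.1.2, hx.2.2⟩)
    have e2 := ((hθ' i' j a).mono (W' := F.U j ∩ (E.U i ∩ G.U a ∩ E.U i'))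
      fun x hx => ⟨hx.1, hx.2.1.2, hx.2.2⟩).comp_left ((ψ' i j).comp (χ' j a))
    have e3 := (((k3 j a j).mono (W' := F.U j ∩ (E.U i ∩ G.U a ∩ E.U i'))
      fun x hx => ⟨⟨hx.1, hx.2.1.2⟩, hx.1⟩).comp_right
      ((h1.isHom j i').mono fun x hx => ⟨hx.1, hx.2.2⟩)).comp_left (ψ' i j)
    have e4 := ((h1.target j j i').mono (W' := F.U j ∩ (E.U i ∩ G.U a ∩ E.U i'))
      fun x hx => ⟨⟨hx.1, hx.1⟩, hx.2.2⟩).comp_left (ψ' i j)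
    exact (((e1.trans e2).trans e3).trans e4).trans
      ((h3 i j i').mono fun x hx => ⟨⟨hx.2.1.1, hx.1⟩, hx.2.2⟩)
  · refine HFMap.Eqv.of_cover F.isOpen (fun x _ => F.cover x) fun j => ?_
    have e1 := ((hθ' i j a).mono (W' := F.U j ∩ (G.U a ∩ E.U i ∩ G.U a'))
      fun x hx => ⟨hx.1, hx.2.1⟩).comp_right
      ((hη.isHom i a').mono fun x hx => ⟨hx.2.1.2, hx.2.2⟩)
    have e2 := ((hη' a' j i).mono (W' := F.U j ∩ (G.U a ∩ E.U i ∩ G.U a'))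
      fun x hx => ⟨hx.1, hx.2.1.2, hx.2.2⟩).comp_left ((χ a j).comp (ψ j i))
    have e3 := (((h4 j i j).mono (W' := F.U j ∩ (G.U a ∩ E.U i ∩ G.U a'))
      fun x hx => ⟨⟨hx.1, hx.2.1.2⟩, hx.1⟩).comp_right
      ((k2.isHom j a').mono fun x hx => ⟨hx.1, hx.2.2⟩)).comp_left (χ a j)
    have e4 := ((k2.target j j a').mono (W' := F.U j ∩ (G.U a ∩ E.U i ∩ G.U a'))
      fun x hx => ⟨⟨hx.1, hx.1⟩, hx.2.2⟩).comp_left (χ a j)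
    exact (((e1.trans e2).trans e3).trans e4).trans
      ((k4 a j a').mono fun x hx => ⟨⟨hx.2.1.1, hx.1⟩, hx.2.2⟩)

/-- The restriction of a vectorial bundle to a refinement of its cover. -/
def refine (E : VectorialBundle X) {ι : Type u} (i : ι → E.Idx) (V : ι → Set X)
    (hV : ∀ k, IsOpen (V k)) (hcov : ∀ x, ∃ k, x ∈ V k) (hVU : ∀ k, V k ⊆ E.U (i k)) :
    VectorialBundle X where
  Idx := ι
  U := V
  isOpen := hV
  cover := hcov
  obj k := (E.obj (i k)).restrict (hVU k)
  φ k l := ⟨(E.φ (i k) (i l)).even, (E.φ (i k) (i l)).odd⟩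
  isHom k l :=
    have h := (E.isHom (i k) (i l)).mono (inter_subset_inter (hVU k) (hVU l))
    ⟨h.cont_even, h.cont_odd, h.comm₁₀, h.comm₀₁⟩
  inverse k l := (E.inverse (i k) (i l)).mono (inter_subset_inter (hVU k) (hVU l))
  cocycle k l n := (E.cocycle (i k) (i l) (i n)).mono
    (inter_subset_inter (inter_subset_inter (hVU k) (hVU l)) (hVU n))

theorem iso_refine (E : VectorialBundle X) {ι : Type u} (i : ι → E.Idx) (V : ι → Set X)
    (hV : ∀ k, IsOpen (V k)) (hcov : ∀ x, ∃ k, x ∈ V k) (hVU : ∀ k, V k ⊆ E.U (i k)) :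
    (E.refine i V hV hcov hVU).Iso E := by
  have hom : ∀ a b, ((E.φ a b).IsHom (E.U a ∩ E.U b)) := E.isHom
  have coc := E.cocycle
  refine ⟨fun j k => ⟨(E.φ j (i k)).even, (E.φ j (i k)).odd⟩,
    fun k j => ⟨(E.φ (i k) j).even, (E.φ (i k) j).odd⟩, ⟨fun j k => ?_, fun j k l => ?_,
    fun j j' k => ?_⟩, ⟨fun k j => ?_, fun k j j' => ?_, fun k l j => ?_⟩,
    fun k j l => ?_, fun j k j' => ?_⟩
  · have h := (hom j (i k)).mono (inter_subset_inter_right _ (hVU k))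
    exact ⟨h.cont_even, h.cont_odd, h.comm₁₀, h.comm₀₁⟩
  · exact (coc j (i k) (i l)).mono fun x hx => ⟨⟨hx.1.1, hVU k hx.1.2⟩, hVU l hx.2⟩
  · exact (coc j j' (i k)).mono fun x hx => ⟨hx.1, hVU k hx.2⟩
  · have h := (hom (i k) j).mono (inter_subset_inter_left _ (hVU k))
    exact ⟨h.cont_even, h.cont_odd, h.comm₁₀, h.comm₀₁⟩
  · exact (coc (i k) j j').mono fun x hx => ⟨⟨hVU k hx.1.1, hx.1.2⟩, hx.2⟩
  · exact (coc (i k) (i l) j).mono fun x hx => ⟨⟨hVU k hx.1.1, hVU l hx.1.2⟩, hx.2⟩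
  · exact (coc (i k) j (i l)).mono fun x hx => ⟨⟨hVU k hx.1.1, hx.1.2⟩, hVU l hx.2⟩
  · exact (coc j (i k) j').mono fun x hx => ⟨⟨hx.1.1, hVU k hx.1.2⟩, hx.2⟩

/-- The kernel of h lies in the low part for every μ > 0. So if h v = 0, then h (ψ v) = 0 forces ψ v
= 0, and v = χ ψ v = 0. -/
theorem Iso.invertibleAt {E F : VectorialBundle X} (h : E.Iso F) {x : X} {i : E.Idx} {j : F.Idx}
    (hi : x ∈ E.U i) (hj : x ∈ F.U j) (hinv : (F.obj j).InvertibleAt x) :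
    (E.obj i).InvertibleAt x := by
  obtain ⟨ψ, χ, h1, -, h3, -⟩ := h
  have hid := ((h3 i j i).mono (W' := E.U i ∩ F.U j) fun x hx => ⟨hx, hx.1⟩).trans
    ((E.φ_self_eqv i).mono fun x hx => hx.1)
  obtain ⟨μ, hμ, N, -, hxN, H⟩ := hid x ⟨hi, hj⟩
  have H := H x ⟨hxN, hi, hj⟩
  have hc := h1.isHom j i
  refine (E.obj i).invertibleAt_of_injective hi ?_ ?_
  all_goals
    rw [← LinearMap.ker_eq_bot, LinearMap.ker_eq_bot']
    intro v hv
  · have h0 : (ψ j i).even x v = 0 := hinv.1.1 (by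
      rw [← hc.comm₁₀ x ⟨hj, hi⟩, hv, map_zero, map_zero])
    have := H.1 v (mem_lowPart_of_eigen (r := 0) hμ (by simp [hv]))
    rw [← show (HFMap.id (E.obj i)).even x v = v from rfl, ← this]
    change (χ i j).even x ((ψ j i).even x v) = 0
    rw [h0, map_zero]
  · have h0 : (ψ j i).odd x v = 0 := hinv.2.1 (by
      rw [← hc.comm₀₁ x ⟨hj, hi⟩, hv, map_zero, map_zero])
    have := H.2 v (mem_lowPart_of_eigen (r := 0) hμ (by simp [hv]))
    rw [← show (HFMap.id (E.obj i)).odd x v = v from rfl, ← this]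
    change (χ i j).odd x ((ψ j i).odd x v) = 0
    rw [h0, map_zero]

theorem Iso.supp_eq {E F : VectorialBundle X} (h : E.Iso F) : E.supp = F.supp := by
  refine congrArg closure (ext fun x => ⟨?_, ?_⟩)
  · rintro ⟨i, hi, hn⟩
    obtain ⟨j, hj⟩ := F.cover x
    exact ⟨j, hj, fun hinv => hn (h.invertibleAt hi hj hinv)⟩
  · rintro ⟨i, hi, hn⟩
    obtain ⟨j, hj⟩ := E.cover x
    exact ⟨j, hj, fun hinv => hn (h.symm.invertibleAt hi hj hinv)⟩

end VectorialBundle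

/-! ### The graph projection, pointwise -/

theorem RealDiag.induct {V : Type} [AddCommGroup V] [Module ℂ V] {M : Module.End ℂ V}
    (hM : RealDiag M) {P : V → Prop} (eigen : ∀ r : ℝ, ∀ v, M v = (r : ℂ) • v → P v)
    (add : ∀ v w, P v → P w → P (v + w)) (v : V) : P v := by
  have hv : v ∈ ⨆ r : ℝ, M.eigenspace (r : ℂ) := by rw [hM]; exact Submodule.mem_top
  refine Submodule.iSup_induction _ (motive := P) hv
    (fun r v hv => eigen r v (Module.End.mem_eigenspace_iff.1 hv)) (eigen 0 0 (by simp)) add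

namespace Graph

/-- The scaling factor. -/
noncomputable def sc (μ : ℝ) : ℝ := √(2 / μ)

/-- The square of the cut-off function of the graph projection. -/
noncomputable def cut (μ r : ℝ) : ℝ := max 0 (1 - 2 / μ * r)

/-- The cut-off function of the graph projection. -/
noncomputable def rcut (μ r : ℝ) : ℝ := √(cut μ r)

/-- The off-diagonal function of the graph projection. -/
noncomputable def off (μ r : ℝ) : ℝ := sc μ * rcut μ r

/-- A function which is one below `μ / 2` and zero above `3 μ / 4`. -/
noncomputable def wide (μ r : ℝ) : ℝ := max 0 (min 1 (3 - 2 / μ * r * 2))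

/-- A function which is one below `μ / 8` and zero above `μ / 4`. -/
noncomputable def narrow (μ r : ℝ) : ℝ := max 0 (min 1 (2 - 2 / μ * r * 4))

theorem continuous_cut (μ : ℝ) : Continuous (cut μ) := by unfold cut; fun_prop
theorem continuous_rcut (μ : ℝ) : Continuous (rcut μ) :=
  Real.continuous_sqrt.comp (continuous_cut μ)
theorem continuous_off (μ : ℝ) : Continuous (off μ) := continuous_const.mul (continuous_rcut μ)
theorem continuous_wide (μ : ℝ) : Continuous (wide μ) := by unfold wide; fun_prop
theorem continuous_narrow (μ : ℝ) : Continuous (narrow μ) := by unfold narrow; fun_prop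

section Scalars

variable {μ : ℝ} (hμ : 0 < μ)
include hμ

theorem sc_pos : 0 < sc μ := Real.sqrt_pos.2 (by positivity)

theorem sc_sq : sc μ * sc μ = 2 / μ := Real.mul_self_sqrt (by positivity)

theorem two_div_mul_lt {r t : ℝ} (h : r < t * μ) : 2 / μ * r < 2 * t := by
  have : 2 / μ * r < 2 / μ * (t * μ) := mul_lt_mul_of_pos_left h (by positivity)
  rwa [show 2 / μ * (t * μ) = 2 * t by field_simp] at this

theorem le_two_div_mul {r t : ℝ} (h : t * μ ≤ r) : 2 * t ≤ 2 / μ * r := by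
  have : 2 / μ * (t * μ) ≤ 2 / μ * r := mul_le_mul_of_nonneg_left h (by positivity)
  rwa [show 2 / μ * (t * μ) = 2 * t by field_simp] at this

omit hμ in
theorem cut_cases (μ r : ℝ) : cut μ r = 0 ∨ cut μ r = 1 - 2 / μ * r := max_choice _ _

omit hμ in
theorem rcut_sq (μ r : ℝ) : rcut μ r * rcut μ r = cut μ r := Real.mul_self_sqrt (le_max_left _ _)

/-- With `cut` as cos² and sc² r as sin², this identity, `rcut_mul` and `narrow_mul` express cos² +
sin² = 1 wherever the first factor does not vanish. The factor is needed because `cut` is truncated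
to 0 for r ≥ μ / 2, where sc² r is at least 1. -/
theorem cut_mul (r : ℝ) : cut μ r * (cut μ r + sc μ * sc μ * r) = cut μ r := by
  rw [sc_sq hμ]
  rcases cut_cases μ r with h | h <;> rw [h] <;> ring

theorem rcut_mul (r : ℝ) : rcut μ r * (cut μ r + sc μ * sc μ * r) = rcut μ r := by
  rw [sc_sq hμ]
  rcases cut_cases μ r with h | h
  · rw [rcut, h, Real.sqrt_zero, zero_mul]
  · rw [h]; ring

theorem cut_eq {r : ℝ} (h : r < μ / 2) : cut μ r = 1 - sc μ * sc μ * r := by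
  have := two_div_mul_lt hμ (r := r) (t := 1 / 2) (by linarith)
  rw [sc_sq hμ, cut, max_eq_right (by linarith)]

theorem cut_zero {r : ℝ} (h : μ / 2 ≤ r) : cut μ r = 0 := by
  have := le_two_div_mul hμ (r := r) (t := 1 / 2) (by linarith)
  rw [cut, max_eq_left (by linarith)]

theorem rcut_zero {r : ℝ} (h : μ / 2 ≤ r) : rcut μ r = 0 := by
  rw [rcut, cut_zero hμ h, Real.sqrt_zero]

theorem off_zero {r : ℝ} (h : μ / 2 ≤ r) : off μ r = 0 := by
  rw [off, rcut_zero hμ h, mul_zero]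

theorem wide_one {r : ℝ} (h : r < μ / 2) : wide μ r = 1 := by
  have := two_div_mul_lt hμ (r := r) (t := 1 / 2) (by linarith)
  rw [wide, min_eq_left (by linarith), max_eq_right zero_le_one]

theorem wide_zero {r : ℝ} (h : μ ≤ r) : wide μ r = 0 := by
  have := le_two_div_mul hμ (r := r) (t := 1) (by linarith)
  rw [wide, max_eq_left ((min_le_right _ _).trans (by linarith))]

theorem narrow_one {r : ℝ} (h : r < μ / 8) : narrow μ r = 1 := by
  have := two_div_mul_lt hμ (r := r) (t := 1 / 8) (by linarith)
  rw [narrow, min_eq_left (by linarith), max_eq_right zero_le_one]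

theorem narrow_zero {r : ℝ} (h : μ / 4 ≤ r) : narrow μ r = 0 := by
  have := le_two_div_mul hμ (r := r) (t := 1 / 4) (by linarith)
  rw [narrow, max_eq_left ((min_le_right _ _).trans (by linarith))]

theorem narrow_mul (r : ℝ) : narrow μ r * (cut μ r + sc μ * sc μ * r) = narrow μ r := by
  rcases lt_or_ge r (μ / 2) with h | h
  · rw [cut_eq hμ h]; ring
  · rw [narrow_zero hμ (by linarith), zero_mul]

end Scalars

variable {V₀ V₁ W₀ W₁ : Type} [AddCommGroup V₀] [Module ℂ V₀] [AddCommGroup V₁] [Module ℂ V₁]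
  [NormedAddCommGroup W₀] [InnerProductSpace ℂ W₀] [NormedAddCommGroup W₁] [InnerProductSpace ℂ W₁]

/-- A degree one map `(A, B)` whose part below `μ` is embedded in `W₀ ⊕ W₁`. -/
structure IsModel (μ : ℝ) (A : V₀ →ₗ[ℂ] V₁) (B : V₁ →ₗ[ℂ] V₀) (T₀ : V₀ →ₗ[ℂ] W₀)
    (T₁ : V₁ →ₗ[ℂ] W₁) (S₀ : W₀ →ₗ[ℂ] V₀) (S₁ : W₁ →ₗ[ℂ] V₁) : Prop where
  pos : 0 < μ
  fin₀ : FiniteDimensional ℂ V₀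
  fin₁ : FiniteDimensional ℂ V₁
  diag₀ : RealDiag (B ∘ₗ A)
  diag₁ : RealDiag (A ∘ₗ B)
  left_inv₀ : ∀ v ∈ lowPart (B ∘ₗ A) μ, S₀ (T₀ v) = v
  left_inv₁ : ∀ v ∈ lowPart (A ∘ₗ B) μ, S₁ (T₁ v) = v
  adj : ∀ v w, inner ℂ (T₁ (A v)) (T₁ w) = inner ℂ (T₀ v) (T₀ (B w))

variable {μ : ℝ} {A : V₀ →ₗ[ℂ] V₁} {B : V₁ →ₗ[ℂ] V₀} {T₀ : V₀ →ₗ[ℂ] W₀}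
    {T₁ : V₁ →ₗ[ℂ] W₁} {S₀ : W₀ →ₗ[ℂ] V₀} {S₁ : W₁ →ₗ[ℂ] V₁}

/-- The graph projection. -/
noncomputable def proj (μ : ℝ) (A : V₀ →ₗ[ℂ] V₁) (B : V₁ →ₗ[ℂ] V₀) (T₀ : V₀ →ₗ[ℂ] W₀)
    (T₁ : V₁ →ₗ[ℂ] W₁) (S₀ : W₀ →ₗ[ℂ] V₀) (S₁ : W₁ →ₗ[ℂ] V₁) : W₀ × W₁ →ₗ[ℂ] W₀ × W₁ :=
  LinearMap.prod
    ((T₀ ∘ₗ fc (cut μ) (B ∘ₗ A) ∘ₗ S₀) ∘ₗ LinearMap.fst ℂ W₀ W₁ +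
      (T₀ ∘ₗ B ∘ₗ fc (off μ) (A ∘ₗ B) ∘ₗ S₁) ∘ₗ LinearMap.snd ℂ W₀ W₁)
    (LinearMap.snd ℂ W₀ W₁ + (T₁ ∘ₗ A ∘ₗ fc (off μ) (B ∘ₗ A) ∘ₗ S₀) ∘ₗ LinearMap.fst ℂ W₀ W₁ -
      (T₁ ∘ₗ fc (cut μ) (A ∘ₗ B) ∘ₗ S₁) ∘ₗ LinearMap.snd ℂ W₀ W₁)

theorem proj_apply (k : W₀ × W₁) : proj μ A B T₀ T₁ S₀ S₁ k =
    (T₀ (fc (cut μ) (B ∘ₗ A) (S₀ k.1) + B (fc (off μ) (A ∘ₗ B) (S₁ k.2))),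
      k.2 + T₁ (A (fc (off μ) (B ∘ₗ A) (S₀ k.1)) - fc (cut μ) (A ∘ₗ B) (S₁ k.2))) := by
  simp [proj, add_sub_assoc]

theorem comp_eigen {r : ℝ} {v : V₀} (hv : (B ∘ₗ A) v = (r : ℂ) • v) :
    (A ∘ₗ B) (A v) = (r : ℂ) • A v := by
  rw [← map_smul, ← hv]; rfl

/-- The inner product for which `w ↦ (Q w, w - Q w)` is isometric. -/
@[reducible]
noncomputable def splitMetric {W : Type} [NormedAddCommGroup W] [InnerProductSpace ℂ W]
    (Q : W →ₗ[ℂ] W) : InnerProductSpace.Core ℂ W :=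
  (sumMetric (InnerProductSpace.Core.std W) (InnerProductSpace.Core.std W)).comap
    (Q.prod (LinearMap.id - Q)) (fun v w e => by
      have h1 : Q v = Q w := congrArg Prod.fst e
      have h2 : v - Q v = w - Q w := congrArg Prod.snd e
      rw [h1] at h2
      exact sub_left_injective h2)

theorem splitMetric_inner {W : Type} [NormedAddCommGroup W] [InnerProductSpace ℂ W]
    (Q : W →ₗ[ℂ] W) (v w : W) : (splitMetric Q).inner v w =
      inner ℂ (Q v) (Q w) + inner ℂ (v - Q v) (w - Q w) := rfl

namespace IsModel

section

variable (h : IsModel μ A B T₀ T₁ S₀ S₁)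
include h

theorem swap_fc (f : ℝ → ℝ) (v : V₀) : A (fc f (B ∘ₗ A) v) = fc f (A ∘ₗ B) (A v) :=
  have := h.fin₀
  have := h.fin₁
  h.diag₀.fc_intertwine (M' := A ∘ₗ B) A (fun _ => rfl) f v

theorem swap_fc' (f : ℝ → ℝ) (v : V₁) : B (fc f (A ∘ₗ B) v) = fc f (B ∘ₗ A) (B v) :=
  have := h.fin₀
  have := h.fin₁
  h.diag₁.fc_intertwine (M' := B ∘ₗ A) B (fun _ => rfl) f v

/-- This is cos² sin² = cos² − cos⁴. By it the matrix with rows (cos², off · B) and (off · A, 1 −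
cos²) is idempotent. -/
theorem off_sq (r : ℝ) : off μ r * off μ r * r = cut μ r - cut μ r * cut μ r := by
  simp only [off]
  linear_combination (sc μ * sc μ * r) * rcut_sq μ r + cut_mul h.pos r

/-- This and the next three lemmas are the four entries of the idempotency, before the passage to W₀
⊕ W₁ and up to cancelling the identity in the lower right corner. -/
theorem cut_cut (v : V₀) : fc (cut μ) (B ∘ₗ A) (fc (cut μ) (B ∘ₗ A) v) +
    B (fc (off μ) (A ∘ₗ B) (A (fc (off μ) (B ∘ₗ A) v))) = fc (cut μ) (B ∘ₗ A) v := by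
  have := h.fin₀
  have := h.fin₁
  induction v using h.diag₀.induct with
  | eigen r v hv =>
    have hv' : B (A v) = (r : ℂ) • v := hv
    have hs : (off μ r * off μ r * r : ℂ) = cut μ r - cut μ r * cut μ r := by
      exact_mod_cast h.off_sq r
    simp only [fc_apply _ hv, map_smul, fc_apply _ (comp_eigen hv), hv']
    linear_combination (norm := module) hs • v
  | add v w e e' =>
    simp only [map_add]
    linear_combination (norm := module) e + e'

theorem cut_off (w : V₁) : fc (cut μ) (B ∘ₗ A) (B (fc (off μ) (A ∘ₗ B) w)) +
    B (fc (off μ) (A ∘ₗ B) (w - fc (cut μ) (A ∘ₗ B) w)) = B (fc (off μ) (A ∘ₗ B) w) := by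
  have := h.fin₁
  rw [← h.swap_fc', map_sub, map_sub, h.diag₁.fc_mul, h.diag₁.fc_mul]
  simp only [mul_comm (cut μ _)]
  abel

theorem off_cut (v : V₀) : A (fc (off μ) (B ∘ₗ A) (fc (cut μ) (B ∘ₗ A) v)) -
    fc (cut μ) (A ∘ₗ B) (A (fc (off μ) (B ∘ₗ A) v)) = 0 := by
  have := h.fin₀
  rw [← h.swap_fc, h.diag₀.fc_mul, h.diag₀.fc_mul]
  simp only [mul_comm (cut μ _), sub_self]

theorem off_off (w : V₁) : A (fc (off μ) (B ∘ₗ A) (B (fc (off μ) (A ∘ₗ B) w))) -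
    fc (cut μ) (A ∘ₗ B) (w - fc (cut μ) (A ∘ₗ B) w) = 0 := by
  have := h.fin₀
  have := h.fin₁
  induction w using h.diag₁.induct with
  | eigen r v hv =>
    have hv' : A (B v) = (r : ℂ) • v := hv
    have hs : (off μ r * off μ r * r : ℂ) = cut μ r - cut μ r * cut μ r := by
      exact_mod_cast h.off_sq r
    simp only [fc_apply _ hv, map_smul, map_sub, fc_apply _ (comp_eigen hv), hv']
    linear_combination (norm := module) hs • v
  | add v w e e' =>
    simp only [map_add, map_sub] at e e' ⊢
    linear_combination (norm := module) e + e'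

theorem left_inv_fc₀ {f : ℝ → ℝ} (hf : ∀ r, μ ≤ r → f r = 0) (v : V₀) :
    S₀ (T₀ (fc f (B ∘ₗ A) v)) = fc f (B ∘ₗ A) v :=
  have := h.fin₀
  h.left_inv₀ _ (h.diag₀.fc_mem_lowPart hf v)

theorem left_inv_fc₁ {f : ℝ → ℝ} (hf : ∀ r, μ ≤ r → f r = 0) (v : V₁) :
    S₁ (T₁ (fc f (A ∘ₗ B) v)) = fc f (A ∘ₗ B) v :=
  have := h.fin₁
  h.left_inv₁ _ (h.diag₁.fc_mem_lowPart hf v)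

theorem cut_low (r : ℝ) (hr : μ ≤ r) : cut μ r = 0 := cut_zero h.pos (by linarith [h.pos])
theorem rcut_low (r : ℝ) (hr : μ ≤ r) : rcut μ r = 0 := rcut_zero h.pos (by linarith [h.pos])
theorem off_low (r : ℝ) (hr : μ ≤ r) : off μ r = 0 := off_zero h.pos (by linarith [h.pos])
theorem narrow_low (r : ℝ) (hr : μ ≤ r) : narrow μ r = 0 :=
  narrow_zero h.pos (by linarith [h.pos])

theorem left_inv_fst (v : V₀) (w : V₁) :
    S₀ (T₀ (fc (cut μ) (B ∘ₗ A) v + B (fc (off μ) (A ∘ₗ B) w))) =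
      fc (cut μ) (B ∘ₗ A) v + B (fc (off μ) (A ∘ₗ B) w) := by
  rw [h.swap_fc', map_add, map_add, h.left_inv_fc₀ h.cut_low, h.left_inv_fc₀ h.off_low]

theorem left_inv_snd (v : V₀) (w : V₁) :
    S₁ (T₁ (A (fc (off μ) (B ∘ₗ A) v) - fc (cut μ) (A ∘ₗ B) w)) =
      A (fc (off μ) (B ∘ₗ A) v) - fc (cut μ) (A ∘ₗ B) w := by
  rw [h.swap_fc, map_sub, map_sub, h.left_inv_fc₁ h.cut_low, h.left_inv_fc₁ h.off_low]

/-- All cut-offs vanish from μ on, so S and T cancel between the two factors and the product is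
computed in V₀ ⊕ V₁. -/
theorem proj_proj (k : W₀ × W₁) :
    proj μ A B T₀ T₁ S₀ S₁ (proj μ A B T₀ T₁ S₀ S₁ k) = proj μ A B T₀ T₁ S₀ S₁ k := by
  simp only [proj_apply]
  rw [h.left_inv_fst, map_add S₁, h.left_inv_snd]
  set v := S₀ k.1
  set w := S₁ k.2
  have e1 := h.cut_cut v
  have e2 := h.cut_off w
  have e3 := h.off_cut v
  have e4 := h.off_off w
  refine Prod.ext ?_ ?_
  · simp only [map_add, map_sub] at e1 e2 ⊢
    rw [← map_add T₀, ← map_add T₀]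
    simp only [← map_add T₀, ← map_sub T₀]
    congr 1
    linear_combination (norm := module) e1 + e2
  · change k.2 + _ + _ = k.2 + _
    rw [add_eq_left, ← map_zero T₁]
    congr 1
    simp only [map_add, map_sub] at e3 e4 ⊢
    linear_combination (norm := module) e3 + e4

/-- The relations satisfied by the elements of the range of the graph projection. -/
theorem range_relations {k : W₀ × W₁} (hk : proj μ A B T₀ T₁ S₀ S₁ k = k) :
    fc (cut μ) (B ∘ₗ A) (S₀ k.1) + B (fc (off μ) (A ∘ₗ B) (S₁ k.2)) = S₀ k.1 ∧
      A (fc (off μ) (B ∘ₗ A) (S₀ k.1)) = fc (cut μ) (A ∘ₗ B) (S₁ k.2) ∧ T₀ (S₀ k.1) = k.1 := by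
  rw [proj_apply] at hk
  have h1 := congrArg Prod.fst hk
  have h2 := congrArg Prod.snd hk
  have e1 := h.left_inv_fst (S₀ k.1) (S₁ k.2)
  have e2 := h.left_inv_snd (S₀ k.1) (S₁ k.2)
  simp only at h1 h2
  rw [add_eq_left] at h2
  rw [h1] at e1
  rw [h2, map_zero] at e2
  exact ⟨e1.symm, sub_eq_zero.1 e2.symm, by rw [e1, h1]⟩

/-! ### Comparison with the range of the graph projection -/

end

end IsModel

/-- The comparison map into the range of the projection. -/
noncomputable def toRange (μ : ℝ) (A : V₀ →ₗ[ℂ] V₁) (B : V₁ →ₗ[ℂ] V₀) (T₀ : V₀ →ₗ[ℂ] W₀)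
    (T₁ : V₁ →ₗ[ℂ] W₁) : V₀ →ₗ[ℂ] W₀ × W₁ :=
  LinearMap.prod (T₀ ∘ₗ fc (rcut μ) (B ∘ₗ A) ∘ₗ fc (narrow μ) (B ∘ₗ A))
    ((sc μ : ℂ) • (T₁ ∘ₗ A ∘ₗ fc (narrow μ) (B ∘ₗ A)))

/-- The comparison map from the range of the projection. -/
noncomputable def ofRange (μ : ℝ) (A : V₀ →ₗ[ℂ] V₁) (B : V₁ →ₗ[ℂ] V₀) (S₀ : W₀ →ₗ[ℂ] V₀)
    (S₁ : W₁ →ₗ[ℂ] V₁) : W₀ × W₁ →ₗ[ℂ] V₀ :=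
  fc (narrow μ) (B ∘ₗ A) ∘ₗ (fc (rcut μ) (B ∘ₗ A) ∘ₗ S₀ ∘ₗ LinearMap.fst ℂ W₀ W₁ +
    (sc μ : ℂ) • (B ∘ₗ S₁ ∘ₗ LinearMap.snd ℂ W₀ W₁))

theorem toRange_apply (v : V₀) : toRange μ A B T₀ T₁ v =
    (T₀ (fc (rcut μ) (B ∘ₗ A) (fc (narrow μ) (B ∘ₗ A) v)),
      (sc μ : ℂ) • T₁ (A (fc (narrow μ) (B ∘ₗ A) v))) := rfl

theorem ofRange_apply (k : W₀ × W₁) : ofRange μ A B S₀ S₁ k =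
    fc (narrow μ) (B ∘ₗ A) (fc (rcut μ) (B ∘ₗ A) (S₀ k.1) + (sc μ : ℂ) • B (S₁ k.2)) := rfl

namespace IsModel

variable (h : IsModel μ A B T₀ T₁ S₀ S₁)
include h

theorem left_inv_toRange_fst (v : V₀) : S₀ (toRange μ A B T₀ T₁ v).1 =
    fc (rcut μ) (B ∘ₗ A) (fc (narrow μ) (B ∘ₗ A) v) :=
  h.left_inv_fc₀ h.rcut_low _

theorem left_inv_toRange_snd (v : V₀) : S₁ (toRange μ A B T₀ T₁ v).2 =
    (sc μ : ℂ) • A (fc (narrow μ) (B ∘ₗ A) v) := by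
  change S₁ ((sc μ : ℂ) • T₁ (A (fc (narrow μ) (B ∘ₗ A) v))) = _
  rw [h.swap_fc, map_smul, h.left_inv_fc₁ h.narrow_low]

/-- The vector (cos · v, sc A v) lies on the graph onto which the matrix projects. The cut-off
`narrow` enters only in order to cancel S₁ against T₁. -/
theorem proj_toRange (v : V₀) :
    proj μ A B T₀ T₁ S₀ S₁ (toRange μ A B T₀ T₁ v) = toRange μ A B T₀ T₁ v := by
  have := h.fin₀
  have := h.fin₁
  rw [proj_apply, h.left_inv_toRange_fst, h.left_inv_toRange_snd]
  have e1 : fc (cut μ) (B ∘ₗ A) (fc (rcut μ) (B ∘ₗ A) (fc (narrow μ) (B ∘ₗ A) v)) +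
      B (fc (off μ) (A ∘ₗ B) ((sc μ : ℂ) • A (fc (narrow μ) (B ∘ₗ A) v))) =
      fc (rcut μ) (B ∘ₗ A) (fc (narrow μ) (B ∘ₗ A) v) := by
    generalize fc (narrow μ) (B ∘ₗ A) v = v
    induction v using h.diag₀.induct with
    | eigen r v hv =>
      have hv' : B (A v) = (r : ℂ) • v := hv
      have hs : (rcut μ r * (cut μ r + sc μ * sc μ * r) : ℂ) = rcut μ r := by
        exact_mod_cast rcut_mul h.pos r
      simp only [fc_apply _ hv, map_smul, fc_apply _ (comp_eigen hv), hv', off, Complex.ofReal_mul]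
      linear_combination (norm := module) hs • v
    | add v w e e' =>
      simp only [map_add, smul_add] at e e' ⊢
      linear_combination (norm := module) e + e'
  have e2 : A (fc (off μ) (B ∘ₗ A) (fc (rcut μ) (B ∘ₗ A) (fc (narrow μ) (B ∘ₗ A) v))) -
      fc (cut μ) (A ∘ₗ B) ((sc μ : ℂ) • A (fc (narrow μ) (B ∘ₗ A) v)) = 0 := by
    generalize fc (narrow μ) (B ∘ₗ A) v = v
    induction v using h.diag₀.induct with
    | eigen r v hv =>
      have hs : (rcut μ r * rcut μ r : ℂ) = cut μ r := by exact_mod_cast rcut_sq μ r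
      simp only [fc_apply _ hv, map_smul, fc_apply _ (comp_eigen hv), off, Complex.ofReal_mul]
      linear_combination (norm := module) ((sc μ : ℂ) * hs) • A v
    | add v w e e' =>
      simp only [map_add, smul_add] at e e' ⊢
      linear_combination (norm := module) e + e'
  rw [e1, e2, map_zero, add_zero]
  rfl

/-- The right side is the component h₀₁ of the global object. The first components agree because off
= sc · cos, the second ones because narrow · (cos² + sin²) = narrow. -/
theorem toRange_comm (e : V₁) : toRange μ A B T₀ T₁ (B e) =
    ((sc μ)⁻¹ : ℂ) • proj μ A B T₀ T₁ S₀ S₁ (0, T₁ (fc (narrow μ) (A ∘ₗ B) e)) := by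
  have := h.fin₀
  have := h.fin₁
  have hc : (sc μ : ℂ) ≠ 0 := by exact_mod_cast (sc_pos h.pos).ne'
  rw [proj_apply, h.left_inv_fc₁ h.narrow_low]
  simp only [map_zero, zero_add, zero_sub, map_neg]
  refine Prod.ext ?_ ?_
  · rw [toRange_apply, Prod.smul_fst, ← map_smul]
    simp only
    rw [← h.swap_fc', ← h.swap_fc']
    rw [← map_smul]
    congr 1
    generalize fc (narrow μ) (A ∘ₗ B) e = w
    induction w using h.diag₁.induct with
    | eigen r v hv =>
      simp only [fc_apply _ hv, off, Complex.ofReal_mul, map_smul, smul_smul]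
      rw [← mul_assoc, inv_mul_cancel₀ hc, one_mul]
    | add v w e e' => simp only [map_add, smul_add, e, e']
  · have e2 : (sc μ : ℂ) • A (fc (narrow μ) (B ∘ₗ A) (B e)) = ((sc μ)⁻¹ : ℂ) •
        (fc (narrow μ) (A ∘ₗ B) e - fc (cut μ) (A ∘ₗ B) (fc (narrow μ) (A ∘ₗ B) e)) := by
      rw [eq_inv_smul_iff₀ hc, ← h.swap_fc']
      induction e using h.diag₁.induct with
      | eigen r v hv =>
        have hv' : A (B v) = (r : ℂ) • v := hv
        have hs : (narrow μ r * (cut μ r + sc μ * sc μ * r) : ℂ) = narrow μ r := by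
          exact_mod_cast narrow_mul h.pos r
        simp only [fc_apply _ hv, map_smul, hv']
        linear_combination (norm := module) hs • v
      | add v w e e' =>
        simp only [map_add, smul_add] at e e' ⊢
        linear_combination (norm := module) e + e'
    have e3 := congrArg T₁ e2
    rw [toRange_apply, Prod.smul_snd]
    simpa only [map_smul, map_add, map_neg, sub_eq_add_neg] using e3

/-- On the range of the projection, A off S₀ k.1 = cut S₁ k.2. This trades the first component of k
for the second, and cos² + sin² = 1 under `narrow` does the rest. -/
theorem ofRange_comm {k : W₀ × W₁} (hk : proj μ A B T₀ T₁ S₀ S₁ k = k) :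
    A (ofRange μ A B S₀ S₁ k) = fc (narrow μ) (A ∘ₗ B) (S₁ (((sc μ)⁻¹ : ℂ) • k.2)) := by
  have := h.fin₀
  have := h.fin₁
  have hc : (sc μ : ℂ) ≠ 0 := by exact_mod_cast (sc_pos h.pos).ne'
  obtain ⟨-, h2, -⟩ := h.range_relations hk
  have e1 : (sc μ : ℂ) • A (fc (rcut μ) (B ∘ₗ A) (S₀ k.1)) = A (fc (off μ) (B ∘ₗ A) (S₀ k.1)) := by
    generalize S₀ k.1 = v
    induction v using h.diag₀.induct with
    | eigen r v hv => simp only [fc_apply _ hv, off, Complex.ofReal_mul, map_smul, smul_smul]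
    | add v w e e' => simp only [map_add, smul_add, e, e']
  have e2 : fc (narrow μ) (A ∘ₗ B) (fc (cut μ) (A ∘ₗ B) (S₁ k.2) +
      (sc μ * sc μ : ℂ) • A (B (S₁ k.2))) = fc (narrow μ) (A ∘ₗ B) (S₁ k.2) := by
    generalize S₁ k.2 = w
    induction w using h.diag₁.induct with
    | eigen r v hv =>
      have hv' : A (B v) = (r : ℂ) • v := hv
      have hs : (narrow μ r * (cut μ r + sc μ * sc μ * r) : ℂ) = narrow μ r := by
        exact_mod_cast narrow_mul h.pos r
      simp only [fc_apply _ hv, map_smul, map_add, hv']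
      linear_combination (norm := module) hs • v
    | add v w e e' =>
      simp only [map_add, smul_add] at e e' ⊢
      linear_combination (norm := module) e + e'
  rw [ofRange_apply, h.swap_fc, map_smul, map_smul, eq_inv_smul_iff₀ hc, ← map_smul, ← e2, ← h2,
    ← e1, map_add, smul_add, map_smul, smul_smul]

theorem ofRange_comm' (w : W₁) : B (fc (narrow μ) (A ∘ₗ B) (S₁ w)) =
    ofRange μ A B S₀ S₁ (((sc μ)⁻¹ : ℂ) • proj μ A B T₀ T₁ S₀ S₁ (0, w)) := by
  have := h.fin₀
  have := h.fin₁
  have hc : (sc μ : ℂ) ≠ 0 := by exact_mod_cast (sc_pos h.pos).ne'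
  have e0 := h.left_inv_fst 0 (S₁ w)
  have e1 := h.left_inv_snd 0 (S₁ w)
  simp only [map_zero, zero_add, zero_sub, map_neg] at e0 e1
  rw [map_smul, proj_apply, ofRange_apply, h.swap_fc', ← map_smul]
  congr 1
  simp only [map_zero, zero_add, zero_sub, map_neg, map_add]
  rw [e0, neg_inj.1 e1, eq_inv_smul_iff₀ hc]
  generalize S₁ w = w
  induction w using h.diag₁.induct with
  | eigen r v hv =>
    have hv' := comp_eigen hv
    have hs : (rcut μ r * rcut μ r : ℂ) = cut μ r := by exact_mod_cast rcut_sq μ r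
    simp only [fc_apply _ hv, map_smul, fc_apply _ hv', off, Complex.ofReal_mul]
    linear_combination (norm := module) -((sc μ : ℂ) * hs) • B v
  | add v w e e' =>
    simp only [map_add, smul_add] at e e' ⊢
    linear_combination (norm := module) e + e'

/-- Below μ / 8 `narrow` is one, and the composite is cos² + sin². -/
theorem ofRange_toRange {v : V₀} (hv : v ∈ lowPart (B ∘ₗ A) (μ / 8)) :
    ofRange μ A B S₀ S₁ (toRange μ A B T₀ T₁ v) = v := by
  have := h.fin₀
  have := h.fin₁
  rw [ofRange_apply, h.left_inv_toRange_fst, h.left_inv_toRange_snd]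
  refine eqOn_lowPart (N := fc (narrow μ) (B ∘ₗ A) ∘ₗ (fc (rcut μ) (B ∘ₗ A) ∘ₗ
    fc (rcut μ) (B ∘ₗ A) ∘ₗ fc (narrow μ) (B ∘ₗ A) + (sc μ : ℂ) • (B ∘ₗ ((sc μ : ℂ) •
    (A ∘ₗ fc (narrow μ) (B ∘ₗ A)))))) (N' := LinearMap.id) (fun r hr v hv => ?_) hv
  have hv' : B (A v) = (r : ℂ) • v := hv
  have hs : (rcut μ r * rcut μ r + sc μ * sc μ * r : ℂ) = 1 := by
    have := cut_eq h.pos (r := r) (by linarith [h.pos])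
    rw [← rcut_sq] at this
    exact_mod_cast (by rw [this]; ring : rcut μ r * rcut μ r + sc μ * sc μ * r = 1)
  simp only [LinearMap.comp_apply, LinearMap.add_apply, LinearMap.smul_apply, LinearMap.id_apply,
    fc_apply _ hv, narrow_one h.pos hr, map_smul, map_add, hv', Complex.ofReal_one]
  linear_combination (norm := module) hs • v

theorem narrow_low_part {v : V₁} (hv : v ∈ lowPart (A ∘ₗ B) (μ / 8)) :
    fc (narrow μ) (A ∘ₗ B) v = v :=
  have := h.fin₁
  fc_of_mem_lowPart (fun _ hr => narrow_one h.pos hr) hv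

/-- A vector on which the cut-off function takes a nonzero value is an eigenvector. -/
theorem eigen_of_cut {r : ℝ} (hr : r < μ / 8) {y : V₁}
    (hy : fc (cut μ) (A ∘ₗ B) y = ((1 - sc μ * sc μ * r : ℝ) : ℂ) • y) :
    (A ∘ₗ B) y = (r : ℂ) • y := by
  have := h.fin₁
  have hc : (sc μ * sc μ : ℂ) ≠ 0 := by exact_mod_cast (mul_pos (sc_pos h.pos) (sc_pos h.pos)).ne'
  have h0 : ((1 - sc μ * sc μ * r : ℝ) : ℂ) ≠ 0 := by
    have := two_div_mul_lt h.pos (r := r) (t := 1 / 8) (by linarith)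
    rw [sc_sq h.pos]
    exact_mod_cast (by linarith : 0 < 1 - 2 / μ * r).ne'
  -- The relation cut · (cut + sc² h²) = cut, applied to y and divided by the nonzero value 1 − sc²
  -- r, can be solved for h² y.
  have key : ∀ y, fc (cut μ) (A ∘ₗ B) (fc (cut μ) (A ∘ₗ B) y) +
      (sc μ * sc μ : ℂ) • (A ∘ₗ B) (fc (cut μ) (A ∘ₗ B) y) = fc (cut μ) (A ∘ₗ B) y := by
    intro y
    induction y using h.diag₁.induct with
    | eigen r v hv =>
      have hs : (cut μ r * (cut μ r + sc μ * sc μ * r) : ℂ) = cut μ r := by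
        exact_mod_cast cut_mul h.pos r
      simp only [fc_apply _ hv, map_smul, hv]
      linear_combination (norm := module) hs • v
    | add v w e e' =>
      simp only [map_add, smul_add] at e e' ⊢
      linear_combination (norm := module) e + e'
  have k := key y
  simp only [hy, map_smul] at k
  rw [smul_comm (sc μ * sc μ : ℂ), ← smul_add] at k
  have k := smul_right_injective _ h0 k
  refine smul_right_injective _ hc ?_
  simp only
  simp only [Complex.ofReal_sub, Complex.ofReal_mul, Complex.ofReal_one] at k
  linear_combination (norm := module) k

theorem swap : IsModel μ B A T₁ T₀ S₁ S₀ where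
  pos := h.pos
  fin₀ := h.fin₁
  fin₁ := h.fin₀
  diag₀ := h.diag₁
  diag₁ := h.diag₀
  left_inv₀ := h.left_inv₁
  left_inv₁ := h.left_inv₀
  adj v w := by
    rw [← inner_conj_symm, ← h.adj, inner_conj_symm]

/-- By the hypothesis T₁ cut S₁ w is a nonzero multiple of w. So w is the image under T₁ of a low
vector, and S₁ is inverse to T₁ on such vectors. -/
theorem snd_of_eigen {r : ℝ} (hr : r < μ / 8) {w : W₁}
    (hw : w - T₁ (fc (cut μ) (A ∘ₗ B) (S₁ w)) = ((sc μ * sc μ * r : ℝ) : ℂ) • w) :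
    T₁ (S₁ w) = w ∧ fc (cut μ) (A ∘ₗ B) (S₁ w) = ((1 - sc μ * sc μ * r : ℝ) : ℂ) • S₁ w := by
  have h0 : ((1 - sc μ * sc μ * r : ℝ) : ℂ) ≠ 0 := by
    have := two_div_mul_lt h.pos (r := r) (t := 1 / 8) (by linarith)
    rw [sc_sq h.pos]
    exact_mod_cast (by linarith : 0 < 1 - 2 / μ * r).ne'
  have h1 : T₁ (fc (cut μ) (A ∘ₗ B) (S₁ w)) = ((1 - sc μ * sc μ * r : ℝ) : ℂ) • w := by
    push_cast at hw ⊢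
    linear_combination (norm := module) -hw
  have h2 : fc (cut μ) (A ∘ₗ B) (S₁ w) = ((1 - sc μ * sc μ * r : ℝ) : ℂ) • S₁ w := by
    rw [← map_smul, ← h1, h.left_inv_fc₁ h.cut_low]
  refine ⟨smul_right_injective _ h0 ?_, h2⟩
  simp only
  rw [← map_smul, ← h2, h1]

/-- The hypothesis `hkr` is the eigenvalue equation for the square of the map on the range, scaled
by sc². It makes S₀ k.1 and S₁ k.2 eigenvectors for r; all functions of h² become scalars on them,
and the relations of the range recover k. -/
theorem toRange_ofRange {r : ℝ} (hr : r < μ / 8) {k : W₀ × W₁}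
    (hk : proj μ A B T₀ T₁ S₀ S₁ k = k)
    (hkr : proj μ A B T₀ T₁ S₀ S₁ (0, k.2) = ((sc μ * sc μ * r : ℝ) : ℂ) • k) :
    toRange μ A B T₀ T₁ (ofRange μ A B S₀ S₁ k) = k := by
  have := h.fin₀
  have := h.fin₁
  obtain ⟨h1, h2, h3⟩ := h.range_relations hk
  rw [proj_apply] at hkr
  simp only [map_zero, zero_add, zero_sub, map_neg] at hkr
  have k1 := congrArg Prod.fst hkr
  have k2 := congrArg Prod.snd hkr
  simp only [Prod.smul_fst, Prod.smul_snd] at k1 k2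
  obtain ⟨t1, t2⟩ := h.snd_of_eigen hr (by rw [sub_eq_add_neg, k2])
  have hy := h.eigen_of_cut hr t2
  have e0 := h.left_inv_fst 0 (S₁ k.2)
  simp only [map_zero, zero_add] at e0
  rw [k1, map_smul] at e0
  have hu := h.swap.eigen_of_cut hr (y := S₀ k.1) (by
    push_cast at e0 ⊢
    linear_combination (norm := module) h1 + e0)
  have hs : (rcut μ r * rcut μ r : ℂ) = 1 - sc μ * sc μ * r := by
    have := cut_eq h.pos (r := r) (by linarith [h.pos])
    rw [← rcut_sq] at this
    exact_mod_cast this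
  have hBy := comp_eigen hy
  have hy' : A (B (S₁ k.2)) = (r : ℂ) • S₁ k.2 := hy
  have hξ : ofRange μ A B S₀ S₁ k = (rcut μ r : ℂ) • S₀ k.1 + (sc μ : ℂ) • B (S₁ k.2) := by
    rw [ofRange_apply]
    simp only [map_add, map_smul, fc_apply _ hu, fc_apply _ hBy, narrow_one h.pos hr,
      Complex.ofReal_one, one_smul]
  rw [fc_apply _ hu, fc_apply _ hy] at h1 h2
  have hcut : (cut μ r : ℂ) = 1 - sc μ * sc μ * r := by
    exact_mod_cast cut_eq h.pos (r := r) (by linarith [h.pos])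
  simp only [map_smul, off, Complex.ofReal_mul] at h1 h2
  have f1 : fc (rcut μ) (B ∘ₗ A) (fc (narrow μ) (B ∘ₗ A) (ofRange μ A B S₀ S₁ k)) = S₀ k.1 := by
    rw [hξ]
    simp only [map_add, map_smul, fc_apply _ hu, fc_apply _ hBy, narrow_one h.pos hr,
      Complex.ofReal_one, one_smul]
    linear_combination (norm := module) h1 + (hs - hcut) • S₀ k.1
  have f2 : (sc μ : ℂ) • A (fc (narrow μ) (B ∘ₗ A) (ofRange μ A B S₀ S₁ k)) = S₁ k.2 := by
    rw [hξ]
    simp only [map_add, map_smul, fc_apply _ hu, fc_apply _ hBy, narrow_one h.pos hr,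
      Complex.ofReal_one, one_smul, hy']
    linear_combination (norm := module) h2 + hcut • S₁ k.2
  rw [toRange_apply]
  refine Prod.ext ?_ ?_
  · simp only
    rw [f1, h3]
  · simp only
    rw [← map_smul, f2, t1]

/-! ### The metric for which the graph projection is self-adjoint -/

theorem inner_symm (v w : V₀) :
    inner ℂ (T₀ ((B ∘ₗ A) v)) (T₀ w) = inner ℂ (T₀ v) (T₀ ((B ∘ₗ A) w)) := by
  rw [← inner_conj_symm, LinearMap.comp_apply, ← h.adj, inner_conj_symm, h.adj,
    LinearMap.comp_apply]

/-- The form ⟨T₀ ·, T₀ ·⟩ may be degenerate at high energies, so symmetry is checked directly on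
pairs of eigenvectors, which are orthogonal for distinct eigenvalues. -/
theorem inner_fc (f : ℝ → ℝ) (v w : V₀) :
    inner ℂ (T₀ (fc f (B ∘ₗ A) v)) (T₀ w) = inner ℂ (T₀ v) (T₀ (fc f (B ∘ₗ A) w)) := by
  have := h.fin₀
  induction v using h.diag₀.induct with
  | eigen r v hv =>
    induction w using h.diag₀.induct with
    | eigen s w hw =>
      have e := h.inner_symm v w
      rw [hv, hw] at e
      rw [fc_apply _ hv, fc_apply _ hw]
      simp only [map_smul, inner_smul_left, inner_smul_right, Complex.conj_ofReal] at e ⊢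
      rcases eq_or_ne r s with rfl | hrs
      · rfl
      · have h0 : ((r : ℂ) - s) ≠ 0 := sub_ne_zero.2 (by exact_mod_cast hrs)
        have : inner ℂ (T₀ v) (T₀ w) = 0 := by
          refine (mul_eq_zero.1 (?_ : ((r : ℂ) - s) * _ = 0)).resolve_left h0
          linear_combination e
        rw [this, mul_zero, mul_zero]
    | add w w' e e' => simp only [map_add, inner_add_right, e, e']
  | add v v' e e' => simp only [map_add, inner_add_left, e, e']

theorem wide_mul {f : ℝ → ℝ} (hf : ∀ r, μ / 2 ≤ r → f r = 0) (r : ℝ) : wide μ r * f r = f r := by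
  rcases lt_or_ge r (μ / 2) with hr | hr
  · rw [wide_one h.pos hr, one_mul]
  · rw [hf r hr, mul_zero]

theorem fc_wide {f : ℝ → ℝ} (hf : ∀ r, μ / 2 ≤ r → f r = 0) (v : V₀) :
    fc (wide μ) (B ∘ₗ A) (fc f (B ∘ₗ A) v) = fc f (B ∘ₗ A) v := by
  have := h.fin₀
  rw [h.diag₀.fc_mul]
  simp only [h.wide_mul hf]

/-- The vector T₀ v is fixed by Q = T₀ wide S₀, so only the first summand of the metric survives;
there `wide` moves across by symmetry and is absorbed by v. -/
theorem splitMetric_left {v : V₀} (hv : fc (wide μ) (B ∘ₗ A) v = v) (w : W₀) :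
    (splitMetric (T₀ ∘ₗ fc (wide μ) (B ∘ₗ A) ∘ₗ S₀)).inner (T₀ v) w =
      inner ℂ (T₀ v) (T₀ (S₀ w)) := by
  have h1 : S₀ (T₀ v) = v := by
    rw [← hv]
    exact h.left_inv_fc₀ (fun r hr => wide_zero h.pos hr) v
  rw [splitMetric_inner]
  simp only [LinearMap.comp_apply, h1, hv, sub_self, inner_zero_left, add_zero]
  rw [← h.inner_fc, hv]

/-- For the given inner products S₀ and S₁ need not be adjoint to T₀ and T₁. In the split metric low
vectors see only T S, by `splitMetric_left`, and this suffices because `wide` is one wherever the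
cut-offs of the projection are nonzero. -/
theorem proj_symm (k k' : W₀ × W₁) :
    (sumMetric (splitMetric (T₀ ∘ₗ fc (wide μ) (B ∘ₗ A) ∘ₗ S₀))
      (splitMetric (T₁ ∘ₗ fc (wide μ) (A ∘ₗ B) ∘ₗ S₁))).inner (proj μ A B T₀ T₁ S₀ S₁ k) k' =
    (sumMetric (splitMetric (T₀ ∘ₗ fc (wide μ) (B ∘ₗ A) ∘ₗ S₀))
      (splitMetric (T₁ ∘ₗ fc (wide μ) (A ∘ₗ B) ∘ₗ S₁))).inner k (proj μ A B T₀ T₁ S₀ S₁ k') := by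
  set c := splitMetric (T₀ ∘ₗ fc (wide μ) (B ∘ₗ A) ∘ₗ S₀)
  set d := splitMetric (T₁ ∘ₗ fc (wide μ) (A ∘ₗ B) ∘ₗ S₁)
  have hc : ∀ r, μ / 2 ≤ r → cut μ r = 0 := fun r hr => cut_zero h.pos hr
  have ho : ∀ r, μ / 2 ≤ r → off μ r = 0 := fun r hr => off_zero h.pos hr
  -- Interchanging l and l' and conjugating exchanges the second and fourth terms and, up to
  -- `inner_fc`, preserves the others.
  have key : ∀ l l' : W₀ × W₁, (sumMetric c d).inner (proj μ A B T₀ T₁ S₀ S₁ l) l' =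
      inner ℂ (T₀ (fc (cut μ) (B ∘ₗ A) (S₀ l.1))) (T₀ (S₀ l'.1)) +
      inner ℂ (T₁ (fc (off μ) (A ∘ₗ B) (S₁ l.2))) (T₁ (A (S₀ l'.1))) + d.inner l.2 l'.2 +
      inner ℂ (T₁ (A (S₀ l.1))) (T₁ (fc (off μ) (A ∘ₗ B) (S₁ l'.2))) -
      inner ℂ (T₁ (fc (cut μ) (A ∘ₗ B) (S₁ l.2))) (T₁ (S₁ l'.2)) := by
    intro l l'
    rw [proj_apply]
    change c.inner _ _ + d.inner _ _ = _
    have v1 : fc (wide μ) (B ∘ₗ A) (fc (cut μ) (B ∘ₗ A) (S₀ l.1) +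
        B (fc (off μ) (A ∘ₗ B) (S₁ l.2))) =
        fc (cut μ) (B ∘ₗ A) (S₀ l.1) + B (fc (off μ) (A ∘ₗ B) (S₁ l.2)) := by
      rw [h.swap_fc', map_add, h.fc_wide hc, h.fc_wide ho]
    have v2 : fc (wide μ) (A ∘ₗ B) (A (fc (off μ) (B ∘ₗ A) (S₀ l.1)) -
        fc (cut μ) (A ∘ₗ B) (S₁ l.2)) =
        A (fc (off μ) (B ∘ₗ A) (S₀ l.1)) - fc (cut μ) (A ∘ₗ B) (S₁ l.2) := by
      rw [h.swap_fc, map_sub, h.swap.fc_wide hc, h.swap.fc_wide ho]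
    rw [h.splitMetric_left v1, d.add_left, h.swap.splitMetric_left v2, map_add, map_sub,
      inner_add_left, inner_sub_left, ← h.swap.adj, h.swap_fc, h.swap.inner_fc]
    ring
  have hsymm : ∀ a b : W₀ × W₁, (sumMetric c d).inner a b =
      (starRingEnd ℂ) ((sumMetric c d).inner b a) := fun a b =>
    ((sumMetric c d).conj_inner_symm a b).symm
  rw [hsymm k, key, key]
  simp only [map_add, map_sub, inner_conj_symm, d.conj_inner_symm]
  rw [h.inner_fc, h.swap.inner_fc (cut μ)]
  ring

end IsModel

end Graph

/-! ### Embedding a family of inner product spaces -/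

section Embedding

variable {m : ℕ} {n : Fin m → ℕ} {V : Fin m → Type} [∀ k, AddCommGroup (V k)]
  [∀ k, Module ℂ (V k)] {H H' : Type} [AddCommGroup H] [Module ℂ H] [AddCommGroup H'] [Module ℂ H']

/-- The weighted coordinates of the images of a vector. -/
noncomputable def weightedCoord (r : Fin m → ℝ) (c : ∀ k, InnerProductSpace.Core ℂ (V k))
    (e : ∀ k, Fin (n k) → V k) (φ : ∀ k, H →ₗ[ℂ] V k) :
    H →ₗ[ℂ] EuclideanSpace ℂ (Σ k, Fin (n k)) where
  toFun v := WithLp.toLp 2 fun p => (r p.1 : ℂ) * (c p.1).inner (e p.1 p.2) (φ p.1 v)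
  map_add' v w := by
    ext p
    simp [(c p.1).inner_add_right', mul_add]
  map_smul' a v := by
    ext p
    simp [(c p.1).inner_smul_right', mul_left_comm]

/-- The weighted sum of the images of the frame vectors. -/
noncomputable def weightedSum (r : Fin m → ℝ) (e : ∀ k, Fin (n k) → V k) (φ : ∀ k, V k →ₗ[ℂ] H) :
    EuclideanSpace ℂ (Σ k, Fin (n k)) →ₗ[ℂ] H where
  toFun w := ∑ k, (r k : ℂ) • φ k (∑ i, w ⟨k, i⟩ • e k i)
  map_add' w w' := by
    simp only [PiLp.add_apply, add_smul, Finset.sum_add_distrib, map_add, smul_add]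
  map_smul' a w := by
    rw [RingHom.id_apply, Finset.smul_sum]
    refine Finset.sum_congr rfl fun k _ => ?_
    simp only [PiLp.smul_apply, smul_eq_mul, mul_smul, ← Finset.smul_sum, map_smul]
    rw [smul_comm]

theorem weightedSum_apply (r : Fin m → ℝ) (e : ∀ k, Fin (n k) → V k) (φ : ∀ k, V k →ₗ[ℂ] H)
    (w : EuclideanSpace ℂ (Σ k, Fin (n k))) :
    weightedSum r e φ w = ∑ k, (r k : ℂ) • φ k (∑ i, w ⟨k, i⟩ • e k i) := rfl

variable {r : Fin m → ℝ} {c : ∀ k, InnerProductSpace.Core ℂ (V k)} {e : ∀ k, Fin (n k) → V k}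

/-- Parseval's identity in each frame. Frames are demanded only where the weight is nonzero, since
in a bundle the k-th frame exists only over its own open set. -/
theorem inner_weightedCoord (he : ∀ k, r k ≠ 0 → IsFrame (c k) (e k)) (φ : ∀ k, H →ₗ[ℂ] V k)
    (φ' : ∀ k, H' →ₗ[ℂ] V k) (v : H) (w : H') :
    inner ℂ (weightedCoord r c e φ v) (weightedCoord r c e φ' w) =
      ∑ k, (r k * r k : ℂ) * (c k).inner (φ k v) (φ' k w) := by
  rw [PiLp.inner_apply, Fintype.sum_sigma]
  refine Finset.sum_congr rfl fun k _ => ?_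
  by_cases hr : r k = 0
  · simp [weightedCoord, hr]
  · rw [(he k hr).inner_eq, Finset.mul_sum]
    refine Finset.sum_congr rfl fun i _ => ?_
    simp only [weightedCoord, LinearMap.coe_mk, AddHom.coe_mk, RCLike.inner_apply, map_mul,
      Complex.conj_ofReal, (c k).conj_inner_symm]
    ring

theorem weightedSum_weightedCoord (he : ∀ k, r k ≠ 0 → IsFrame (c k) (e k))
    (φ : ∀ k, H →ₗ[ℂ] V k) (φ' : ∀ k, V k →ₗ[ℂ] H') (v : H) :
    weightedSum r e φ' (weightedCoord r c e φ v) = ∑ k, (r k * r k : ℂ) • φ' k (φ k v) := by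
  rw [weightedSum_apply]
  refine Finset.sum_congr rfl fun k _ => ?_
  by_cases hr : r k = 0
  · simp [hr]
  · have hco : ∀ i, (weightedCoord r c e φ v) ⟨k, i⟩ = r k * (c k).inner (e k i) (φ k v) :=
      fun _ => rfl
    have hex := (he k hr).expand (φ k v)
    simp only [hco, mul_smul, ← Finset.smul_sum, map_smul]
    rw [← hex]

theorem weightedCoord_congr {φ : ∀ k, H →ₗ[ℂ] V k} {φ' : ∀ k, H' →ₗ[ℂ] V k} {v : H} {w : H'}
    (h : ∀ k, r k ≠ 0 → φ k v = φ' k w) :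
    weightedCoord r c e φ v = weightedCoord r c e φ' w := by
  ext p
  by_cases hr : r p.1 = 0
  · simp [weightedCoord, hr]
  · simp [weightedCoord, h _ hr]

theorem map_weightedSum {φ : ∀ k, V k →ₗ[ℂ] H} {φ' : ∀ k, V k →ₗ[ℂ] H'} {G : Type}
    [AddCommGroup G] [Module ℂ G] {f : H →ₗ[ℂ] G} {f' : H' →ₗ[ℂ] G}
    (h : ∀ k, r k ≠ 0 → ∀ v, f (φ k v) = f' (φ' k v)) (w : EuclideanSpace ℂ (Σ k, Fin (n k))) :
    f (weightedSum r e φ w) = f' (weightedSum r e φ' w) := by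
  rw [weightedSum_apply, weightedSum_apply, map_sum f, map_sum f']
  refine Finset.sum_congr rfl fun k _ => ?_
  by_cases hr : r k = 0
  · simp [hr]
  · rw [map_smul, map_smul, h k hr]

end Embedding

section EmbeddingContinuity

variable {X : Type u} [TopologicalSpace X] {m : ℕ} {n : Fin m → ℕ} {U : Fin m → Set X} {W : Set X}
  {E : ∀ k, HBundle (U k)} {r : Fin m → X → ℝ} {e : ∀ k, Fin (n k) → ∀ x, (E k).Fib x}

theorem contMap_weightedCoord (hU : ∀ k, IsOpen (U k)) (hr : ∀ k, Continuous (r k))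
    (hrU : ∀ k, tsupport (r k) ⊆ U k) (he : ∀ k i, (E k).ContSec (e k i) (U k)) {F : CBundle W}
    {φ : ∀ k x, F.Fib x →ₗ[ℂ] (E k).Fib x}
    (hφ : ∀ k, F.ContMap (E k).toCBundle (U k ∩ W) (φ k)) :
    F.ContMap (CBundle.triv X (EuclideanSpace ℂ (Σ k, Fin (n k)))) W fun x =>
      weightedCoord (fun k => r k x) (fun k => (E k).metric x) (fun k i => e k i x)
        fun k => φ k x := by
  refine CBundle.ContMap.of_contSec subset_rfl fun W' hW' s hs => ?_
  rw [CBundle.contSec_triv]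
  refine (PiLp.continuous_toLp 2 _).comp_continuousOn (continuousOn_pi.2 fun p => ?_)
  refine CBundle.contSec_triv.1 (CBundle.ContSec.smul_of_tsupport (E := CBundle.triv X ℂ)
    (c := fun x => (r p.1 x : ℂ))
    (s := fun x => ((E p.1).metric x).inner (e p.1 p.2 x) (φ p.1 x (s x)))
    (Complex.continuous_ofReal.comp (hr p.1)) (hU p.1)
    ((tsupport_ofReal_subset _).trans (hrU p.1)) (CBundle.contSec_triv.2 ?_))
  refine CBundle.ContSec.inner ((he p.1 p.2).mono inter_subset_left) ?_ inter_subset_left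
  exact (hφ p.1).contSec' (inter_subset_right.trans hW')
    (inter_subset_inter_right _ hW') (hs.mono inter_subset_right)

theorem contMap_weightedSum (hU : ∀ k, IsOpen (U k)) (hr : ∀ k, Continuous (r k))
    (hrU : ∀ k, tsupport (r k) ⊆ U k) (he : ∀ k i, (E k).ContSec (e k i) (U k)) {F : CBundle W}
    {φ : ∀ k x, (E k).Fib x →ₗ[ℂ] F.Fib x}
    (hφ : ∀ k, (E k).toCBundle.ContMap F (U k ∩ W) (φ k)) :
    (CBundle.triv X (EuclideanSpace ℂ (Σ k, Fin (n k)))).ContMap F W fun x =>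
      weightedSum (fun k => r k x) (fun k i => e k i x) fun k => φ k x := by
  rw [CBundle.contMap_triv_left]
  intro w
  simp only [weightedSum_apply]
  refine CBundle.ContSec.sum fun k _ => ?_
  refine CBundle.ContSec.smul_of_tsupport (c := fun x => (r k x : ℂ))
    (Complex.continuous_ofReal.comp (hr k)) (hU k)
    ((tsupport_ofReal_subset _).trans (hrU k)) ?_
  refine (hφ k).contSec inter_subset_left ?_
  refine CBundle.ContSec.sum fun i _ => CBundle.ContSec.smul continuousOn_const ?_
  exact (he k i).mono inter_subset_left

end EmbeddingContinuity

/-! ### Framed vectorial bundles -/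

/-- A vectorial bundle with a finite partition of unity, orthonormal frames, and a uniform bound
below which the cocycle conditions hold. -/
structure VectorialBundle.Framing {X : Type u} [TopologicalSpace X] (F : VectorialBundle X) where
  m : ℕ
  idx : Fin m → F.Idx
  r : Fin m → X → ℝ
  cont_r : ∀ k, Continuous (r k)
  supp_r : ∀ k, tsupport (r k) ⊆ F.U (idx k)
  sum_r : ∀ x, ∑ k, r k x * r k x = 1
  n₀ : Fin m → ℕ
  n₁ : Fin m → ℕ
  e₀ : ∀ k, Fin (n₀ k) → ∀ x, (F.obj (idx k)).even.Fib x
  e₁ : ∀ k, Fin (n₁ k) → ∀ x, (F.obj (idx k)).odd.Fib x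
  cont_e₀ : ∀ k i, (F.obj (idx k)).even.ContSec (e₀ k i) (F.U (idx k))
  cont_e₁ : ∀ k i, (F.obj (idx k)).odd.ContSec (e₁ k i) (F.U (idx k))
  frame₀ : ∀ k, ∀ x ∈ F.U (idx k), IsFrame ((F.obj (idx k)).even.metric x) fun i => e₀ k i x
  frame₁ : ∀ k, ∀ x ∈ F.U (idx k), IsFrame ((F.obj (idx k)).odd.metric x) fun i => e₁ k i x
  μ : ℝ
  pos : 0 < μ
  refl : ∀ i, ∀ x ∈ F.U i, (F.φ i i).AgreeAt (HFMap.id _) μ x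
  cocycle : ∀ i j k x, x ∈ F.U i → x ∈ F.U j → x ∈ F.U k →
    ((F.φ i j).comp (F.φ j k)).AgreeAt (F.φ i k) μ x

/-- Bounds become uniform on compact sets only. The cover is therefore shrunk to finitely many
framed sets whose closures lie in the old ones, and `exists_uniform` is applied to intersections of
these closures. -/
theorem VectorialBundle.exists_framing {X : Type u} [TopologicalSpace X] [CompactSpace X]
    [T2Space X] (E : VectorialBundle X) :
    ∃ F : VectorialBundle X, F.Iso E ∧ Nonempty F.Framing := by
  have hloc : ∀ x, ∃ (i : E.Idx) (V : Set X) (n₀ n₁ : ℕ)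
      (e₀ : Fin n₀ → ∀ x, (E.obj i).even.Fib x) (e₁ : Fin n₁ → ∀ x, (E.obj i).odd.Fib x),
      IsOpen V ∧ x ∈ V ∧ closure V ⊆ E.U i ∧
      (∀ k, (E.obj i).even.ContSec (e₀ k) V) ∧ (∀ k, (E.obj i).odd.ContSec (e₁ k) V) ∧
      (∀ x ∈ V, IsFrame ((E.obj i).even.metric x) fun k => e₀ k x) ∧
      (∀ x ∈ V, IsFrame ((E.obj i).odd.metric x) fun k => e₁ k x) := by
    intro x
    obtain ⟨i, hi⟩ := E.cover x
    obtain ⟨n₀, e₀, N₀, hN₀, hx₀, hc₀, hf₀⟩ := (E.obj i).even.exists_frame hi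
    obtain ⟨n₁, e₁, N₁, hN₁, hx₁, hc₁, hf₁⟩ := (E.obj i).odd.exists_frame hi
    have hO : IsOpen (N₀ ∩ N₁ ∩ E.U i) := (hN₀.inter hN₁).inter (E.isOpen i)
    obtain ⟨K, hK, hKc, hKO⟩ := exists_mem_nhds_isClosed_subset (hO.mem_nhds ⟨⟨hx₀, hx₁⟩, hi⟩)
    have hVK : interior K ⊆ N₀ ∩ N₁ ∩ E.U i := interior_subset.trans hKO
    refine ⟨i, interior K, n₀, n₁, e₀, e₁, isOpen_interior, mem_interior_iff_mem_nhds.2 hK,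
      ?_, ?_, ?_, ?_, ?_⟩
    · exact (closure_minimal interior_subset hKc).trans fun y hy => (hKO hy).2
    · exact fun k => (hc₀ k).mono fun y hy => ⟨(hVK hy).1.1, (hVK hy).2⟩
    · exact fun k => (hc₁ k).mono fun y hy => ⟨(hVK hy).1.2, (hVK hy).2⟩
    · exact fun y hy => hf₀ y ⟨(hVK hy).1.1, (hVK hy).2⟩
    · exact fun y hy => hf₁ y ⟨(hVK hy).1.2, (hVK hy).2⟩
  choose i V n₀ n₁ e₀ e₁ hV hxV hVU hc₀ hc₁ hf₀ hf₁ using hloc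
  obtain ⟨m, p, r, hr, hrV, hsum⟩ := exists_finite_partition V hV hxV
  -- The index type of a vectorial bundle lies in the universe of X, whence `ULift`.
  have hcov : ∀ x, ∃ k : ULift.{u} (Fin m), x ∈ V (p k.down) := by
    intro x
    by_contra! hx
    have h0 : ∑ k, r k x * r k x = 0 := Finset.sum_eq_zero fun k _ => by
      have : r k x = 0 := image_eq_zero_of_notMem_tsupport fun h => hx ⟨k⟩ (hrV k h)
      rw [this, mul_zero]
    rw [hsum x] at h0
    exact one_ne_zero h0
  have hVU' : ∀ k : ULift.{u} (Fin m), V (p k.down) ⊆ E.U (i (p k.down)) := fun k =>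
    subset_closure.trans (hVU _)
  have h1 : ∀ k : Fin m, ∃ μ : ℝ, 0 < μ ∧ ∀ y ∈ closure (V (p k)),
      (E.φ (i (p k)) (i (p k))).AgreeAt (HFMap.id _) μ y := fun k =>
    (E.φ_self_eqv _).exists_uniform isClosed_closure.isCompact (hVU _)
  have h2 : ∀ t : Fin m × Fin m × Fin m, ∃ μ : ℝ, 0 < μ ∧
      ∀ y ∈ closure (V (p t.1)) ∩ closure (V (p t.2.1)) ∩ closure (V (p t.2.2)),
      ((E.φ (i (p t.1)) (i (p t.2.1))).comp (E.φ (i (p t.2.1)) (i (p t.2.2)))).AgreeAt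
        (E.φ (i (p t.1)) (i (p t.2.2))) μ y := fun t =>
    (E.cocycle _ _ _).exists_uniform
      ((isClosed_closure.inter isClosed_closure).inter isClosed_closure).isCompact
      (inter_subset_inter (inter_subset_inter (hVU _) (hVU _)) (hVU _))
  choose μ₁ hμ₁ H1 using h1
  choose μ₂ hμ₂ H2 using h2
  obtain ⟨ν₁, hν₁, hle₁⟩ := exists_pos_le μ₁ hμ₁
  obtain ⟨ν₂, hν₂, hle₂⟩ := exists_pos_le μ₂ hμ₂
  refine ⟨E.refine (fun k : ULift.{u} (Fin m) => i (p k.down)) (fun k => V (p k.down))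
    (fun k => hV _) hcov hVU', E.iso_refine _ _ _ _ _, ⟨{
      m := m
      idx := fun k => ⟨k⟩
      r := r
      cont_r := hr
      supp_r := hrV
      sum_r := hsum
      n₀ := fun k => n₀ (p k)
      n₁ := fun k => n₁ (p k)
      e₀ := fun k => e₀ (p k)
      e₁ := fun k => e₁ (p k)
      cont_e₀ := fun k => hc₀ (p k)
      cont_e₁ := fun k => hc₁ (p k)
      frame₀ := fun k => hf₀ (p k)
      frame₁ := fun k => hf₁ (p k)
      μ := min ν₁ ν₂
      pos := lt_min hν₁ hν₂
      refl := fun k x hx => (H1 k.down x (subset_closure hx)).mono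
        ((min_le_left _ _).trans (hle₁ _))
      cocycle := fun k l n x hk hl hn => (H2 (k.down, l.down, n.down) x
        ⟨⟨subset_closure hk, subset_closure hl⟩, subset_closure hn⟩).mono
        ((min_le_right _ _).trans (hle₂ _)) }⟩⟩

/-! ### The bundle of ranges of a continuous family of projections -/

namespace CBundle

variable {X : Type u} [TopologicalSpace X] {F : Type} [NormedAddCommGroup F] [NormedSpace ℂ F]

/-- The comparison between nearby projections. -/
noncomputable def projComparison (p q : F →L[ℂ] F) : F →L[ℂ] F := p * q + (1 - p) * (1 - q)

/-- The operator c = p q + (1 − p)(1 − q) satisfies c q = p q = p c, so it carries the range of q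
into that of p. It is 1 for q = p, hence invertible for q near p, and so it trivializes a bundle of
ranges. -/
theorem projComparison_right {p q : F →L[ℂ] F} (hq : q * q = q) :
    projComparison p q * q = p * q := by
  simp only [projComparison, add_mul, mul_assoc, sub_mul, one_mul, hq, sub_self, mul_zero, add_zero]

theorem projComparison_left {p q : F →L[ℂ] F} (hp : p * p = p) :
    p * projComparison p q = p * q := by
  simp only [projComparison, mul_add, ← mul_assoc, mul_sub, mul_one, hp, sub_self, zero_mul,
    add_zero]

variable [FiniteDimensional ℂ F]

theorem continuousAt_inverse_projComparison {p : X → F →L[ℂ] F} (hp : Continuous p) {q : F →L[ℂ] F}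
    {x : X} (hx : IsUnit (projComparison q (p x))) :
    ContinuousAt (fun x => Ring.inverse (projComparison q (p x))) x := by
  have := FiniteDimensional.complete ℂ F
  obtain ⟨w, hw⟩ := hx
  refine ContinuousAt.comp (g := Ring.inverse) ?_ (((continuous_const.mul hp).add
    (continuous_const.mul (continuous_const.sub hp))).continuousAt)
  rw [← hw]
  exact NormedRing.inverse_continuousAt w

/-- The vector bundle of the ranges of a continuous family of projections. -/
noncomputable def ofProj (p : X → F →L[ℂ] F) (hp : Continuous p) (hpp : ∀ x, p x * p x = p x) :
    CBundle (univ : Set X) :=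
  have := FiniteDimensional.complete ℂ F
  { Fib := fun x => LinearMap.range (p x : F →ₗ[ℂ] F)
    Idx := X
    chart := fun x₀ =>
      { Model := LinearMap.range (p x₀ : F →ₗ[ℂ] F)
        dom := {x | IsUnit (projComparison (p x₀) (p x))}
        isOpen_dom := Units.isOpen.preimage
          ((continuous_const.mul hp).add (continuous_const.mul (continuous_const.sub hp)))
        coord := fun x => (p x₀ : F →ₗ[ℂ] F).rangeRestrict ∘ₗ Submodule.subtype _
        lift := fun x => (p x : F →ₗ[ℂ] F).rangeRestrict ∘ₗ
          ((Ring.inverse (projComparison (p x₀) (p x)) : F →L[ℂ] F) : F →ₗ[ℂ] F) ∘ₗ Submodule.subtype _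
        coord_lift := by
          rintro x hx ⟨_, w, rfl⟩
          refine Subtype.ext ?_
          -- With c the comparison operator, p₀ p c⁻¹ p₀ = p₀ c c⁻¹ p₀ = p₀.
          change (p x₀ * p x * Ring.inverse (projComparison (p x₀) (p x)) * p x₀) w = p x₀ w
          congr 1
          have e1 : projComparison (p x₀) (p x) * (p x * Ring.inverse (projComparison (p x₀) (p x))
              * p x₀) = p x₀ := by
            rw [← mul_assoc, ← mul_assoc, projComparison_right (hpp x),
              ← projComparison_left (hpp x₀), mul_assoc (p x₀), Ring.mul_inverse_cancel _ hx,
              mul_one, hpp]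
          rw [← projComparison_left (hpp x₀), mul_assoc (p x₀), Ring.mul_inverse_cancel _ hx,
            mul_one, hpp]
        lift_coord := by
          rintro x hx ⟨_, w, rfl⟩
          refine Subtype.ext ?_
          change (p x * Ring.inverse (projComparison (p x₀) (p x)) * (p x₀ * p x)) w = p x w
          congr 1
          rw [← projComparison_right (hpp x), mul_assoc, ← mul_assoc (Ring.inverse _),
            Ring.inverse_mul_cancel _ hx, one_mul, hpp] }
    cover := fun x _ => ⟨x, by
      have : projComparison (p x) (p x) = 1 := by
        simp only [projComparison, mul_sub, sub_mul, one_mul, mul_one, hpp]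
        abel
      change IsUnit (projComparison (p x) (p x))
      rw [this]
      exact isUnit_one⟩
    compat := fun x₀ x₁ v => by
      refine Topology.IsInducing.subtypeVal.continuousOn_iff.2 ?_
      change ContinuousOn (fun x => p x₁ (p x (Ring.inverse (projComparison (p x₀) (p x)) v.1))) _
      intro x hx
      have h1 := continuousAt_inverse_projComparison hp hx.1.1
      exact ((p x₁).continuous.continuousAt.comp
        (hp.continuousAt.clm_apply (h1.clm_apply continuousAt_const))).continuousWithinAt }

variable {p : X → F →L[ℂ] F} {hp : Continuous p} {hpp : ∀ x, p x * p x = p x}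

/-- The inclusion of the bundle of ranges. -/
noncomputable def ofProjIncl (p : X → F →L[ℂ] F) (hp : Continuous p) (hpp : ∀ x, p x * p x = p x)
    (x : X) : (ofProj p hp hpp).Fib x →ₗ[ℂ] F :=
  (LinearMap.range (p x : F →ₗ[ℂ] F)).subtype

/-- The projection to the bundle of ranges. -/
noncomputable def ofProjMap (p : X → F →L[ℂ] F) (hp : Continuous p) (hpp : ∀ x, p x * p x = p x)
    (x : X) : F →ₗ[ℂ] (ofProj p hp hpp).Fib x :=
  (p x : F →ₗ[ℂ] F).rangeRestrict

theorem proj_ofProjIncl (x : X) (v : (ofProj p hp hpp).Fib x) :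
    p x (ofProjIncl p hp hpp x v) = ofProjIncl p hp hpp x v := by
  obtain ⟨_, w, rfl⟩ := v
  exact DFunLike.congr_fun (hpp x) w

theorem ofProjIncl_injective (x : X) : Function.Injective (ofProjIncl p hp hpp x) :=
  Subtype.val_injective

theorem contMap_ofProjMap : (triv X F).ContMap (ofProj p hp hpp) univ (ofProjMap p hp hpp) := by
  intro a x₁ v
  refine Topology.IsInducing.subtypeVal.continuousOn_iff.2 ?_
  exact ((p x₁).continuous.comp (hp.clm_apply continuous_const)).continuousOn

theorem contMap_ofProjIncl : (ofProj p hp hpp).ContMap (triv X F) univ (ofProjIncl p hp hpp) := by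
  have := FiniteDimensional.complete ℂ F
  intro x₀ a v
  change ContinuousOn (fun x => p x (Ring.inverse (projComparison (p x₀) (p x)) v.1)) _
  intro x hx
  have h1 := continuousAt_inverse_projComparison hp hx.1.1
  exact (hp.continuousAt.clm_apply (h1.clm_apply continuousAt_const)).continuousWithinAt

end CBundle

/-- A Hermitian bundle from a family of inner products which is continuous on sections. -/
noncomputable def HBundle.ofMetric {X : Type u} [TopologicalSpace X] (E : CBundle (univ : Set X))
    (g : ∀ x, InnerProductSpace.Core ℂ (E.Fib x))
    (h : ∀ W s t, E.ContSec s W → E.ContSec t W →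
      ContinuousOn (fun x => (g x).inner (s x) (t x)) W) : HBundle (univ : Set X) where
  toCBundle := E
  metric := g
  cont_metric a v w := h _ _ _ (E.contSec_lift a v (subset_univ _))
    (E.contSec_lift a w (subset_univ _))

/-! ### The global object of a framed vectorial bundle -/

/-- An index of a set of the cover containing the given point. -/
noncomputable def VectorialBundle.indexAt {X : Type u} [TopologicalSpace X] (F : VectorialBundle X)
    (x : X) : F.Idx := (F.cover x).choose

theorem VectorialBundle.mem_indexAt {X : Type u} [TopologicalSpace X] (F : VectorialBundle X)
    (x : X) : x ∈ F.U (F.indexAt x) := (F.cover x).choose_spec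

namespace VectorialBundle.Framing

variable {X : Type u} [TopologicalSpace X] {F : VectorialBundle X} (Φ : F.Framing)

/-- The space in which the even part is embedded. -/
abbrev W₀ := EuclideanSpace ℂ (Σ k, Fin (Φ.n₀ k))

/-- The space in which the odd part is embedded. -/
abbrev W₁ := EuclideanSpace ℂ (Σ k, Fin (Φ.n₁ k))

/-- The embedding of the even part. -/
noncomputable def T₀ (j : F.Idx) (x : X) : (F.obj j).even.Fib x →ₗ[ℂ] Φ.W₀ :=
  weightedCoord (fun k => Φ.r k x) (fun k => (F.obj (Φ.idx k)).even.metric x)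
    (fun k i => Φ.e₀ k i x) fun k => (F.φ (Φ.idx k) j).even x

/-- The embedding of the odd part. -/
noncomputable def T₁ (j : F.Idx) (x : X) : (F.obj j).odd.Fib x →ₗ[ℂ] Φ.W₁ :=
  weightedCoord (fun k => Φ.r k x) (fun k => (F.obj (Φ.idx k)).odd.metric x)
    (fun k i => Φ.e₁ k i x) fun k => (F.φ (Φ.idx k) j).odd x

/-- The left inverse of the embedding of the even part. -/
noncomputable def S₀ (j : F.Idx) (x : X) : Φ.W₀ →ₗ[ℂ] (F.obj j).even.Fib x :=
  weightedSum (fun k => Φ.r k x) (fun k i => Φ.e₀ k i x) fun k => (F.φ j (Φ.idx k)).even x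

/-- The left inverse of the embedding of the odd part. -/
noncomputable def S₁ (j : F.Idx) (x : X) : Φ.W₁ →ₗ[ℂ] (F.obj j).odd.Fib x :=
  weightedSum (fun k => Φ.r k x) (fun k i => Φ.e₁ k i x) fun k => (F.φ j (Φ.idx k)).odd x

variable {Φ} {i j : F.Idx} {x : X}

theorem mem_of_ne_zero {k : Fin Φ.m} (h : Φ.r k x ≠ 0) : x ∈ F.U (Φ.idx k) :=
  Φ.supp_r k (subset_tsupport _ h)

theorem round_trip_even (hj : x ∈ F.U j) {v : (F.obj j).even.Fib x}
    (hv : v ∈ (F.obj j).lowEven x Φ.μ) {k : Fin Φ.m} (hk : Φ.r k x ≠ 0) :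
    (F.φ j (Φ.idx k)).even x ((F.φ (Φ.idx k) j).even x v) = v :=
  ((Φ.cocycle j (Φ.idx k) j x hj (mem_of_ne_zero hk) hj).1 v hv).trans ((Φ.refl j x hj).1 v hv)

theorem round_trip_odd (hj : x ∈ F.U j) {v : (F.obj j).odd.Fib x}
    (hv : v ∈ (F.obj j).lowOdd x Φ.μ) {k : Fin Φ.m} (hk : Φ.r k x ≠ 0) :
    (F.φ j (Φ.idx k)).odd x ((F.φ (Φ.idx k) j).odd x v) = v :=
  ((Φ.cocycle j (Φ.idx k) j x hj (mem_of_ne_zero hk) hj).2 v hv).trans ((Φ.refl j x hj).2 v hv)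

theorem sum_smul {V : Type} [AddCommGroup V] [Module ℂ V] (x : X) {f : Fin Φ.m → V} {v : V}
    (h : ∀ k, Φ.r k x ≠ 0 → f k = v) : ∑ k, (Φ.r k x * Φ.r k x : ℂ) • f k = v := by
  have h1 : ∑ k, (Φ.r k x * Φ.r k x : ℂ) = 1 := by exact_mod_cast Φ.sum_r x
  rw [← one_smul ℂ v, ← h1, Finset.sum_smul]
  refine Finset.sum_congr rfl fun k _ => ?_
  by_cases hk : Φ.r k x = 0
  · simp [hk]
  · rw [h k hk]

/-- The composite S T is Σ r_k² φ_jk φ_kj, the identity below μ by the cocycle conditions. The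
relation `adj` holds although T need not be isometric, because each φ_kj intertwines h and each h_k
is Hermitian for its own metric. -/
theorem isModel (hj : x ∈ F.U j) : Graph.IsModel Φ.μ ((F.obj j).h₁₀ x) ((F.obj j).h₀₁ x)
    (Φ.T₀ j x) (Φ.T₁ j x) (Φ.S₀ j x) (Φ.S₁ j x) where
  pos := Φ.pos
  fin₀ := (F.obj j).finiteDimensional_even hj
  fin₁ := (F.obj j).finiteDimensional_odd hj
  diag₀ := (F.obj j).realDiag_sqEven hj
  diag₁ := (F.obj j).realDiag_sqOdd hj
  left_inv₀ v hv := by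
    rw [T₀, S₀, weightedSum_weightedCoord fun k hk => Φ.frame₀ k x (mem_of_ne_zero hk)]
    exact sum_smul x fun k hk => round_trip_even hj hv hk
  left_inv₁ v hv := by
    rw [T₁, S₁, weightedSum_weightedCoord fun k hk => Φ.frame₁ k x (mem_of_ne_zero hk)]
    exact sum_smul x fun k hk => round_trip_odd hj hv hk
  adj v w := by
    rw [T₀, T₁, inner_weightedCoord fun k hk => Φ.frame₁ k x (mem_of_ne_zero hk),
      inner_weightedCoord fun k hk => Φ.frame₀ k x (mem_of_ne_zero hk)]
    refine Finset.sum_congr rfl fun k _ => ?_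
    by_cases hk : Φ.r k x = 0
    · simp [hk]
    · have hxk := mem_of_ne_zero hk
      rw [(F.isHom _ j).comm₁₀ x ⟨hxk, hj⟩, (F.isHom _ j).comm₀₁ x ⟨hxk, hj⟩,
        (F.obj (Φ.idx k)).hermitian x hxk]

/-! ### Change of the index -/

/-- Below μ the embeddings do not depend on the index, by the cocycle conditions. The lemmas up to
`T₁_h_fc_S₀` deduce the same for T f(h²) S and T h f(h²) S whenever f vanishes from μ on; the maps S
are compatible with the transition maps only after such a cut-off. -/
theorem T₀_φ (hi : x ∈ F.U i) (hj : x ∈ F.U j) {v : (F.obj j).even.Fib x}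
    (hv : v ∈ (F.obj j).lowEven x Φ.μ) : Φ.T₀ i x ((F.φ i j).even x v) = Φ.T₀ j x v :=
  weightedCoord_congr fun _ hk => (Φ.cocycle _ i j x (mem_of_ne_zero hk) hi hj).1 v hv

theorem T₁_φ (hi : x ∈ F.U i) (hj : x ∈ F.U j) {v : (F.obj j).odd.Fib x}
    (hv : v ∈ (F.obj j).lowOdd x Φ.μ) : Φ.T₁ i x ((F.φ i j).odd x v) = Φ.T₁ j x v :=
  weightedCoord_congr fun _ hk => (Φ.cocycle _ i j x (mem_of_ne_zero hk) hi hj).2 v hv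

theorem φ_S₀ (hi : x ∈ F.U i) (hj : x ∈ F.U j) {f : ℝ → ℝ} (hf : ∀ r, Φ.μ ≤ r → f r = 0) (w) :
    (F.φ i j).even x (fc f ((F.obj j).sqEven x) (Φ.S₀ j x w)) =
      fc f ((F.obj i).sqEven x) (Φ.S₀ i x w) := by
  refine map_weightedSum (f := (F.φ i j).even x ∘ₗ fc f ((F.obj j).sqEven x))
    (f' := fc f ((F.obj i).sqEven x)) (fun k hk v => ?_) w
  have hxk := mem_of_ne_zero hk
  have := (F.obj (Φ.idx k)).finiteDimensional_even hxk
  change (F.φ i j).even x (fc f _ ((F.φ j (Φ.idx k)).even x v)) = _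
  rw [← (F.isHom j (Φ.idx k)).fc_even ⟨hj, hxk⟩ hxk hj,
    ← (F.isHom i (Φ.idx k)).fc_even ⟨hi, hxk⟩ hxk hi]
  exact (Φ.cocycle i j _ x hi hj hxk).1 _
    (((F.obj (Φ.idx k)).realDiag_sqEven hxk).fc_mem_lowPart hf v)

theorem φ_S₁ (hi : x ∈ F.U i) (hj : x ∈ F.U j) {f : ℝ → ℝ} (hf : ∀ r, Φ.μ ≤ r → f r = 0) (w) :
    (F.φ i j).odd x (fc f ((F.obj j).sqOdd x) (Φ.S₁ j x w)) =
      fc f ((F.obj i).sqOdd x) (Φ.S₁ i x w) := by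
  refine map_weightedSum (f := (F.φ i j).odd x ∘ₗ fc f ((F.obj j).sqOdd x))
    (f' := fc f ((F.obj i).sqOdd x)) (fun k hk v => ?_) w
  have hxk := mem_of_ne_zero hk
  have := (F.obj (Φ.idx k)).finiteDimensional_odd hxk
  change (F.φ i j).odd x (fc f _ ((F.φ j (Φ.idx k)).odd x v)) = _
  rw [← (F.isHom j (Φ.idx k)).fc_odd ⟨hj, hxk⟩ hxk hj,
    ← (F.isHom i (Φ.idx k)).fc_odd ⟨hi, hxk⟩ hxk hi]
  exact (Φ.cocycle i j _ x hi hj hxk).2 _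
    (((F.obj (Φ.idx k)).realDiag_sqOdd hxk).fc_mem_lowPart hf v)

theorem T₀_fc_S₀ (hi : x ∈ F.U i) (hj : x ∈ F.U j) {f : ℝ → ℝ} (hf : ∀ r, Φ.μ ≤ r → f r = 0) (w) :
    Φ.T₀ i x (fc f ((F.obj i).sqEven x) (Φ.S₀ i x w)) =
      Φ.T₀ j x (fc f ((F.obj j).sqEven x) (Φ.S₀ j x w)) := by
  have := (F.obj j).finiteDimensional_even hj
  rw [← φ_S₀ hi hj hf, T₀_φ hi hj (((F.obj j).realDiag_sqEven hj).fc_mem_lowPart hf _)]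

theorem T₁_fc_S₁ (hi : x ∈ F.U i) (hj : x ∈ F.U j) {f : ℝ → ℝ} (hf : ∀ r, Φ.μ ≤ r → f r = 0) (w) :
    Φ.T₁ i x (fc f ((F.obj i).sqOdd x) (Φ.S₁ i x w)) =
      Φ.T₁ j x (fc f ((F.obj j).sqOdd x) (Φ.S₁ j x w)) := by
  have := (F.obj j).finiteDimensional_odd hj
  rw [← φ_S₁ hi hj hf, T₁_φ hi hj (((F.obj j).realDiag_sqOdd hj).fc_mem_lowPart hf _)]

theorem T₀_h_fc_S₁ (hi : x ∈ F.U i) (hj : x ∈ F.U j) {f : ℝ → ℝ} (hf : ∀ r, Φ.μ ≤ r → f r = 0)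
    (w) : Φ.T₀ i x ((F.obj i).h₀₁ x (fc f ((F.obj i).sqOdd x) (Φ.S₁ i x w))) =
      Φ.T₀ j x ((F.obj j).h₀₁ x (fc f ((F.obj j).sqOdd x) (Φ.S₁ j x w))) := by
  have := (F.obj j).finiteDimensional_even hj
  rw [← φ_S₁ hi hj hf, ← (F.isHom i j).comm₀₁ x ⟨hi, hj⟩, (F.obj j).h₀₁_fc hj,
    T₀_φ hi hj (((F.obj j).realDiag_sqEven hj).fc_mem_lowPart hf _)]

theorem T₁_h_fc_S₀ (hi : x ∈ F.U i) (hj : x ∈ F.U j) {f : ℝ → ℝ} (hf : ∀ r, Φ.μ ≤ r → f r = 0)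
    (w) : Φ.T₁ i x ((F.obj i).h₁₀ x (fc f ((F.obj i).sqEven x) (Φ.S₀ i x w))) =
      Φ.T₁ j x ((F.obj j).h₁₀ x (fc f ((F.obj j).sqEven x) (Φ.S₀ j x w))) := by
  have := (F.obj j).finiteDimensional_odd hj
  rw [← φ_S₀ hi hj hf, ← (F.isHom i j).comm₁₀ x ⟨hi, hj⟩, (F.obj j).h₁₀_fc hj,
    T₁_φ hi hj (((F.obj j).realDiag_sqOdd hj).fc_mem_lowPart hf _)]

variable (Φ)

/-- The graph projection in terms of the object with index `j`. -/
noncomputable def localProj (j : F.Idx) (x : X) : Φ.W₀ × Φ.W₁ →ₗ[ℂ] Φ.W₀ × Φ.W₁ :=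
  Graph.proj Φ.μ ((F.obj j).h₁₀ x) ((F.obj j).h₀₁ x) (Φ.T₀ j x) (Φ.T₁ j x) (Φ.S₀ j x) (Φ.S₁ j x)

/-- The smoothed projection to the even low-energy part. -/
noncomputable def localQ₀ (j : F.Idx) (x : X) : Φ.W₀ →ₗ[ℂ] Φ.W₀ :=
  Φ.T₀ j x ∘ₗ fc (Graph.wide Φ.μ) ((F.obj j).sqEven x) ∘ₗ Φ.S₀ j x

/-- The smoothed projection to the odd low-energy part. -/
noncomputable def localQ₁ (j : F.Idx) (x : X) : Φ.W₁ →ₗ[ℂ] Φ.W₁ :=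
  Φ.T₁ j x ∘ₗ fc (Graph.wide Φ.μ) ((F.obj j).sqOdd x) ∘ₗ Φ.S₁ j x

/-- The graph projection. -/
noncomputable def proj (x : X) : (Φ.W₀ × Φ.W₁) →L[ℂ] (Φ.W₀ × Φ.W₁) :=
  (Φ.localProj (F.indexAt x) x).toContinuousLinearMap

/-- The smoothed projection to the even low-energy part. -/
noncomputable def Q₀ (x : X) : Φ.W₀ →ₗ[ℂ] Φ.W₀ := Φ.localQ₀ (F.indexAt x) x

/-- The smoothed projection to the odd low-energy part. -/
noncomputable def Q₁ (x : X) : Φ.W₁ →ₗ[ℂ] Φ.W₁ := Φ.localQ₁ (F.indexAt x) x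

variable {Φ}

theorem wide_low (r : ℝ) (hr : Φ.μ ≤ r) : Graph.wide Φ.μ r = 0 := Graph.wide_zero Φ.pos hr

theorem Q₀_eq (hj : x ∈ F.U j) (w) : Φ.Q₀ x w = Φ.localQ₀ j x w :=
  T₀_fc_S₀ (F.mem_indexAt x) hj wide_low w

theorem Q₁_eq (hj : x ∈ F.U j) (w) : Φ.Q₁ x w = Φ.localQ₁ j x w :=
  T₁_fc_S₁ (F.mem_indexAt x) hj wide_low w

theorem localProj_congr (hi : x ∈ F.U i) (hj : x ∈ F.U j) (k) :
    Φ.localProj i x k = Φ.localProj j x k := by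
  have h := isModel (Φ := Φ) hi
  rw [localProj, localProj, Graph.proj_apply, Graph.proj_apply, map_add, map_add, map_sub, map_sub,
    T₀_fc_S₀ hi hj h.cut_low, T₀_h_fc_S₁ hi hj h.off_low, T₁_fc_S₁ hi hj h.cut_low,
    T₁_h_fc_S₀ hi hj h.off_low]

theorem proj_eq (hj : x ∈ F.U j) (k) : Φ.proj x k = Φ.localProj j x k :=
  localProj_congr (F.mem_indexAt x) hj k

theorem proj_mul (x : X) : Φ.proj x * Φ.proj x = Φ.proj x :=
  ContinuousLinearMap.ext fun k => (isModel (F.mem_indexAt x)).proj_proj k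

/-! ### Continuity -/

variable (Φ)

theorem contMap_T₀ (j : F.Idx) :
    (F.obj j).even.ContMap (CBundle.triv X Φ.W₀) (F.U j) (Φ.T₀ j) :=
  contMap_weightedCoord (E := fun k => (F.obj (Φ.idx k)).even) (fun _ => F.isOpen _) Φ.cont_r
    Φ.supp_r Φ.cont_e₀ fun k => (F.isHom (Φ.idx k) j).cont_even

theorem contMap_T₁ (j : F.Idx) :
    (F.obj j).odd.ContMap (CBundle.triv X Φ.W₁) (F.U j) (Φ.T₁ j) :=
  contMap_weightedCoord (E := fun k => (F.obj (Φ.idx k)).odd) (fun _ => F.isOpen _) Φ.cont_r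
    Φ.supp_r Φ.cont_e₁ fun k => (F.isHom (Φ.idx k) j).cont_odd

theorem contMap_S₀ (j : F.Idx) :
    (CBundle.triv X Φ.W₀).ContMap (F.obj j).even.toCBundle (F.U j) (Φ.S₀ j) :=
  contMap_weightedSum (E := fun k => (F.obj (Φ.idx k)).even) (fun _ => F.isOpen _) Φ.cont_r
    Φ.supp_r Φ.cont_e₀ fun k => by
      rw [inter_comm]
      exact (F.isHom j (Φ.idx k)).cont_even

theorem contMap_S₁ (j : F.Idx) :
    (CBundle.triv X Φ.W₁).ContMap (F.obj j).odd.toCBundle (F.U j) (Φ.S₁ j) :=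
  contMap_weightedSum (E := fun k => (F.obj (Φ.idx k)).odd) (fun _ => F.isOpen _) Φ.cont_r
    Φ.supp_r Φ.cont_e₁ fun k => by
      rw [inter_comm]
      exact (F.isHom j (Φ.idx k)).cont_odd

theorem contMap_T₀_fc_S₀ (j : F.Idx) {f : ℝ → ℝ} (hf : Continuous f) :
    (CBundle.triv X Φ.W₀).ContMap (CBundle.triv X Φ.W₀) (F.U j)
      fun x => Φ.T₀ j x ∘ₗ fc f ((F.obj j).sqEven x) ∘ₗ Φ.S₀ j x :=
  (Φ.contMap_T₀ j).comp (((F.obj j).contMap_fc_sqEven hf).comp (Φ.contMap_S₀ j) subset_rfl)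
    subset_rfl

theorem contMap_T₁_fc_S₁ (j : F.Idx) {f : ℝ → ℝ} (hf : Continuous f) :
    (CBundle.triv X Φ.W₁).ContMap (CBundle.triv X Φ.W₁) (F.U j)
      fun x => Φ.T₁ j x ∘ₗ fc f ((F.obj j).sqOdd x) ∘ₗ Φ.S₁ j x :=
  (Φ.contMap_T₁ j).comp (((F.obj j).contMap_fc_sqOdd hf).comp (Φ.contMap_S₁ j) subset_rfl)
    subset_rfl

theorem contMap_T₀_h_fc_S₁ (j : F.Idx) {f : ℝ → ℝ} (hf : Continuous f) :
    (CBundle.triv X Φ.W₁).ContMap (CBundle.triv X Φ.W₀) (F.U j)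
      fun x => Φ.T₀ j x ∘ₗ (F.obj j).h₀₁ x ∘ₗ fc f ((F.obj j).sqOdd x) ∘ₗ Φ.S₁ j x :=
  (Φ.contMap_T₀ j).comp ((F.obj j).cont₀₁.comp
    (((F.obj j).contMap_fc_sqOdd hf).comp (Φ.contMap_S₁ j) subset_rfl) subset_rfl) subset_rfl

theorem contMap_T₁_h_fc_S₀ (j : F.Idx) {f : ℝ → ℝ} (hf : Continuous f) :
    (CBundle.triv X Φ.W₀).ContMap (CBundle.triv X Φ.W₁) (F.U j)
      fun x => Φ.T₁ j x ∘ₗ (F.obj j).h₁₀ x ∘ₗ fc f ((F.obj j).sqEven x) ∘ₗ Φ.S₀ j x :=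
  (Φ.contMap_T₁ j).comp ((F.obj j).cont₁₀.comp
    (((F.obj j).contMap_fc_sqEven hf).comp (Φ.contMap_S₀ j) subset_rfl) subset_rfl) subset_rfl

/-- The choice of `indexAt x` is not continuous in x. Independence of the index reduces continuity
to a fixed index over each open set of the cover. -/
theorem _root_.CBundle.ContMap.of_index {V W : Set X} {E : CBundle V} {G : CBundle W}
    {f : ∀ x, E.Fib x →ₗ[ℂ] G.Fib x} (g : F.Idx → ∀ x, E.Fib x →ₗ[ℂ] G.Fib x)
    (h : ∀ j, E.ContMap G (F.U j) (g j)) (hfg : ∀ j, ∀ x ∈ F.U j, ∀ v, f x v = g j x v) :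
    E.ContMap G univ f := by
  refine CBundle.ContMap.of_local fun x _ => ?_
  obtain ⟨j, hj⟩ := F.cover x
  refine ⟨F.U j, (F.isOpen j).mem_nhds hj, ?_⟩
  rw [inter_univ]
  exact (h j).congr (hfg j)

theorem contMap_Q₀ : (CBundle.triv X Φ.W₀).ContMap (CBundle.triv X Φ.W₀) univ Φ.Q₀ :=
  CBundle.ContMap.of_index (F := F) Φ.localQ₀
    (fun j => Φ.contMap_T₀_fc_S₀ j (Graph.continuous_wide _)) fun _ _ hx => Q₀_eq hx

theorem contMap_Q₁ : (CBundle.triv X Φ.W₁).ContMap (CBundle.triv X Φ.W₁) univ Φ.Q₁ :=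
  CBundle.ContMap.of_index (F := F) Φ.localQ₁
    (fun j => Φ.contMap_T₁_fc_S₁ j (Graph.continuous_wide _)) fun _ _ hx => Q₁_eq hx

theorem continuous_proj : Continuous Φ.proj := by
  rw [← continuousOn_univ]
  refine CBundle.contMap_triv.1 (CBundle.ContMap.of_index (F := F) Φ.localProj (fun j => ?_)
    fun _ _ hx => proj_eq hx)
  refine CBundle.contMap_triv_left.2 fun k => CBundle.contSec_triv.2 ?_
  have c1 := CBundle.contSec_triv.1 (CBundle.contMap_triv_left.1
    (Φ.contMap_T₀_fc_S₀ j (Graph.continuous_cut Φ.μ)) k.1)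
  have c2 := CBundle.contSec_triv.1 (CBundle.contMap_triv_left.1
    (Φ.contMap_T₀_h_fc_S₁ j (Graph.continuous_off Φ.μ)) k.2)
  have c3 := CBundle.contSec_triv.1 (CBundle.contMap_triv_left.1
    (Φ.contMap_T₁_h_fc_S₀ j (Graph.continuous_off Φ.μ)) k.1)
  have c4 := CBundle.contSec_triv.1 (CBundle.contMap_triv_left.1
    (Φ.contMap_T₁_fc_S₁ j (Graph.continuous_cut Φ.μ)) k.2)
  refine ((c1.add c2).prodMk ((continuousOn_const (c := k.2)).add (c3.sub c4))).congr fun x _ => ?_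
  rw [localProj, Graph.proj_apply, map_add, map_sub]
  rfl

end VectorialBundle.Framing

/-! ### Every vectorial bundle is represented by a global object -/

theorem Graph.continuousOn_splitMetric {X : Type u} [TopologicalSpace X] {H : Type}
    [NormedAddCommGroup H] [InnerProductSpace ℂ H] [FiniteDimensional ℂ H] {Q : X → H →ₗ[ℂ] H}
    (hQ : (CBundle.triv X H).ContMap (CBundle.triv X H) univ Q) {W : Set X} {s t : X → H}
    (hs : ContinuousOn s W) (ht : ContinuousOn t W) :
    ContinuousOn (fun x => (Graph.splitMetric (Q x)).inner (s x) (t x)) W := by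
  have key : ∀ {s : X → H}, ContinuousOn s W → ContinuousOn (fun x => Q x (s x)) W := fun hs =>
    CBundle.contSec_triv.1 (hQ.contSec' (subset_univ _) (subset_univ _) (CBundle.contSec_triv.2 hs))
  exact ((key hs).inner (key ht)).add ((hs.sub (key hs)).inner (ht.sub (key ht)))

namespace VectorialBundle.Framing

variable {X : Type u} [TopologicalSpace X] {F : VectorialBundle X} (Φ : F.Framing)

/-- The inner products for which the graph projections are self-adjoint. -/
@[reducible]
noncomputable def metric (x : X) : InnerProductSpace.Core ℂ (Φ.W₀ × Φ.W₁) :=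
  sumMetric (Graph.splitMetric (Φ.Q₀ x)) (Graph.splitMetric (Φ.Q₁ x))

theorem metric_proj (x : X) (k k' : Φ.W₀ × Φ.W₁) :
    (Φ.metric x).inner (Φ.proj x k) k' = (Φ.metric x).inner k (Φ.proj x k') :=
  (isModel (F.mem_indexAt x)).proj_symm k k'

/-- The bundle of ranges of the graph projections. -/
noncomputable abbrev rangeBundle : CBundle (univ : Set X) :=
  CBundle.ofProj Φ.proj Φ.continuous_proj proj_mul

/-- The inclusion of the range. -/
noncomputable abbrev incl (x : X) : Φ.rangeBundle.Fib x →ₗ[ℂ] Φ.W₀ × Φ.W₁ :=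
  CBundle.ofProjIncl Φ.proj Φ.continuous_proj proj_mul x

theorem incl_injective (x : X) : Function.Injective (Φ.incl x) :=
  CBundle.ofProjIncl_injective x

theorem proj_incl (x : X) (k : Φ.rangeBundle.Fib x) : Φ.proj x (Φ.incl x k) = Φ.incl x k :=
  CBundle.proj_ofProjIncl x k

/-- The projection to the range. -/
noncomputable abbrev toRange (x : X) : Φ.W₀ × Φ.W₁ →ₗ[ℂ] Φ.rangeBundle.Fib x :=
  CBundle.ofProjMap Φ.proj Φ.continuous_proj proj_mul x

theorem contMap_incl :
    Φ.rangeBundle.ContMap (CBundle.triv X (Φ.W₀ × Φ.W₁)) univ Φ.incl :=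
  CBundle.contMap_ofProjIncl

theorem contMap_toRange :
    (CBundle.triv X (Φ.W₀ × Φ.W₁)).ContMap Φ.rangeBundle univ Φ.toRange :=
  CBundle.contMap_ofProjMap

theorem contMap_fst : (CBundle.triv X (Φ.W₀ × Φ.W₁)).ContMap (CBundle.triv X Φ.W₀) univ
    fun _ => LinearMap.fst ℂ Φ.W₀ Φ.W₁ :=
  CBundle.contMap_triv_left.2 fun _ => CBundle.contSec_triv.2 continuousOn_const

theorem contMap_snd : (CBundle.triv X (Φ.W₀ × Φ.W₁)).ContMap (CBundle.triv X Φ.W₁) univ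
    fun _ => LinearMap.snd ℂ Φ.W₀ Φ.W₁ :=
  CBundle.contMap_triv_left.2 fun _ => CBundle.contSec_triv.2 continuousOn_const

theorem contMap_inr : (CBundle.triv X Φ.W₁).ContMap (CBundle.triv X (Φ.W₀ × Φ.W₁)) univ
    fun _ => LinearMap.inr ℂ Φ.W₀ Φ.W₁ :=
  CBundle.contMap_triv_left.2 fun _ => CBundle.contSec_triv.2 continuousOn_const

/-- The even part of the global object. -/
noncomputable def globalEven : HBundle (univ : Set X) :=
  HBundle.ofMetric Φ.rangeBundle
    (fun x => (Φ.metric x).comap (Φ.incl x) (Φ.incl_injective x))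
    fun W s t hs ht => by
      have key : ∀ {s}, Φ.rangeBundle.ContSec s W →
          ContinuousOn (fun x => Φ.incl x (s x)) W := fun hs =>
        CBundle.contSec_triv.1 (Φ.contMap_incl.contSec' (subset_univ _) (subset_univ _) hs)
      exact (Graph.continuousOn_splitMetric Φ.contMap_Q₀ (key hs).fst (key ht).fst).add
        (Graph.continuousOn_splitMetric Φ.contMap_Q₁ (key hs).snd (key ht).snd)

/-- The odd part of the global object. -/
noncomputable def globalOdd : HBundle (univ : Set X) :=
  HBundle.ofMetric (CBundle.triv X Φ.W₁) (fun x => Graph.splitMetric (Φ.Q₁ x))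
    fun _ _ _ hs ht => Graph.continuousOn_splitMetric Φ.contMap_Q₁
      (CBundle.contSec_triv.1 hs) (CBundle.contSec_triv.1 ht)

/-- The Hermitian condition is the self-adjointness of the projection P: for k in its range, ⟨k₂, w⟩
= ⟨k, (0, w)⟩ = ⟨P k, (0, w)⟩ = ⟨k, P (0, w)⟩. -/
theorem metric_incl (x : X) (v : Φ.rangeBundle.Fib x) (w : Φ.W₁) :
    (Graph.splitMetric (Φ.Q₁ x)).inner (((Graph.sc Φ.μ)⁻¹ : ℂ) • (Φ.incl x v).2) w =
      (Φ.metric x).inner (Φ.incl x v) (((Graph.sc Φ.μ)⁻¹ : ℂ) • Φ.proj x (0, w)) := by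
  have e := Φ.metric_proj x (Φ.incl x v) (0, w)
  rw [Φ.proj_incl] at e
  have e1 : (Φ.metric x).inner (Φ.incl x v) (0, w) =
      (Graph.splitMetric (Φ.Q₁ x)).inner (Φ.incl x v).2 w := by
    change _ + _ = _
    rw [InnerProductSpace.Core.inner_zero_right', zero_add]
  have hc : (starRingEnd ℂ) ((Graph.sc Φ.μ)⁻¹ : ℂ) = ((Graph.sc Φ.μ)⁻¹ : ℂ) := by
    rw [map_inv₀, Complex.conj_ofReal]
  rw [(Graph.splitMetric (Φ.Q₁ x)).smul_left, InnerProductSpace.Core.inner_smul_right', hc, ← e, e1]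

/-- The global object whose vectorial bundle is isomorphic to the given one. -/
noncomputable def globalObj : HFObj (univ : Set X) where
  even := Φ.globalEven
  odd := Φ.globalOdd
  h₁₀ x := ((Graph.sc Φ.μ)⁻¹ : ℂ) • (LinearMap.snd ℂ Φ.W₀ Φ.W₁ ∘ₗ Φ.incl x)
  h₀₁ x := ((Graph.sc Φ.μ)⁻¹ : ℂ) • (Φ.toRange x ∘ₗ LinearMap.inr ℂ Φ.W₀ Φ.W₁)
  cont₁₀ := (Φ.contMap_snd.comp Φ.contMap_incl (subset_univ _)).smul continuousOn_const
  cont₀₁ := (Φ.contMap_toRange.comp Φ.contMap_inr (subset_univ _)).smul continuousOn_const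
  hermitian x _ v w := Φ.metric_incl x v w

-- The eigenvalue equation of the global object multiplied by sc², the form in which
-- `Graph.IsModel.toRange_ofRange` takes it.
variable {Φ} in
theorem proj_of_sqEven {x : X} {r : ℝ} (k : Φ.rangeBundle.Fib x)
    (hk : Φ.globalObj.sqEven x k = (r : ℂ) • k) : Φ.proj x (0, (Φ.incl x k).2) =
      ((Graph.sc Φ.μ * Graph.sc Φ.μ * r : ℝ) : ℂ) • Φ.incl x k := by
  have hc : (Graph.sc Φ.μ : ℂ) ≠ 0 := by exact_mod_cast (Graph.sc_pos Φ.pos).ne'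
  have e : ((Graph.sc Φ.μ)⁻¹ : ℂ) • Φ.proj x (0, ((Graph.sc Φ.μ)⁻¹ : ℂ) • (Φ.incl x k).2) =
    (r : ℂ) • Φ.incl x k := congrArg (Φ.incl x) hk
  have e2 : ((0 : Φ.W₀), ((Graph.sc Φ.μ)⁻¹ : ℂ) • (Φ.incl x k).2) =
      ((Graph.sc Φ.μ)⁻¹ : ℂ) • ((0 : Φ.W₀), (Φ.incl x k).2) := by simp
  rw [e2, map_smul, smul_smul, ← mul_inv, inv_smul_eq_iff₀ (mul_ne_zero hc hc), smul_smul] at e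
  push_cast
  exact e

variable {Φ} in
theorem proj_of_sqOdd {x : X} {j : F.Idx} (hj : x ∈ F.U j) {r : ℝ} (w : Φ.W₁)
    (hw : Φ.globalObj.sqOdd x w = (r : ℂ) • w) :
    w - Φ.T₁ j x (fc (Graph.cut Φ.μ) ((F.obj j).sqOdd x) (Φ.S₁ j x w)) =
      ((Graph.sc Φ.μ * Graph.sc Φ.μ * r : ℝ) : ℂ) • w := by
  have hc : (Graph.sc Φ.μ : ℂ) ≠ 0 := by exact_mod_cast (Graph.sc_pos Φ.pos).ne'
  have e : ((Graph.sc Φ.μ)⁻¹ : ℂ) • ((Graph.sc Φ.μ)⁻¹ : ℂ) • (Φ.proj x (0, w)).2 =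
    (r : ℂ) • w := hw
  rw [smul_smul, ← mul_inv, inv_smul_eq_iff₀ (mul_ne_zero hc hc), smul_smul, proj_eq hj, localProj,
    Graph.proj_apply] at e
  simp only [map_zero, zero_sub, map_neg] at e
  rw [← sub_eq_add_neg] at e
  push_cast
  exact e

/-! ### The isomorphism with the global object -/

/-- The homomorphisms to the global object. -/
noncomputable def toGlobal (j : F.Idx) : HFMap (F.obj j) Φ.globalObj where
  even x := Φ.toRange x ∘ₗ Graph.toRange Φ.μ ((F.obj j).h₁₀ x) ((F.obj j).h₀₁ x)
    (Φ.T₀ j x) (Φ.T₁ j x)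
  odd x := Φ.T₁ j x ∘ₗ fc (Graph.narrow Φ.μ) ((F.obj j).sqOdd x)

/-- The homomorphisms from the global object. -/
noncomputable def ofGlobal (j : F.Idx) : HFMap Φ.globalObj (F.obj j) where
  even x := Graph.ofRange Φ.μ ((F.obj j).h₁₀ x) ((F.obj j).h₀₁ x)
    (Φ.S₀ j x) (Φ.S₁ j x) ∘ₗ Φ.incl x
  odd x := fc (Graph.narrow Φ.μ) ((F.obj j).sqOdd x) ∘ₗ Φ.S₁ j x

variable {Φ} {i j : F.Idx} {x : X}

theorem incl_toGlobal (hj : x ∈ F.U j) (v) : Φ.incl x ((Φ.toGlobal j).even x v) =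
    Graph.toRange Φ.μ ((F.obj j).h₁₀ x) ((F.obj j).h₀₁ x) (Φ.T₀ j x) (Φ.T₁ j x) v := by
  have e := proj_eq (Φ := Φ) hj (Graph.toRange Φ.μ ((F.obj j).h₁₀ x) ((F.obj j).h₀₁ x)
    (Φ.T₀ j x) (Φ.T₁ j x) v)
  exact e.trans ((isModel hj).proj_toRange v)

theorem localProj_incl (hj : x ∈ F.U j) (k) : Φ.localProj j x (Φ.incl x k) = Φ.incl x k :=
  (proj_eq hj _).symm.trans (Φ.proj_incl x k)

theorem isHom_toGlobal (j : F.Idx) : (Φ.toGlobal j).IsHom (F.U j) where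
  cont_even := by
    refine (Φ.contMap_toRange.mono (subset_univ _)).comp ?_ (subset_univ _)
    refine CBundle.ContMap.of_contSec subset_rfl fun W' hW' s hs => CBundle.contSec_triv.2 ?_
    have c1 := ((Φ.contMap_T₀ j).comp (((F.obj j).contMap_fc_sqEven
      (Graph.continuous_rcut Φ.μ)).comp ((F.obj j).contMap_fc_sqEven
      (Graph.continuous_narrow Φ.μ)) subset_rfl) subset_rfl).contSec' hW' hW' hs
    have c2 := ((Φ.contMap_T₁ j).comp ((F.obj j).cont₁₀.comp ((F.obj j).contMap_fc_sqEven
      (Graph.continuous_narrow Φ.μ)) subset_rfl) subset_rfl).contSec' hW' hW' hs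
    exact (CBundle.contSec_triv.1 c1).prodMk
      (continuousOn_const.smul (CBundle.contSec_triv.1 c2))
  cont_odd := (Φ.contMap_T₁ j).comp ((F.obj j).contMap_fc_sqOdd (Graph.continuous_narrow Φ.μ))
    subset_rfl
  comm₁₀ x hx v := by
    have hc : (Graph.sc Φ.μ : ℂ) ≠ 0 := by exact_mod_cast (Graph.sc_pos Φ.pos).ne'
    change Φ.T₁ j x (fc _ _ _) = ((Graph.sc Φ.μ)⁻¹ : ℂ) • (Φ.incl x ((Φ.toGlobal j).even x v)).2
    rw [incl_toGlobal hx, Graph.toRange_apply, smul_smul, inv_mul_cancel₀ hc, one_smul,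
      (F.obj j).h₁₀_fc hx]
  comm₀₁ x hx v := by
    refine Φ.incl_injective x ?_
    rw [incl_toGlobal hx, (isModel hx).toRange_comm]
    change _ = ((Graph.sc Φ.μ)⁻¹ : ℂ) • Φ.proj x (0, _)
    rw [proj_eq hx]
    rfl

theorem isHom_ofGlobal (j : F.Idx) : (Φ.ofGlobal j).IsHom (F.U j) where
  cont_even := by
    have c1 := (((F.obj j).contMap_fc_sqEven (Graph.continuous_narrow Φ.μ)).comp
      (((F.obj j).contMap_fc_sqEven (Graph.continuous_rcut Φ.μ)).comp ((Φ.contMap_S₀ j).comp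
      (Φ.contMap_fst.mono (subset_univ (F.U j))) (subset_univ _)) subset_rfl) subset_rfl)
    have c2 := (((F.obj j).contMap_fc_sqEven (Graph.continuous_narrow Φ.μ)).comp
      (CBundle.ContMap.smul (c := fun _ => (Graph.sc Φ.μ : ℂ)) continuousOn_const
      ((F.obj j).cont₀₁.comp ((Φ.contMap_S₁ j).comp
      (Φ.contMap_snd.mono (subset_univ (F.U j))) (subset_univ _)) subset_rfl)) subset_rfl)
    refine ((c1.add c2).comp (Φ.contMap_incl.mono (subset_univ _)) (subset_univ _)).congr
      fun x _ v => ?_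
    exact map_add (fc (Graph.narrow Φ.μ) ((F.obj j).sqEven x)) _ _
  cont_odd := ((F.obj j).contMap_fc_sqOdd (Graph.continuous_narrow Φ.μ)).comp (Φ.contMap_S₁ j)
    subset_rfl
  comm₁₀ x hx v := by
    exact ((isModel hx).ofRange_comm (localProj_incl hx v)).symm
  comm₀₁ x hx v := by
    refine Eq.trans ?_ ((isModel hx).ofRange_comm' v).symm
    change Graph.ofRange _ _ _ _ _ (((Graph.sc Φ.μ)⁻¹ : ℂ) • Φ.proj x (0, v)) = _
    rw [proj_eq hx]
    rfl

theorem narrow_low (r : ℝ) (hr : Φ.μ ≤ r) : Graph.narrow Φ.μ r = 0 :=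
  Graph.narrow_zero Φ.pos (by linarith [Φ.pos])

/-- Equality holds for all vectors, not merely for low ones, because `toGlobal` contains a cut-off
that vanishes from μ on. -/
theorem toGlobal_φ (hi : x ∈ F.U i) (hj : x ∈ F.U j) :
    (∀ v, (Φ.toGlobal i).even x ((F.φ i j).even x v) = (Φ.toGlobal j).even x v) ∧
      ∀ v, (Φ.toGlobal i).odd x ((F.φ i j).odd x v) = (Φ.toGlobal j).odd x v := by
  have := (F.obj j).finiteDimensional_even hj
  have := (F.obj j).finiteDimensional_odd hj
  have hR := (F.obj j).realDiag_sqEven hj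
  have hR' := (F.obj j).realDiag_sqOdd hj
  have hhom := F.isHom i j
  refine ⟨fun v => Φ.incl_injective x ?_, fun v => ?_⟩
  · have hlow := hR.fc_mem_lowPart (narrow_low (Φ := Φ))
    rw [incl_toGlobal hi, incl_toGlobal hj, Graph.toRange_apply,
      Graph.toRange_apply]
    have e1 := hhom.fc_even ⟨hi, hj⟩ hj hi (Graph.narrow Φ.μ) v
    have e2 := hhom.fc_even ⟨hi, hj⟩ hj hi (Graph.rcut Φ.μ) (fc (Graph.narrow Φ.μ)
      ((F.obj j).sqEven x) v)
    rw [← e1, ← e2, T₀_φ hi hj (hR.fc_mem_lowPart (isModel hi).rcut_low _),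
      ← hhom.comm₁₀ x ⟨hi, hj⟩, (F.obj j).h₁₀_fc hj,
      T₁_φ hi hj (hR'.fc_mem_lowPart narrow_low _)]
  · change Φ.T₁ i x (fc _ _ _) = Φ.T₁ j x (fc _ _ _)
    rw [← hhom.fc_odd ⟨hi, hj⟩ hj hi, T₁_φ hi hj (hR'.fc_mem_lowPart narrow_low _)]

theorem φ_ofGlobal (hi : x ∈ F.U i) (hj : x ∈ F.U j) :
    (∀ v, (F.φ i j).even x ((Φ.ofGlobal j).even x v) = (Φ.ofGlobal i).even x v) ∧
      ∀ v, (F.φ i j).odd x ((Φ.ofGlobal j).odd x v) = (Φ.ofGlobal i).odd x v := by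
  have hhom := F.isHom i j
  refine ⟨fun v => ?_, fun v => φ_S₁ hi hj narrow_low _⟩
  change (F.φ i j).even x (Graph.ofRange _ _ _ _ _ (Φ.incl x v)) = Graph.ofRange _ _ _ _ _ _
  rw [Graph.ofRange_apply, Graph.ofRange_apply, map_add, map_add, map_add,
    map_smul, map_smul, map_smul, ← (F.obj j).h₀₁_fc hj, ← (F.obj i).h₀₁_fc hi,
    hhom.comm₀₁ x ⟨hi, hj⟩, φ_S₁ hi hj narrow_low, hhom.fc_even ⟨hi, hj⟩ hj hi,
    φ_S₀ hi hj (isModel hi).rcut_low]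
  rfl

theorem ofGlobal_toGlobal (hj : x ∈ F.U j) :
    ((Φ.ofGlobal j).comp (Φ.toGlobal j)).AgreeAt (HFMap.id _) (Φ.μ / 8) x := by
  refine ⟨fun v hv => ?_, fun v hv => ?_⟩
  · change Graph.ofRange _ _ _ _ _ (Φ.incl x ((Φ.toGlobal j).even x v)) = v
    rw [incl_toGlobal hj]
    exact (isModel hj).ofRange_toRange hv
  · change fc _ _ (Φ.S₁ j x (Φ.T₁ j x (fc _ _ v))) = v
    rw [(isModel hj).left_inv_fc₁ narrow_low, (isModel hj).narrow_low_part hv,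
      (isModel hj).narrow_low_part hv]

/-- The low part of the global object is spanned by its eigenvectors below μ / 8, and the components
of these correspond to eigenvectors of the local h². -/
theorem toGlobal_ofGlobal (hj : x ∈ F.U j) :
    ((Φ.toGlobal j).comp (Φ.ofGlobal j)).AgreeAt (HFMap.id _) (Φ.μ / 8) x := by
  refine ⟨fun v hv => ?_, fun v hv => ?_⟩
  · refine eqOn_lowPart (M := Φ.globalObj.sqEven x) (N := ((Φ.toGlobal j).comp (Φ.ofGlobal j)).even x)
      (N' := LinearMap.id) (fun r hr k hk => ?_) hv
    refine Φ.incl_injective x ?_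
    change Φ.incl x ((Φ.toGlobal j).even x _) = Φ.incl x k
    rw [incl_toGlobal hj]
    refine (isModel hj).toRange_ofRange hr (localProj_incl hj k) ?_
    exact (proj_eq hj _).symm.trans (proj_of_sqEven k hk)
  · refine eqOn_lowPart (M := Φ.globalObj.sqOdd x) (N := ((Φ.toGlobal j).comp (Φ.ofGlobal j)).odd x)
      (N' := LinearMap.id) (fun r hr w hw => ?_) hv
    obtain ⟨t1, t2⟩ := (isModel hj).snd_of_eigen hr (proj_of_sqOdd hj w hw)
    have hy := (isModel hj).eigen_of_cut hr t2
    have hl := (isModel hj).narrow_low_part (mem_lowPart_of_eigen hr hy)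
    change Φ.T₁ j x (fc _ _ (fc _ _ (Φ.S₁ j x w))) = w
    rw [hl, hl, t1]

theorem iso_globalObj : F.Iso Φ.globalObj.toVectorial := by
  refine ⟨fun _ j => Φ.toGlobal j, fun j _ => Φ.ofGlobal j, ⟨?_, ?_, ?_⟩, ⟨?_, ?_, ?_⟩, ?_, ?_⟩
  · exact fun _ j => (isHom_toGlobal j).mono inter_subset_right
  · exact fun _ i j => HFMap.Eqv.of_eq (fun x hx => (toGlobal_φ hx.1.2 hx.2).1)
      (fun x hx => (toGlobal_φ hx.1.2 hx.2).2)
  · exact fun _ _ j => HFMap.Eqv.of_eq (fun _ _ _ => rfl) (fun _ _ _ => rfl)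
  · exact fun j _ => (isHom_ofGlobal j).mono inter_subset_left
  · exact fun j _ _ => HFMap.Eqv.of_eq (fun _ _ _ => rfl) (fun _ _ _ => rfl)
  · exact fun i j _ => HFMap.Eqv.of_eq (fun x hx => (φ_ofGlobal hx.1.1 hx.1.2).1)
      (fun x hx => (φ_ofGlobal hx.1.1 hx.1.2).2)
  -- The transition map is moved through `toGlobal` first, so that the round trip takes place at a
  -- single index. It is exact below μ / 8 at every point, so the whole space serves as
  -- neighbourhood.
  · intro i _ j x hx
    refine ⟨Φ.μ / 8, by linarith [Φ.pos], univ, isOpen_univ, trivial, fun y hy => ?_⟩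
    have hi : y ∈ F.U i := hy.2.1.1
    have hj : y ∈ F.U j := hy.2.2
    refine ⟨fun v hv => ?_, fun v hv => ?_⟩
    · change (Φ.ofGlobal i).even y ((Φ.toGlobal j).even y v) = _
      rw [← (toGlobal_φ hi hj).1]
      exact (ofGlobal_toGlobal hi).1 _
        (map_mem_lowPart (φ := (F.φ i j).even y) ((F.isHom i j).sqEven ⟨hi, hj⟩) hv)
    · change (Φ.ofGlobal i).odd y ((Φ.toGlobal j).odd y v) = _
      rw [← (toGlobal_φ hi hj).2]
      exact (ofGlobal_toGlobal hi).2 _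
        (map_mem_lowPart (φ := (F.φ i j).odd y) ((F.isHom i j).sqOdd ⟨hi, hj⟩) hv)
  · intro _ j _ x hx
    exact ⟨Φ.μ / 8, by linarith [Φ.pos], univ, isOpen_univ, trivial, fun y hy =>
      toGlobal_ofGlobal hy.2.1.2⟩

end VectorialBundle.Framing

theorem VectorialBundle.exists_global {X : Type u} [TopologicalSpace X] [CompactSpace X]
    [T2Space X] (E : VectorialBundle X) :
    ∃ G : HFObj (univ : Set X), E.Iso G.toVectorial := by
  obtain ⟨F, hF, ⟨Φ⟩⟩ := E.exists_framing
  exact ⟨Φ.globalObj, hF.symm.trans Framing.iso_globalObj⟩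

/-! ### Direct sums and isomorphisms of vector bundles -/

namespace CBundle

variable {X : Type u} [TopologicalSpace X] {U V W : Set X}

theorem contMap_fst (E F : CBundle (univ : Set X)) :
    (E.gsum F).ContMap E W fun _ => LinearMap.fst ℂ _ _ := fun a b v =>
  (E.compat a.1 b v.1).mono fun _ hx => ⟨⟨hx.1.1.1, hx.1.2⟩, trivial⟩

theorem contMap_snd (E F : CBundle (univ : Set X)) :
    (E.gsum F).ContMap F W fun _ => LinearMap.snd ℂ _ _ := fun a b v =>
  (F.compat a.2 b v.2).mono fun _ hx => ⟨⟨hx.1.1.2, hx.1.2⟩, trivial⟩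

theorem contMap_inl (E F : CBundle (univ : Set X)) :
    E.ContMap (E.gsum F) W fun _ => LinearMap.inl ℂ _ _ := fun a b v => by
  refine ContinuousOn.congr (((E.compat a b.1 v).mono fun _ hx =>
    ⟨⟨hx.1.1, hx.1.2.1⟩, trivial⟩).prodMk (continuousOn_const (c := (0 : (F.chart b.2).Model))))
    fun x _ => Prod.ext rfl ?_
  exact map_zero ((F.chart b.2).coord x)

theorem contMap_inr (E F : CBundle (univ : Set X)) :
    F.ContMap (E.gsum F) W fun _ => LinearMap.inr ℂ _ _ := fun a b v => by
  refine ContinuousOn.congr ((continuousOn_const (c := (0 : (E.chart b.1).Model))).prodMk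
    ((F.compat a b.2 v).mono fun _ hx => ⟨⟨hx.1.1, hx.1.2.2⟩, trivial⟩))
    fun x _ => Prod.ext ?_ rfl
  exact map_zero ((E.chart b.1).coord x)

theorem ContMap.prodMk {E F G : CBundle (univ : Set X)} {f : ∀ x, E.Fib x →ₗ[ℂ] F.Fib x}
    {g : ∀ x, E.Fib x →ₗ[ℂ] G.Fib x} (hf : E.ContMap F W f) (hg : E.ContMap G W g) :
    E.ContMap (F.gsum G) W fun x => (f x).prod (g x) :=
  (((contMap_inl F G).comp hf (subset_univ _)).add
    ((contMap_inr F G).comp hg (subset_univ _))).congr fun _ _ _ =>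
      Prod.ext (add_zero _).symm (zero_add _).symm

/-- At a point outside one of the closed sets continuity within that set is vacuous. -/
theorem ContMap.union {E : CBundle U} {F : CBundle V} {f : ∀ x, E.Fib x →ₗ[ℂ] F.Fib x}
    {C D : Set X} (hC : IsClosed C) (hD : IsClosed D) (h : E.ContMap F C f)
    (k : E.ContMap F D f) : E.ContMap F (C ∪ D) f := by
  intro a b v x hx
  rw [inter_union_distrib_left]
  have key : ∀ {C : Set X}, IsClosed C → E.ContMap F C f → ContinuousWithinAt
      (fun x => (F.chart b).coord x (f x ((E.chart a).lift x v)))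
      ((E.chart a).dom ∩ (F.chart b).dom ∩ C) x := by
    intro C hC h
    by_cases hxC : x ∈ C
    · exact h a b v x ⟨hx.1, hxC⟩
    · exact continuousWithinAt_of_notMem_closure fun hcl =>
        hxC (hC.closure_subset (closure_mono inter_subset_right hcl))
  exact (key hC h).union (key hD k)

theorem IsoPair.of_bijective {E F : CBundle (univ : Set X)} {f : ∀ x, E.Fib x →ₗ[ℂ] F.Fib x}
    (hf : E.ContMap F univ f) (h : ∀ x, Function.Bijective (f x)) :
    E.IsoPair F f (E.fibInv F f) where
  cont_to := hf
  cont_inv := hf.fibInv fun x _ => h x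
  left_inv x v := fibInv_apply (h x) v
  right_inv x v := apply_fibInv (h x) v

theorem IsoPair.refl (E : CBundle (univ : Set X)) :
    E.IsoPair E (fun _ => LinearMap.id) fun _ => LinearMap.id where
  cont_to := E.contMap_id subset_rfl
  cont_inv := E.contMap_id subset_rfl
  left_inv _ _ := rfl
  right_inv _ _ := rfl

theorem IsoPair.bijective {E F : CBundle (univ : Set X)} {f : ∀ x, E.Fib x →ₗ[ℂ] F.Fib x}
    {g : ∀ x, F.Fib x →ₗ[ℂ] E.Fib x} (h : E.IsoPair F f g) (x : X) : Function.Bijective (f x) :=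
  ⟨Function.LeftInverse.injective (h.left_inv x), Function.RightInverse.surjective (h.right_inv x)⟩

theorem IsoPair.swap (E F : CBundle (univ : Set X)) : (E.gsum F).IsoPair (F.gsum E)
    (fun _ => (LinearMap.snd ℂ _ _).prod (LinearMap.fst ℂ _ _))
    (fun _ => (LinearMap.snd ℂ _ _).prod (LinearMap.fst ℂ _ _)) where
  cont_to := (contMap_snd E F).prodMk (contMap_fst E F)
  cont_inv := (contMap_snd F E).prodMk (contMap_fst F E)
  left_inv _ _ := rfl
  right_inv _ _ := rfl

/-! ### Homotopy invariance -/

/-- The identification of fibres over equal points. -/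
def fibCast (E : CBundle U) {x y : X} (h : x = y) : E.Fib x →ₗ[ℂ] E.Fib y :=
  h ▸ LinearMap.id

theorem fibCast_bijective (E : CBundle U) {x y : X} (h : x = y) :
    Function.Bijective (E.fibCast h) := by
  subst h
  exact Function.bijective_id

theorem coord_fibCast_lift (E : CBundle U) {x y : X} (h : x = y) (a b : E.Idx) (v) :
    (E.chart b).coord y (E.fibCast h ((E.chart a).lift x v)) =
      (E.chart b).coord y ((E.chart a).lift y v) := by
  subst h
  rfl

theorem fibCast_map {E : CBundle U} {F : CBundle V} (f : ∀ x, E.Fib x →ₗ[ℂ] F.Fib x) {x y : X}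
    (h : x = y) (v : E.Fib x) : f y (E.fibCast h v) = F.fibCast h (f x v) := by
  subst h
  rfl

open Classical in
/-- The identification of `E` with its pullback along a map `σ` at the fixed points of `σ`. -/
noncomputable def fixedCast (E : CBundle U) (σ : C(X, X)) (x : X) :
    E.Fib (σ x) →ₗ[ℂ] E.Fib x :=
  if h : σ x = x then E.fibCast h else 0

theorem fixedCast_apply (E : CBundle U) {σ : C(X, X)} {x : X} (h : σ x = x)
    (v : E.Fib (σ x)) : E.fixedCast σ x v = E.fibCast h v := by
  rw [fixedCast, dif_pos h]

theorem fixedCast_bijective (E : CBundle U) {σ : C(X, X)} {x : X} (h : σ x = x) :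
    Function.Bijective (E.fixedCast σ x) := by
  rw [fixedCast, dif_pos h]
  exact E.fibCast_bijective h

/-- At fixed points the pullback has the fibres and charts of E, so the matrix of the identification
is a transition function of E. -/
theorem contMap_fixedCast (E : CBundle (univ : Set X)) (σ : C(X, X)) :
    (E.comap σ).ContMap E {x | σ x = x} (E.fixedCast σ) := by
  intro a b v
  refine ContinuousOn.congr ((E.compat a b v).mono fun x hx => ⟨⟨?_, hx.1.2⟩, trivial⟩)
    fun x hx => ?_
  · have h1 : σ x ∈ (E.chart a).dom := hx.1.1
    have hσ : σ x = x := hx.2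
    rwa [hσ] at h1
  · have hσ : σ x = x := hx.2
    exact (congrArg _ (fixedCast_apply E hσ _)).trans (coord_fibCast_lift E hσ a b v)

end CBundle

/-! ### Rules of computation in K(X, Y) and constancy along homotopies. -/

namespace RelKGroup

variable {X : Type u} [TopologicalSpace X] {Y : Set X}

theorem mk_eq_of_iso {S T : KTriple Y} (h : S.Iso T) : mk S = mk T := by
  refine (QuotientAddGroup.eq_iff_sub_mem).2 (AddSubgroup.subset_closure ?_)
  exact Rel.iso S T h

theorem mk_sum (S T : KTriple Y) : mk (S.sum T) = mk S + mk T := by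
  refine (QuotientAddGroup.eq_iff_sub_mem).2 (AddSubgroup.subset_closure ?_)
  exact Rel.sum S T

theorem mk_elem (P : CBundle (univ : Set X)) : mk (KTriple.elem Y P) = 0 :=
  (QuotientAddGroup.eq_zero_iff _).2 (AddSubgroup.subset_closure (Rel.elem P))

theorem mk_congr {S T : KTriple Y} (f₀ : ∀ x, S.E₀.Fib x →ₗ[ℂ] T.E₀.Fib x)
    (f₁ : ∀ x, S.E₁.Fib x →ₗ[ℂ] T.E₁.Fib x) (h₀ : S.E₀.ContMap T.E₀ univ f₀)
    (h₁ : S.E₁.ContMap T.E₁ univ f₁) (b₀ : ∀ x, Function.Bijective (f₀ x))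
    (b₁ : ∀ x, Function.Bijective (f₁ x)) (h : ∀ x ∈ Y, ∀ v, f₁ x (S.α x v) = T.α x (f₀ x v)) :
    mk S = mk T :=
  mk_eq_of_iso ⟨f₀, _, f₁, _, .of_bijective h₀ b₀, .of_bijective h₁ b₁, h⟩

theorem mk_eq_zero (T : KTriple Y) {f : ∀ x, T.E₀.Fib x →ₗ[ℂ] T.E₁.Fib x}
    (hf : T.E₀.ContMap T.E₁ univ f) (hb : ∀ x, Function.Bijective (f x))
    (h : ∀ x ∈ Y, T.α x = f x) : mk T = 0 := by
  rw [← mk_elem T.E₁]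
  refine mk_congr (T := KTriple.elem Y T.E₁) f (fun _ => LinearMap.id) hf
    (T.E₁.contMap_id subset_rfl) hb (fun _ => Function.bijective_id) fun x hx v => ?_
  rw [h x hx]
  rfl

section Homotopy

variable {P₀ P₁ : CBundle (univ : Set (X × unitInterval))}
  {f : ∀ p, P₀.Fib p →ₗ[ℂ] P₁.Fib p}

/-- The restriction of a triple over `X × [0,1]` to a slice. -/
def slice (hf : P₀.ContMap P₁ (Y ×ˢ univ) f)
    (hb : ∀ p ∈ Y ×ˢ (univ : Set unitInterval), Function.Bijective (f p)) (t : unitInterval) :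
    KTriple Y where
  E₀ := P₀.comap (sliceMap X t)
  E₁ := P₁.comap (sliceMap X t)
  α x := f (x, t)
  cont := (hf.comap (sliceMap X t)).mono fun _ hx => ⟨hx, trivial⟩
  bij x hx := hb (x, t) ⟨hx, trivial⟩

/-- The projection of `X × [0,1]` to the slice at `t`. -/
def toSlice (X : Type u) [TopologicalSpace X] (t : unitInterval) :
    C(X × unitInterval, X × unitInterval) := ⟨fun p => (p.1, t), by fun_prop⟩

/-- Bijectivity is an open condition, and X is compact: the tube lemma. -/
theorem eventually_forall_bijective [CompactSpace X] {Q P : CBundle (univ : Set (X × unitInterval))}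
    {g : ∀ p, Q.Fib p →ₗ[ℂ] P.Fib p} (hg : Q.ContMap P univ g) {t : unitInterval}
    (hb : ∀ x, Function.Bijective (g (x, t))) :
    ∀ᶠ s in 𝓝 t, ∀ x, Function.Bijective (g (x, s)) := by
  have := (isCompact_univ (X := X)).eventually_forall_of_forall_eventually (x₀ := t)
    (P := fun s (x : X) => Function.Bijective (g (x, s))) fun x _ => by
      have h := hg.eventually_bijective subset_rfl subset_rfl (mem_univ (x, t)) (hb x)
      rw [nhdsWithin_univ] at h
      exact (continuous_swap.tendsto (t, x)).eventually h
  exact this.mono fun s hs x => hs x trivial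

/-- The map σ retracts X × [0,1] to the slice at t. Extending the identity of that slice gives maps
σ*Pᵢ → Pᵢ which are bijective over all nearby slices. For compatibility with f over Y, the map for
P₁ is prescribed as f g₀ f⁻¹ on Y × J before it is extended. -/
theorem eventually_mk_slice [CompactSpace X] [T2Space X] (hY : IsClosed Y)
    (hf : P₀.ContMap P₁ (Y ×ˢ univ) f)
    (hb : ∀ p ∈ Y ×ˢ (univ : Set unitInterval), Function.Bijective (f p)) (t : unitInterval) :
    ∀ᶠ s in 𝓝 t, mk (slice hf hb s) = mk (slice hf hb t) := by
  classical
  set σ := toSlice X t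
  have hσ : ∀ x, σ (x, t) = (x, t) := fun _ => rfl
  set C : Set (X × unitInterval) := {p | σ p = p}
  have hC : IsClosed C := isClosed_eq σ.continuous continuous_id
  obtain ⟨g₀, hg₀, hgC₀⟩ := CBundle.ContMap.exists_extension (E := P₀.comap σ) hC
    (P₀.contMap_fixedCast σ)
  have hb₀ := eventually_forall_bijective hg₀ (t := t) fun x => by
    rw [hgC₀ (x, t) (hσ x)]
    exact P₀.fixedCast_bijective (hσ x)
  -- A closed neighbourhood J makes Y × J closed, as the second extension requires.
  obtain ⟨J, hJ, hJc, hJb⟩ := exists_mem_nhds_isClosed_subset hb₀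
  set D : Set (X × unitInterval) := Y ×ˢ J
  have hD : IsClosed D := hY.prod hJc
  set k : ∀ p, P₁.Fib (σ p) →ₗ[ℂ] P₁.Fib p := fun p =>
    f p ∘ₗ g₀ p ∘ₗ P₀.fibInv P₁ f (σ p)
  have hinv := hf.fibInv hb
  have hk : (P₁.comap σ).ContMap P₁ D k := by
    refine (hf.mono fun p hp => ⟨hp.1, trivial⟩).comp ((hg₀.mono (subset_univ _)).comp
      ((hinv.comap σ).mono fun p hp => ⟨hp.1, trivial⟩) (subset_univ _)) (subset_univ _)
  obtain ⟨l, hlD, hlD'⟩ : ∃ l : ∀ p, P₁.Fib (σ p) →ₗ[ℂ] P₁.Fib p,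
      (∀ p ∈ D, l p = k p) ∧ ∀ p ∉ D, l p = P₁.fixedCast σ p :=
    ⟨fun p => if p ∈ D then k p else P₁.fixedCast σ p, fun _ hp => if_pos hp,
      fun _ hp => if_neg hp⟩
  -- The two prescriptions agree where the slice meets D, since g₀ is the identification of fibres
  -- there and f commutes with it.
  have hlC : ∀ p ∈ C, l p = P₁.fixedCast σ p := by
    intro p hp
    by_cases hpD : p ∈ D
    · have hg : ∀ v, g₀ p v = P₀.fixedCast σ p v := fun v => DFunLike.congr_fun (hgC₀ p hp) v
      have hσp : σ p = p := hp
      refine LinearMap.ext fun v => ?_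
      rw [hlD p hpD]
      refine (congrArg (f p) ((hg _).trans (P₀.fixedCast_apply hσp _))).trans
        ((CBundle.fibCast_map f hσp _).trans ?_)
      exact (congrArg _ (CBundle.apply_fibInv (hb (σ p) ⟨hpD.1, trivial⟩) v)).trans
        (P₁.fixedCast_apply hσp v).symm
    · exact hlD' p hpD
  have hl : (P₁.comap σ).ContMap P₁ (C ∪ D) l := by
    refine CBundle.ContMap.union hC hD ?_ ?_
    · exact (P₁.contMap_fixedCast σ).congr fun p hp v => DFunLike.congr_fun (hlC p hp) v
    · exact hk.congr fun p hp v => DFunLike.congr_fun (hlD p hp) v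
  obtain ⟨g₁, hg₁, hgC₁⟩ := CBundle.ContMap.exists_extension (E := P₁.comap σ) (hC.union hD) hl
  have hb₁ := eventually_forall_bijective hg₁ (t := t) fun x => by
    rw [hgC₁ (x, t) (Or.inl (hσ x)), hlC _ (hσ x)]
    exact P₁.fixedCast_bijective (hσ x)
  filter_upwards [hJ, hb₁] with s hs hs₁
  refine (mk_congr (S := slice hf hb t) (T := slice hf hb s) (fun x => g₀ (x, s))
    (fun x => g₁ (x, s)) (hg₀.comap (sliceMap X s)) (hg₁.comap (sliceMap X s)) (hJb hs) hs₁
    fun x hx v => ?_).symm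
  change g₁ (x, s) (f (x, t) v) = f (x, s) (g₀ (x, s) v)
  have e1 : ∀ w, g₁ (x, s) w = k (x, s) w := fun w =>
    (DFunLike.congr_fun (hgC₁ (x, s) (Or.inr ⟨hx, hs⟩)) w).trans
      (DFunLike.congr_fun (hlD (x, s) ⟨hx, hs⟩) w)
  refine (e1 _).trans ?_
  exact congrArg (fun w => f (x, s) (g₀ (x, s) w))
    (CBundle.fibInv_apply (hb (x, t) ⟨hx, trivial⟩) v)

theorem mk_slice_eq [CompactSpace X] [T2Space X] (hY : IsClosed Y)
    (hf : P₀.ContMap P₁ (Y ×ˢ univ) f)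
    (hb : ∀ p ∈ Y ×ˢ (univ : Set unitInterval), Function.Bijective (f p)) (s t : unitInterval) :
    mk (slice hf hb s) = mk (slice hf hb t) := by
  have h : IsLocallyConstant fun s => mk (slice hf hb s) :=
    (IsLocallyConstant.iff_eventually_eq _).2 (eventually_mk_slice hY hf hb)
  exact h.apply_eq_of_preconnectedSpace s t

end Homotopy

/-- The projection `X × [0,1] → X`. -/
def _root_.fstMap (X : Type u) [TopologicalSpace X] : C(X × unitInterval, X) :=
  ⟨Prod.fst, continuous_fst⟩

theorem _root_.CBundle.contMap_path {E₀ E₁ : CBundle (univ : Set X)}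
    {a b : ∀ x, E₀.Fib x →ₗ[ℂ] E₁.Fib x} {W : Set X}
    (ha : E₀.ContMap E₁ W a) (hb : E₀.ContMap E₁ W b) :
    (E₀.comap (fstMap X)).ContMap (E₁.comap (fstMap X)) (fstMap X ⁻¹' W)
      fun p => a p.1 + ((p.2 : ℝ) : ℂ) • b p.1 :=
  (ha.comap (fstMap X)).add ((hb.comap (fstMap X)).smul
    (c := fun p : X × unitInterval => ((p.2 : ℝ) : ℂ)) (by fun_prop))

theorem mk_eq_of_path [CompactSpace X] [T2Space X] (hY : IsClosed Y) (S T : KTriple Y)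
    (f₀ : ∀ x, S.E₀.Fib x →ₗ[ℂ] T.E₀.Fib x)
    (f₁ : ∀ x, S.E₁.Fib x →ₗ[ℂ] T.E₁.Fib x) (h₀ : S.E₀.ContMap T.E₀ univ f₀)
    (h₁ : S.E₁.ContMap T.E₁ univ f₁) (b₀ : ∀ x, Function.Bijective (f₀ x))
    (b₁ : ∀ x, Function.Bijective (f₁ x))
    {b : ∀ x, S.E₀.Fib x →ₗ[ℂ] S.E₁.Fib x} (hb : S.E₀.ContMap S.E₁ Y b)
    (hbij : ∀ x ∈ Y, ∀ t : unitInterval, Function.Bijective (S.α x + ((t : ℝ) : ℂ) • b x))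
    (h : ∀ x ∈ Y, ∀ v, f₁ x (S.α x v + b x v) = T.α x (f₀ x v)) : mk S = mk T := by
  have hc := (CBundle.contMap_path S.cont hb).mono (W' := Y ×ˢ univ) fun p hp => hp.1
  have e := mk_slice_eq hY hc (fun p hp => hbij p.1 hp.1 p.2) 0 1
  have e0 : mk (slice hc (fun p hp => hbij p.1 hp.1 p.2) 0) = mk S :=
    mk_congr (T := S) (fun _ => LinearMap.id) (fun _ => LinearMap.id) (S.E₀.contMap_id subset_rfl)
      (S.E₁.contMap_id subset_rfl) (fun _ => Function.bijective_id)
      (fun _ => Function.bijective_id) fun x _ v => by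
        change S.α x v + (((0 : unitInterval) : ℝ) : ℂ) • b x v = S.α x v
        simp
  have e1 : mk (slice hc (fun p hp => hbij p.1 hp.1 p.2) 1) = mk T :=
    mk_congr (T := T) f₀ f₁ h₀ h₁ b₀ b₁ fun x hx v => by
        refine Eq.trans ?_ (h x hx v)
        change f₁ x (S.α x v + (((1 : unitInterval) : ℝ) : ℂ) • b x v) = _
        simp
  rw [← e0, e, e1]

end RelKGroup

/-! ### Isomorphic global objects have the same class -/

/-- A function which is one at zero and zero above `μ`. -/
noncomputable def tent (μ r : ℝ) : ℝ := max 0 (1 - r / μ)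

theorem continuous_tent (μ : ℝ) : Continuous (tent μ) := by unfold tent; fun_prop

theorem tent_zero (μ : ℝ) : tent μ 0 = 1 := by simp [tent]

theorem tent_eq_zero {μ : ℝ} (hμ : 0 < μ) (r : ℝ) (hr : μ ≤ r) : tent μ r = 0 :=
  max_eq_left (sub_nonpos.2 ((one_le_div hμ).2 hr))

namespace HFMap

variable {X : Type u} [TopologicalSpace X] {U V W : Set X} {E : HFObj U} {F : HFObj V}

/-- The map with the grading reversed. -/
def swap (φ : HFMap E F) : HFMap E.swap F.swap where
  even := φ.odd
  odd := φ.even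

theorem IsHom.swap {φ : HFMap E F} (h : φ.IsHom W) : φ.swap.IsHom W where
  cont_even := h.cont_odd
  cont_odd := h.cont_even
  comm₁₀ := h.comm₀₁
  comm₀₁ := h.comm₁₀

/-- The block diagonal map of `E⁰ ⊕ F¹` to `E¹ ⊕ F⁰` given by `h` and `-h`. -/
noncomputable def crossDiag (E : HFObj U) (F : HFObj V) (x : X) :
    (E.even.Fib x × F.odd.Fib x) →ₗ[ℂ] (E.odd.Fib x × F.even.Fib x) :=
  (E.h₁₀ x).prodMap (-(F.h₀₁ x))

/-- The off-diagonal map of `E⁰ ⊕ F¹` to `E¹ ⊕ F⁰` given by two homomorphisms. -/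
noncomputable def crossOff (μ : ℝ) (ψ : HFMap E F) (χ : HFMap F E) (x : X) :
    (E.even.Fib x × F.odd.Fib x) →ₗ[ℂ] (E.odd.Fib x × F.even.Fib x) :=
  (fc (tent μ) (E.sqOdd x) ∘ₗ χ.odd x ∘ₗ LinearMap.snd ℂ _ _).prod
    (ψ.even x ∘ₗ fc (tent μ) (E.sqEven x) ∘ₗ LinearMap.fst ℂ _ _)

/-- Write θ for tent(h²) and h' for the map of F. If (v, y) is in the kernel, then h v + tθχy = 0
and h'y = tψθv. Applying h to the first and using χψ = 1 at low energies gives (h² + t²θ²) v = 0.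
For an eigenvalue r ≥ 0 the number r + t² tent(r)² is positive, since tent(0) = 1, unless r = t = 0,
which invertibility of h excludes; so v = 0. Then h'y = 0. If t ≠ 0, χy lies in the kernel of h,
where θ = 1, so χy = 0 and y = ψχy = 0; otherwise h' is invertible. -/
theorem cross_injective {ψ : HFMap E F} {χ : HFMap F E} (hχ : χ.IsHom W) {x : X}
    (hx : x ∈ W) (hU : x ∈ U) {μ : ℝ} (hμ : 0 < μ)
    (h₁ : (χ.comp ψ).AgreeAt (HFMap.id E) μ x) (h₂ : (ψ.comp χ).AgreeAt (HFMap.id F) μ x)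
    {t : ℝ} (ht : t ≠ 0 ∨ E.InvertibleAt x ∧ F.InvertibleAt x) :
    Function.Injective (crossDiag E F x + (t : ℂ) • crossOff μ ψ χ x) := by
  have := E.finiteDimensional_even hU
  have := E.finiteDimensional_odd hU
  have hR := E.realDiag_sqEven hU
  rw [injective_iff_map_eq_zero]
  rintro ⟨v, y⟩ hv
  have e1 : E.h₁₀ x v + (t : ℂ) • fc (tent μ) (E.sqOdd x) (χ.odd x y) = 0 := congrArg Prod.fst hv
  have e2 : -F.h₀₁ x y + (t : ℂ) • ψ.even x (fc (tent μ) (E.sqEven x) v) = 0 :=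
    congrArg Prod.snd hv
  have hlow := hR.fc_mem_lowPart (tent_eq_zero hμ) v
  have e3 : χ.even x (ψ.even x (fc (tent μ) (E.sqEven x) v)) = fc (tent μ) (E.sqEven x) v :=
    h₁.1 _ hlow
  have hv0 : v = 0 := by
    have e4 : E.h₀₁ x (fc (tent μ) (E.sqOdd x) (χ.odd x y)) =
        (t : ℂ) • fc (tent μ) (E.sqEven x) (fc (tent μ) (E.sqEven x) v) := by
      rw [E.h₀₁_fc hU, ← hχ.comm₀₁ x hx, neg_add_eq_zero.1 e2, map_smul, map_smul, e3]
    have e5 := congrArg (E.h₀₁ x) e1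
    rw [map_add, map_smul, e4, map_zero] at e5
    have e6 : E.sqEven x + ((t * t : ℝ) : ℂ) • fc (fun r => tent μ r * tent μ r) (E.sqEven x) =
        fc (fun r => r + t * t * (tent μ r * tent μ r)) (E.sqEven x) :=
      hR.eq_fc fun r w hw => by
        rw [LinearMap.add_apply, LinearMap.smul_apply, fc_apply _ hw, hw]
        push_cast
        module
    refine hR.fc_injective (f := fun r => r + t * t * (tent μ r * tent μ r)) ?_ ?_
    · rintro r ⟨w, hw0, hw⟩
      have hr := E.sqEven_nonneg hU hw0 hw
      rcases hr.eq_or_lt with rfl | hr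
      · rw [tent_zero, zero_add, mul_one, mul_one]
        rcases ht with ht | ht
        · exact mul_self_ne_zero.2 ht
        · refine absurd ?_ hw0
          refine ht.1.1.1 (ht.1.2.1 ?_)
          rw [map_zero, map_zero]
          simpa using hw
      · have := mul_nonneg (mul_self_nonneg t) (mul_self_nonneg (tent μ r))
        exact (by linarith : 0 < r + t * t * (tent μ r * tent μ r)).ne'
    · rw [← e6, map_zero, LinearMap.add_apply, LinearMap.smul_apply, ← hR.fc_mul, ← e5,
        smul_smul, Complex.ofReal_mul]
      rfl
  subst hv0
  rw [map_zero, map_zero, smul_zero, add_zero, neg_eq_zero] at e2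
  rw [map_zero, zero_add] at e1
  have hy : y = 0 := by
    rcases ht with ht | ht
    · have e7 : E.sqOdd x (χ.odd x y) = ((0 : ℝ) : ℂ) • χ.odd x y := by
        change E.h₁₀ x (E.h₀₁ x (χ.odd x y)) = _
        rw [← hχ.comm₀₁ x hx, e2]
        simp
      rw [fc_apply _ e7, tent_zero, Complex.ofReal_one, one_smul] at e1
      have e8 : χ.odd x y = 0 := (smul_eq_zero.1 e1).resolve_left (by exact_mod_cast ht)
      have e9 : F.sqOdd x y = ((0 : ℝ) : ℂ) • y := by
        change F.h₁₀ x (F.h₀₁ x y) = _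
        rw [e2]
        simp
      have e10 : ψ.odd x (χ.odd x y) = y := h₂.2 y (mem_lowPart_of_eigen hμ e9)
      rw [← e10, e8, map_zero]
    · exact ht.2.2.1 (by rw [e2, map_zero])
  rw [hy]
  rfl

/-- Reversing the grading turns the same construction into an injection in the other direction. -/
theorem cross_bijective {ψ : HFMap E F} {χ : HFMap F E} (hχ : χ.IsHom W) {x : X}
    (hx : x ∈ W) (hU : x ∈ U) (hV : x ∈ V) {μ : ℝ} (hμ : 0 < μ)
    (h₁ : (χ.comp ψ).AgreeAt (HFMap.id E) μ x) (h₂ : (ψ.comp χ).AgreeAt (HFMap.id F) μ x)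
    {t : ℝ} (ht : t ≠ 0 ∨ E.InvertibleAt x ∧ F.InvertibleAt x) :
    Function.Bijective (crossDiag E F x + (t : ℂ) • crossOff μ ψ χ x) := by
  have := E.finiteDimensional_even hU
  have := E.finiteDimensional_odd hU
  have := F.finiteDimensional_even hV
  have := F.finiteDimensional_odd hV
  exact bijective_of_injective_injective (cross_injective hχ hx hU hμ h₁ h₂ ht)
    (cross_injective (ψ := ψ.swap) hχ.swap hx hU hμ ⟨h₁.2, h₁.1⟩ ⟨h₂.2, h₂.1⟩
      (ht.imp_right fun h => ⟨h.1.symm, h.2.symm⟩))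

variable {E F : HFObj (univ : Set X)}

theorem contMap_crossDiag (E F : HFObj (univ : Set X)) :
    (E.even.gsum F.odd.toCBundle).ContMap (E.odd.gsum F.even.toCBundle) univ (crossDiag E F) :=
  (E.cont₁₀.comp (CBundle.contMap_fst _ _) (subset_univ _)).prodMk
    (F.cont₀₁.neg.comp (CBundle.contMap_snd _ _) (subset_univ _))

theorem contMap_crossOff {ψ : HFMap E F} {χ : HFMap F E} (hψ : ψ.IsHom univ)
    (hχ : χ.IsHom univ) (μ : ℝ) :
    (E.even.gsum F.odd.toCBundle).ContMap (E.odd.gsum F.even.toCBundle) univ (crossOff μ ψ χ) :=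
  ((E.contMap_fc_sqOdd (continuous_tent μ)).comp (hχ.cont_odd.comp (CBundle.contMap_snd _ _)
    (subset_univ _)) (subset_univ _)).prodMk
    (hψ.cont_even.comp ((E.contMap_fc_sqEven (continuous_tent μ)).comp
      (CBundle.contMap_fst _ _) (subset_univ _)) (subset_univ _))

end HFMap

namespace HFObj

variable {X : Type u} [TopologicalSpace X] {Y : Set X}

/-- The triple of the object with reversed grading and sign. -/
def negTriple (E : HFObj (univ : Set X)) (h : E.toVectorial.supp ∩ Y = ∅) : KTriple Y where
  E₀ := E.odd.toCBundle
  E₁ := E.even.toCBundle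
  α x := -E.h₀₁ x
  cont := (E.cont₀₁.mono (subset_univ Y)).neg
  bij x hx := by
    have hb := (E.supp_inter_eq_empty_iff.1 h x hx).2
    exact (Equiv.neg _).bijective.comp hb

/-- At t = 0 the block matrix is the sum of the two triples; at t = 1 it is bijective over all of X,
so its triple is zero. Over Y it stays bijective in between. -/
theorem mk_toTriple_add_negTriple [CompactSpace X] [T2Space X] (hY : IsClosed Y)
    {E F : HFObj (univ : Set X)} (hE : E.toVectorial.supp ∩ Y = ∅)
    (hF : F.toVectorial.supp ∩ Y = ∅) {ψ : HFMap E F} {χ : HFMap F E} (hψ : ψ.IsHom univ)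
    (hχ : χ.IsHom univ) {μ : ℝ} (hμ : 0 < μ) (h₁ : ∀ x, (χ.comp ψ).AgreeAt (HFMap.id E) μ x)
    (h₂ : ∀ x, (ψ.comp χ).AgreeAt (HFMap.id F) μ x) :
    RelKGroup.mk (E.toTriple hE) + RelKGroup.mk (F.negTriple hF) = 0 := by
  have hb : ∀ (x : X) (t : ℝ), t ≠ 0 ∨ x ∈ Y →
      Function.Bijective (HFMap.crossDiag E F x + (t : ℂ) • HFMap.crossOff μ ψ χ x) :=
    fun x t ht => HFMap.cross_bijective hχ trivial trivial trivial hμ (h₁ x) (h₂ x)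
      (ht.imp_right fun hx => ⟨E.supp_inter_eq_empty_iff.1 hE x hx,
        F.supp_inter_eq_empty_iff.1 hF x hx⟩)
  have hc := (HFMap.contMap_crossDiag E F).add (HFMap.contMap_crossOff hψ hχ μ)
  have hb1 : ∀ x : X, Function.Bijective (HFMap.crossDiag E F x + HFMap.crossOff μ ψ χ x) := by
    intro x
    simpa using hb x 1 (Or.inl one_ne_zero)
  rw [← RelKGroup.mk_sum]
  let T : KTriple Y := ⟨_, _, _, hc.mono (subset_univ Y), fun x _ => hb1 x⟩
  refine Eq.trans (RelKGroup.mk_eq_of_path hY _ T (fun _ => LinearMap.id) (fun _ => LinearMap.id)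
    (CBundle.contMap_id _ subset_rfl) (CBundle.contMap_id _ subset_rfl)
    (fun _ => Function.bijective_id) (fun _ => Function.bijective_id)
    ((HFMap.contMap_crossOff hψ hχ μ).mono (subset_univ _)) (fun x hx t => hb x t (Or.inr hx))
    fun x hx v => rfl) ?_
  exact RelKGroup.mk_eq_zero T hc hb1 fun x _ => rfl

/-- The case ψ = χ = id. Applied to F, it turns the previous lemma into an equality of the classes
of E and F. -/
theorem mk_toTriple_eq_neg [CompactSpace X] [T2Space X] (hY : IsClosed Y)
    (E : HFObj (univ : Set X)) (h : E.toVectorial.supp ∩ Y = ∅) :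
    RelKGroup.mk (E.toTriple h) = -RelKGroup.mk (E.negTriple h) :=
  eq_neg_of_add_eq_zero_left (mk_toTriple_add_negTriple hY h h (HFMap.isHom_id E subset_rfl)
    (HFMap.isHom_id E subset_rfl) one_pos (fun _ => ⟨fun _ _ => rfl, fun _ _ => rfl⟩)
    fun _ => ⟨fun _ _ => rfl, fun _ _ => rfl⟩)

theorem mk_toTriple_eq_of_iso [CompactSpace X] [T2Space X] (hY : IsClosed Y)
    {E F : HFObj (univ : Set X)} (hE : E.toVectorial.supp ∩ Y = ∅)
    (hF : F.toVectorial.supp ∩ Y = ∅) (h : E.toVectorial.Iso F.toVectorial) :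
    RelKGroup.mk (E.toTriple hE) = RelKGroup.mk (F.toTriple hF) := by
  obtain ⟨ψ, χ, hψ, hχ, h₁, h₂⟩ := h
  have hψ' : (ψ PUnit.unit PUnit.unit).IsHom univ := (hψ.isHom _ _).mono fun _ _ => ⟨trivial, trivial⟩
  have hχ' : (χ PUnit.unit PUnit.unit).IsHom univ := (hχ.isHom _ _).mono fun _ _ => ⟨trivial, trivial⟩
  obtain ⟨μ, hμ, H₁⟩ := (h₁ PUnit.unit PUnit.unit PUnit.unit).exists_uniform isCompact_univ
    fun _ _ => ⟨⟨trivial, trivial⟩, trivial⟩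
  obtain ⟨ν, hν, H₂⟩ := (h₂ PUnit.unit PUnit.unit PUnit.unit).exists_uniform isCompact_univ
    fun _ _ => ⟨⟨trivial, trivial⟩, trivial⟩
  have key := mk_toTriple_add_negTriple hY hE hF hψ' hχ' (lt_min hμ hν)
    (fun x => (H₁ x trivial).mono (min_le_left _ _)) fun x => (H₂ x trivial).mono (min_le_right _ _)
  rw [mk_toTriple_eq_neg hY F hF]
  exact eq_neg_of_add_eq_zero_left key

/-- A global object whose triple is isomorphic to the given one. -/
theorem exists_lift [CompactSpace X] [T2Space X] (hY : IsClosed Y) (T : KTriple Y) :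
    ∃ f : ∀ x, T.E₀.Fib x →ₗ[ℂ] T.E₁.Fib x, T.E₀.ContMap T.E₁ univ f ∧ ∀ x ∈ Y, f x = T.α x :=
  CBundle.ContMap.exists_extension hY T.cont

/-- A global object with the same bundles as the given triple. -/
noncomputable def lift [CompactSpace X] [T2Space X] (hY : IsClosed Y) (T : KTriple Y) :
    HFObj (univ : Set X) :=
  HFObj.ofMap T.E₀.hermitian T.E₁.hermitian (exists_lift hY T).choose
    (exists_lift hY T).choose_spec.1

theorem lift_h₁₀ [CompactSpace X] [T2Space X] (hY : IsClosed Y) (T : KTriple Y) {x : X}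
    (hx : x ∈ Y) : (lift hY T).h₁₀ x = T.α x :=
  (exists_lift hY T).choose_spec.2 x hx

theorem supp_lift [CompactSpace X] [T2Space X] (hY : IsClosed Y) (T : KTriple Y) :
    (lift hY T).toVectorial.supp ∩ Y = ∅ :=
  (supp_inter_eq_empty_iff _).2 fun x hx => invertibleAt_of_bijective _ trivial (by
    have hb := T.bij x hx
    rw [← lift_h₁₀ hY T hx] at hb
    exact hb)

theorem mk_toTriple_lift [CompactSpace X] [T2Space X] (hY : IsClosed Y) (T : KTriple Y) :
    RelKGroup.mk ((lift hY T).toTriple (supp_lift hY T)) = RelKGroup.mk T :=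
  RelKGroup.mk_congr (T := T) (fun _ => LinearMap.id) (fun _ => LinearMap.id)
    (CBundle.contMap_id _ subset_rfl) (CBundle.contMap_id _ subset_rfl)
    (fun _ => Function.bijective_id) (fun _ => Function.bijective_id) fun _ hx v =>
      DFunLike.congr_fun (lift_h₁₀ hY T hx) v

end HFObj

/-- Reversing the grading of a lift gives negatives, so no formal differences remain. The uniqueness
of Φ depends on this. -/
theorem RelKGroup.exists_eq_mk {X : Type u} [TopologicalSpace X] [CompactSpace X] [T2Space X]
    {Y : Set X} (hY : IsClosed Y) (z : RelKGroup X Y) : ∃ T : KTriple Y, z = mk T := by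
  obtain ⟨z, rfl⟩ := QuotientAddGroup.mk_surjective z
  induction z using FreeAbelianGroup.induction_on with
  | zero =>
    exact ⟨KTriple.elem Y (CBundle.triv X (EuclideanSpace ℂ (Fin 0))), (mk_elem _).symm⟩
  | of T => exact ⟨T, rfl⟩
  | neg T _ =>
    refine ⟨(HFObj.lift hY T).negTriple (HFObj.supp_lift hY T), ?_⟩
    have h := HFObj.mk_toTriple_eq_neg hY _ (HFObj.supp_lift hY T)
    rw [HFObj.mk_toTriple_lift] at h
    rw [QuotientAddGroup.mk_neg]
    exact neg_eq_iff_eq_neg.2 h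
  | add z w hz hw =>
    obtain ⟨S, hS⟩ := hz
    obtain ⟨T, hT⟩ := hw
    exact ⟨S.sum T, by rw [QuotientAddGroup.mk_add, hS, hT, mk_sum]⟩

/-! ### Homotopies of global objects -/

namespace HFObj

variable {X : Type u} [TopologicalSpace X] {Y : Set X}

theorem toVectorial_iso_of_isHom {E F : HFObj (univ : Set X)} {ψ : HFMap E F} {χ : HFMap F E}
    (hψ : ψ.IsHom univ) (hχ : χ.IsHom univ) (h₁ : (χ.comp ψ).Eqv (HFMap.id E) univ)
    (h₂ : (ψ.comp χ).Eqv (HFMap.id F) univ) : E.toVectorial.Iso F.toVectorial :=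
  ⟨fun _ _ => ψ, fun _ _ => χ,
    ⟨fun _ _ => hψ.mono (subset_univ _), fun _ _ _ => .refl _ _, fun _ _ _ => .refl _ _⟩,
    ⟨fun _ _ => hχ.mono (subset_univ _), fun _ _ _ => .refl _ _, fun _ _ _ => .refl _ _⟩,
    fun _ _ _ => h₁.mono (subset_univ _), fun _ _ _ => h₂.mono (subset_univ _)⟩

/-- For isometries, compatibility with h₀₁ follows from compatibility with its adjoint h₁₀. -/
theorem toVectorial_iso_of_isometry {E F : HFObj (univ : Set X)}
    {f₀ : ∀ x, E.even.Fib x →ₗ[ℂ] F.even.Fib x} {f₁ : ∀ x, E.odd.Fib x →ₗ[ℂ] F.odd.Fib x}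
    (h₀ : E.even.ContMap F.even.toCBundle univ f₀) (h₁ : E.odd.ContMap F.odd.toCBundle univ f₁)
    (b₀ : ∀ x, Function.Bijective (f₀ x)) (b₁ : ∀ x, Function.Bijective (f₁ x))
    (i₀ : ∀ x v w, (F.even.metric x).inner (f₀ x v) (f₀ x w) = (E.even.metric x).inner v w)
    (i₁ : ∀ x v w, (F.odd.metric x).inner (f₁ x v) (f₁ x w) = (E.odd.metric x).inner v w)
    (h : ∀ x v, f₁ x (E.h₁₀ x v) = F.h₁₀ x (f₀ x v)) : E.toVectorial.Iso F.toVectorial := by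
  have h' : ∀ x v, f₀ x (E.h₀₁ x v) = F.h₀₁ x (f₁ x v) := by
    intro x v
    refine (F.even.metric x).ext_inner _ _ fun u => ?_
    obtain ⟨u, rfl⟩ := (b₀ x).2 u
    rw [i₀, ← E.hermitian x trivial, ← F.hermitian x trivial, ← h, i₁]
  refine toVectorial_iso_of_isHom (ψ := ⟨f₀, f₁⟩) (χ := ⟨E.even.fibInv F.even.toCBundle f₀,
    E.odd.fibInv F.odd.toCBundle f₁⟩) ⟨h₀, h₁, fun x _ => h x, fun x _ => h' x⟩
    ⟨h₀.fibInv fun x _ => b₀ x, h₁.fibInv fun x _ => b₁ x, fun x _ v => ?_, fun x _ v => ?_⟩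
    (.of_eq (fun x _ => CBundle.fibInv_apply (b₀ x)) fun x _ => CBundle.fibInv_apply (b₁ x))
    (.of_eq (fun x _ => CBundle.apply_fibInv (b₀ x)) fun x _ => CBundle.apply_fibInv (b₁ x))
  · obtain ⟨v, rfl⟩ := (b₀ x).2 v
    change E.odd.fibInv F.odd.toCBundle f₁ x (F.h₁₀ x (f₀ x v)) =
      E.h₁₀ x (E.even.fibInv F.even.toCBundle f₀ x (f₀ x v))
    rw [← h, CBundle.fibInv_apply (b₁ x), CBundle.fibInv_apply (b₀ x)]
  · obtain ⟨v, rfl⟩ := (b₁ x).2 v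
    change E.even.fibInv F.even.toCBundle f₀ x (F.h₀₁ x (f₁ x v)) =
      E.h₀₁ x (E.odd.fibInv F.odd.toCBundle f₁ x (f₁ x v))
    rw [← h', CBundle.fibInv_apply (b₁ x), CBundle.fibInv_apply (b₀ x)]

theorem toVectorial_sum_iso (E F : HFObj (univ : Set X)) :
    (E.toVectorial.sum F.toVectorial).Iso (E.gsum F).toVectorial := by
  have h : (HFMap.id (E.gsum F)).IsHom univ := HFMap.isHom_id _ subset_rfl
  have e : (HFMap.id (E.gsum F)).Eqv (HFMap.id (E.gsum F)) univ := .refl _ _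
  exact ⟨fun _ _ => ⟨fun _ => LinearMap.id, fun _ => LinearMap.id⟩,
    fun _ _ => ⟨fun _ => LinearMap.id, fun _ => LinearMap.id⟩,
    ⟨fun _ _ => ⟨h.1.mono (subset_univ _), h.2.mono (subset_univ _), fun _ _ _ => rfl,
      fun _ _ _ => rfl⟩, fun _ _ _ => .of_eq (fun _ _ _ => rfl) fun _ _ _ => rfl,
      fun _ _ _ => .of_eq (fun _ _ _ => rfl) fun _ _ _ => rfl⟩,
    ⟨fun _ _ => ⟨h.1.mono (subset_univ _), h.2.mono (subset_univ _), fun _ _ _ => rfl,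
      fun _ _ _ => rfl⟩, fun _ _ _ => .of_eq (fun _ _ _ => rfl) fun _ _ _ => rfl,
      fun _ _ _ => .of_eq (fun _ _ _ => rfl) fun _ _ _ => rfl⟩,
    fun _ _ _ => .of_eq (fun _ _ _ => rfl) fun _ _ _ => rfl,
    fun _ _ _ => .of_eq (fun _ _ _ => rfl) fun _ _ _ => rfl⟩

theorem supp_gsum {E F : HFObj (univ : Set X)} (hE : E.toVectorial.supp ∩ Y = ∅)
    (hF : F.toVectorial.supp ∩ Y = ∅) : (E.gsum F).toVectorial.supp ∩ Y = ∅ :=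
  (supp_inter_eq_empty_iff _).2 fun y hy =>
    have hE := E.supp_inter_eq_empty_iff.1 hE y hy
    have hF := F.supp_inter_eq_empty_iff.1 hF y hy
    ⟨hE.1.prodMap hF.1, hE.2.prodMap hF.2⟩

end HFObj

/-- The path from the inner product of `E` to the one pulled back along `f : E → F`. -/
noncomputable def HBundle.path {X : Type u} [TopologicalSpace X] (E F : HBundle (univ : Set X))
    (f : ∀ x, E.Fib x →ₗ[ℂ] F.Fib x) (hf : E.ContMap F.toCBundle univ f)
    (hb : ∀ x, Function.Injective (f x)) : HBundle (univ : Set (X × unitInterval)) :=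
  HBundle.ofMetric (E.toCBundle.comap (fstMap X))
    (fun p => (sumMetric (E.metric p.1) (F.metric p.1)).comap
      -- The square roots make the pulled back form the convex combination of the inner product of
      -- E, with weight 1 − t, and of the one pulled back from F, with weight t. At each t at least
      -- one component is injective.
      (((√(1 - (p.2 : ℝ)) : ℂ) • LinearMap.id).prod ((√(p.2 : ℝ) : ℂ) • f p.1)) (by
        intro v w h
        have h1 : (√(1 - (p.2 : ℝ)) : ℂ) • v = (√(1 - (p.2 : ℝ)) : ℂ) • w := congrArg Prod.fst h
        have h2 : (√(p.2 : ℝ) : ℂ) • f p.1 v = (√(p.2 : ℝ) : ℂ) • f p.1 w := congrArg Prod.snd h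
        by_cases ht : (p.2 : ℝ) = 0
        · rw [ht] at h1
          simpa using h1
        · refine hb p.1 ((smul_right_injective _ ?_) h2)
          exact Complex.ofReal_ne_zero.2
            (Real.sqrt_ne_zero'.2 (lt_of_le_of_ne p.2.2.1 (Ne.symm ht)))))
    (fun W s t hs ht => by
      have c₀ : Continuous fun p : X × unitInterval => (√(1 - (p.2 : ℝ)) : ℂ) := by fun_prop
      have c₁ : Continuous fun p : X × unitInterval => (√(p.2 : ℝ) : ℂ) := by fun_prop
      have k := (hf.comap (fstMap X)).mono (W' := W) (subset_univ _)
      have hs' := k.contSec' (subset_univ W) subset_rfl hs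
      have ht' := k.contSec' (subset_univ W) subset_rfl ht
      exact (CBundle.ContSec.inner (E := E.comap (fstMap X)) (hs.smul c₀.continuousOn)
        (ht.smul c₀.continuousOn) (subset_univ _)).add
        (CBundle.ContSec.inner (E := F.comap (fstMap X)) (hs'.smul c₁.continuousOn)
        (ht'.smul c₁.continuousOn) (subset_univ _)))

theorem HBundle.path_inner {X : Type u} [TopologicalSpace X] {E F : HBundle (univ : Set X)}
    {f : ∀ x, E.Fib x →ₗ[ℂ] F.Fib x} (hf : E.ContMap F.toCBundle univ f)
    (hb : ∀ x, Function.Injective (f x)) (x : X) (t : unitInterval) (v w : E.Fib x) :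
    ((E.path F f hf hb).metric (x, t)).inner v w =
      (E.metric x).inner ((√(1 - (t : ℝ)) : ℂ) • v) ((√(1 - (t : ℝ)) : ℂ) • w) +
      (F.metric x).inner ((√(t : ℝ) : ℂ) • f x v) ((√(t : ℝ) : ℂ) • f x w) := rfl

theorem HBundle.path_inner_zero {X : Type u} [TopologicalSpace X] {E F : HBundle (univ : Set X)}
    {f : ∀ x, E.Fib x →ₗ[ℂ] F.Fib x} (hf : E.ContMap F.toCBundle univ f)
    (hb : ∀ x, Function.Injective (f x)) (x : X) (v w : E.Fib x) :
    ((E.path F f hf hb).metric (x, 0)).inner v w = (E.metric x).inner v w := by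
  rw [HBundle.path_inner]
  simp [InnerProductSpace.Core.inner_zero_right']

theorem HBundle.path_inner_one {X : Type u} [TopologicalSpace X] {E F : HBundle (univ : Set X)}
    {f : ∀ x, E.Fib x →ₗ[ℂ] F.Fib x} (hf : E.ContMap F.toCBundle univ f)
    (hb : ∀ x, Function.Injective (f x)) (x : X) (v w : E.Fib x) :
    ((E.path F f hf hb).metric (x, 1)).inner v w = (F.metric x).inner (f x v) (f x w) := by
  rw [HBundle.path_inner]
  simp [InnerProductSpace.Core.inner_zero_right']

/-! ### Paths of objects and equality of classes in KF(X, Y). -/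

namespace KF

variable {X : Type u} [TopologicalSpace X] {Y : Set X}

theorem mk_eq_of_iso {E F : VectorialBundle X} (hE : E.supp ∩ Y = ∅) (hF : F.supp ∩ Y = ∅)
    (h : E.Iso F) : mk E hE = mk F hF :=
  Quot.sound ⟨RelVectorialBundle.const ⟨E, hE⟩, .refl E, h⟩

/-- Map and metric move together: h + t b is taken with the metric on the way from that of E to the
one pulled back from F, and h₀₁ is its adjoint for the metric at t. At t = 1 the pair (f₀, f₁) is an
isometry onto F. -/
theorem mk_eq_of_path {E F : HFObj (univ : Set X)} (hE : E.toVectorial.supp ∩ Y = ∅)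
    (hF : F.toVectorial.supp ∩ Y = ∅)
    {f₀ : ∀ x, E.even.Fib x →ₗ[ℂ] F.even.Fib x} {f₁ : ∀ x, E.odd.Fib x →ₗ[ℂ] F.odd.Fib x}
    (h₀ : E.even.ContMap F.even.toCBundle univ f₀) (h₁ : E.odd.ContMap F.odd.toCBundle univ f₁)
    (b₀ : ∀ x, Function.Bijective (f₀ x)) (b₁ : ∀ x, Function.Bijective (f₁ x))
    {b : ∀ x, E.even.Fib x →ₗ[ℂ] E.odd.Fib x} (hb : E.even.ContMap E.odd.toCBundle univ b)
    (hbij : ∀ x ∈ Y, ∀ t : unitInterval, Function.Bijective (E.h₁₀ x + ((t : ℝ) : ℂ) • b x))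
    (h : ∀ x v, f₁ x (E.h₁₀ x v + b x v) = F.h₁₀ x (f₀ x v)) :
    mk E.toVectorial hE = mk F.toVectorial hF := by
  let H : HFObj (univ : Set (X × unitInterval)) := HFObj.ofMap
    (E.even.path F.even f₀ h₀ fun x => (b₀ x).1) (E.odd.path F.odd f₁ h₁ fun x => (b₁ x).1)
    (fun p => E.h₁₀ p.1 + ((p.2 : ℝ) : ℂ) • b p.1) (CBundle.contMap_path E.cont₁₀ hb)
  have hH : H.toVectorial.supp ∩ (Y ×ˢ univ) = ∅ := H.supp_inter_eq_empty_iff.2 fun p hp =>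
    H.invertibleAt_of_bijective trivial (hbij p.1 hp.1 p.2)
  refine Quot.sound ⟨⟨H.toVectorial, hH⟩, ?_, ?_⟩
  · let H₀ : HFObj (univ : Set X) := H.comap (sliceMap X 0)
    change H₀.toVectorial.Iso E.toVectorial
    refine HFObj.toVectorial_iso_of_isometry (f₀ := fun _ => LinearMap.id)
      (f₁ := fun _ => LinearMap.id) (E.even.contMap_id subset_rfl) (E.odd.contMap_id subset_rfl)
      (fun _ => Function.bijective_id) (fun _ => Function.bijective_id)
      (fun x v w => (HBundle.path_inner_zero h₀ (fun x => (b₀ x).1) x v w).symm)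
      (fun x v w => (HBundle.path_inner_zero h₁ (fun x => (b₁ x).1) x v w).symm) fun x v => ?_
    change E.h₁₀ x v + (((0 : unitInterval) : ℝ) : ℂ) • b x v = E.h₁₀ x v
    simp
  · let H₁ : HFObj (univ : Set X) := H.comap (sliceMap X 1)
    change H₁.toVectorial.Iso F.toVectorial
    refine HFObj.toVectorial_iso_of_isometry (f₀ := f₀) (f₁ := f₁) h₀ h₁ b₀ b₁
      (fun x v w => (HBundle.path_inner_one h₀ (fun x => (b₀ x).1) x v w).symm)
      (fun x v w => (HBundle.path_inner_one h₁ (fun x => (b₁ x).1) x v w).symm) fun x v => ?_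
    refine Eq.trans ?_ (h x v)
    change f₁ x (E.h₁₀ x v + (((1 : unitInterval) : ℝ) : ℂ) • b x v) = _
    simp

/-- The difference b = f₁⁻¹ h_F f₀ − h_E vanishes over Y, so the straight path is constant there and
stays invertible. Hence the class of an object depends only on its underlying triple, not on the
metric or on h off Y. -/
theorem mk_congr {E F : HFObj (univ : Set X)} (hE : E.toVectorial.supp ∩ Y = ∅)
    (hF : F.toVectorial.supp ∩ Y = ∅)
    {f₀ : ∀ x, E.even.Fib x →ₗ[ℂ] F.even.Fib x} {f₁ : ∀ x, E.odd.Fib x →ₗ[ℂ] F.odd.Fib x}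
    (h₀ : E.even.ContMap F.even.toCBundle univ f₀) (h₁ : E.odd.ContMap F.odd.toCBundle univ f₁)
    (b₀ : ∀ x, Function.Bijective (f₀ x)) (b₁ : ∀ x, Function.Bijective (f₁ x))
    (h : ∀ x ∈ Y, ∀ v, f₁ x (E.h₁₀ x v) = F.h₁₀ x (f₀ x v)) :
    mk E.toVectorial hE = mk F.toVectorial hF := by
  have hc := ((h₁.fibInv fun x _ => b₁ x).comp (F.cont₁₀.comp h₀ subset_rfl) subset_rfl).sub
    E.cont₁₀
  refine mk_eq_of_path hE hF h₀ h₁ b₀ b₁ hc (fun x hx t => ?_) fun x v => ?_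
  · have e : E.odd.fibInv F.odd.toCBundle f₁ x ∘ₗ F.h₁₀ x ∘ₗ f₀ x - E.h₁₀ x = 0 := by
      refine LinearMap.ext fun v => ?_
      change E.odd.fibInv F.odd.toCBundle f₁ x (F.h₁₀ x (f₀ x v)) - E.h₁₀ x v = 0
      rw [← h x hx, CBundle.fibInv_apply (b₁ x), sub_self]
    rw [e, smul_zero, add_zero]
    exact (E.supp_inter_eq_empty_iff.1 hE x hx).1
  · change f₁ x (E.h₁₀ x v + (E.odd.fibInv F.odd.toCBundle f₁ x (F.h₁₀ x (f₀ x v)) - E.h₁₀ x v)) = _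
    rw [add_sub_cancel, CBundle.apply_fibInv (b₁ x)]

theorem mk_add {E F : HFObj (univ : Set X)} (hE : E.toVectorial.supp ∩ Y = ∅)
    (hF : F.toVectorial.supp ∩ Y = ∅) : mk E.toVectorial hE + mk F.toVectorial hF =
      mk (E.gsum F).toVectorial (HFObj.supp_gsum hE hF) :=
  mk_eq_of_iso (RelVectorialBundle.sum ⟨_, hE⟩ ⟨_, hF⟩).2 _ (E.toVectorial_sum_iso F)

theorem exists_eq_mk [CompactSpace X] [T2Space X] (z : KF X Y) :
    ∃ (G : HFObj (univ : Set X)) (h : G.toVectorial.supp ∩ Y = ∅), z = mk G.toVectorial h := by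
  obtain ⟨⟨E, hE⟩, rfl⟩ := Quot.exists_rep z
  obtain ⟨G, hG⟩ := E.exists_global
  have h : G.toVectorial.supp ∩ Y = ∅ := by rwa [← hG.supp_eq]
  exact ⟨G, h, mk_eq_of_iso hE h hG⟩

end KF

/-! ### The group structure of `KF(X, Y)` -/

/-- The zero bundle. -/
noncomputable abbrev CBundle.null (X : Type u) [TopologicalSpace X] : CBundle (univ : Set X) :=
  CBundle.triv X (EuclideanSpace ℂ (Fin 0))

namespace KF

variable {X : Type u} [TopologicalSpace X] {Y : Set X}

theorem supp_null (Z W : HBundle (univ : Set X)) (hZ : ∀ x, Subsingleton (Z.Fib x))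
    (hW : ∀ x, Subsingleton (W.Fib x)) : (HFObj.ofZero Z W).toVectorial.supp ∩ Y = ∅ :=
  (HFObj.supp_inter_eq_empty_iff _).2 fun x _ =>
    ⟨⟨fun _ _ _ => (hZ x).elim _ _, fun _ => ⟨0, (hW x).elim _ _⟩⟩,
      ⟨fun _ _ _ => (hW x).elim _ _, fun _ => ⟨0, (hZ x).elim _ _⟩⟩⟩

/-- The zero object. -/
noncomputable def nullObj (X : Type u) [TopologicalSpace X] [CompactSpace X] [T2Space X] :
    HFObj (univ : Set X) :=
  HFObj.ofZero (CBundle.null X).hermitian (CBundle.null X).hermitian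

theorem subsingleton_null (x : X) : Subsingleton ((CBundle.null X).Fib x) :=
  inferInstanceAs (Subsingleton (EuclideanSpace ℂ (Fin 0)))

theorem supp_nullObj [CompactSpace X] [T2Space X] : (nullObj X).toVectorial.supp ∩ Y = ∅ :=
  supp_null _ _ subsingleton_null subsingleton_null

/-- Here h² = 1 has no eigenvalue below 1, so the low part for μ = 1 is zero and the zero maps are
mutually inverse in HF. -/
theorem ofMap_id_iso_nullObj [CompactSpace X] [T2Space X] (P : HBundle (univ : Set X)) :
    (HFObj.ofMap P P (fun _ => LinearMap.id) (P.contMap_id subset_rfl)).toVectorial.Iso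
      (nullObj X).toVectorial := by
  set G := HFObj.ofMap P P (fun _ => LinearMap.id) (P.contMap_id subset_rfl)
  have hadj : ∀ x v, G.h₀₁ x v = v := fun x v =>
    (P.metric x).ext_inner _ _ fun u => (G.hermitian x trivial u v).symm
  have h0 : ∀ x, Subsingleton ((nullObj X).even.Fib x) := subsingleton_null
  have h1 : ∀ x, Subsingleton ((nullObj X).odd.Fib x) := subsingleton_null
  refine HFObj.toVectorial_iso_of_isHom (ψ := ⟨fun _ => 0, fun _ => 0⟩)
    (χ := ⟨fun _ => 0, fun _ => 0⟩)
    ⟨CBundle.contMap_zero _ _, CBundle.contMap_zero _ _, fun _ _ _ => (h1 _).elim _ _,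
      fun _ _ _ => (h0 _).elim _ _⟩
    ⟨CBundle.contMap_zero _ _, CBundle.contMap_zero _ _, fun _ _ _ => (map_zero _).symm,
      fun _ _ _ => (map_zero _).symm⟩ ?_
    (.of_eq (fun _ _ _ => (h0 _).elim _ _) fun _ _ _ => (h1 _).elim _ _)
  have key : ∀ {r : ℝ}, r < 1 → ∀ {x} {v : P.Fib x}, v = (r : ℂ) • v → (0 : P.Fib x) = v := by
    intro r hr x v hv
    have h2 : ((1 - r : ℝ) : ℂ) • v = 0 := by
      push_cast
      rw [sub_smul, one_smul, ← hv, sub_self]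
    exact ((smul_eq_zero.1 h2).resolve_left
      (Complex.ofReal_ne_zero.2 (sub_pos.2 hr).ne')).symm
  refine fun _ _ => ⟨1, one_pos, univ, isOpen_univ, trivial, fun y _ => ⟨fun ξ hξ => ?_,
    fun ξ hξ => ?_⟩⟩
  · exact eqOn_lowPart (M := G.sqEven y) (N := (0 : P.Fib y →ₗ[ℂ] P.Fib y)) (N' := LinearMap.id)
      (fun r hr v hv => key hr ((hadj y v).symm.trans hv)) hξ
  · exact eqOn_lowPart (M := G.sqOdd y) (N := (0 : P.Fib y →ₗ[ℂ] P.Fib y)) (N' := LinearMap.id)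
      (fun r hr v hv => key hr ((hadj y v).symm.trans hv)) hξ

/-- An everywhere invertible h₁₀ is itself an isomorphism of E⁰ with E¹ that turns h into the
identity of E¹. -/
theorem mk_eq_null [CompactSpace X] [T2Space X] (E : HFObj (univ : Set X))
    (hE : E.toVectorial.supp ∩ Y = ∅) (h : ∀ x, E.InvertibleAt x) :
    mk E.toVectorial hE = mk (nullObj X).toVectorial supp_nullObj := by
  have hG : (HFObj.ofMap E.odd E.odd (fun _ => LinearMap.id)
      (E.odd.contMap_id subset_rfl)).toVectorial.supp ∩ Y = ∅ :=
    (HFObj.supp_inter_eq_empty_iff _).2 fun x _ =>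
      HFObj.invertibleAt_of_bijective _ trivial Function.bijective_id
  rw [← mk_eq_of_iso hG supp_nullObj (ofMap_id_iso_nullObj E.odd)]
  exact mk_congr hE hG (f₀ := E.h₁₀) (f₁ := fun _ => LinearMap.id) E.cont₁₀
    (E.odd.contMap_id subset_rfl) (fun x => (h x).1) (fun _ => Function.bijective_id)
    fun _ _ _ => rfl

theorem add_comm' [CompactSpace X] [T2Space X] (z w : KF X Y) : z + w = w + z := by
  obtain ⟨E, hE, rfl⟩ := exists_eq_mk z
  obtain ⟨F, hF, rfl⟩ := exists_eq_mk w
  rw [mk_add, mk_add]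
  have h₀ := CBundle.IsoPair.swap E.even.toCBundle F.even.toCBundle
  have h₁ := CBundle.IsoPair.swap E.odd.toCBundle F.odd.toCBundle
  exact mk_congr (E := E.gsum F) (F := F.gsum E) _ _ h₀.cont_to h₁.cont_to h₀.bijective
    h₁.bijective fun _ _ _ => rfl

/-- The inverse has reversed grading and sign: the block matrix of `HFMap.cross_bijective`, with
identities off the diagonal, deforms the sum into an everywhere invertible object. -/
theorem exists_add_eq_null [CompactSpace X] [T2Space X] (z : KF X Y) :
    ∃ w : KF X Y, z + w = mk (nullObj X).toVectorial supp_nullObj := by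
  obtain ⟨E, hE, rfl⟩ := exists_eq_mk z
  let N : HFObj (univ : Set X) := HFObj.ofMap E.odd E.even (fun x => -E.h₀₁ x) E.cont₀₁.neg
  have hN : N.toVectorial.supp ∩ Y = ∅ := N.supp_inter_eq_empty_iff.2 fun x hx =>
    N.invertibleAt_of_bijective trivial
      ((Equiv.neg _).bijective.comp (E.supp_inter_eq_empty_iff.1 hE x hx).2)
  refine ⟨mk N.toVectorial hN, ?_⟩
  rw [mk_add hE hN]
  have hid := HFMap.isHom_id E subset_rfl
  have hb : ∀ (x : X) (t : ℝ), t ≠ 0 ∨ x ∈ Y → Function.Bijective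
      (HFMap.crossDiag E E x + (t : ℂ) • HFMap.crossOff 1 (HFMap.id E) (HFMap.id E) x) :=
    fun x t ht => HFMap.cross_bijective hid trivial trivial trivial one_pos
      ⟨fun _ _ => rfl, fun _ _ => rfl⟩ ⟨fun _ _ => rfl, fun _ _ => rfl⟩
      (ht.imp_right fun hx => ⟨E.supp_inter_eq_empty_iff.1 hE x hx,
        E.supp_inter_eq_empty_iff.1 hE x hx⟩)
  have hoff := HFMap.contMap_crossOff hid hid 1
  have hc := (HFMap.contMap_crossDiag E E).add hoff
  let S : HFObj (univ : Set X) := HFObj.ofMap (E.gsum N).even (E.gsum N).odd _ hc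
  have hS : ∀ x, S.InvertibleAt x := fun x => S.invertibleAt_of_bijective trivial (by
    have h1 := hb x 1 (Or.inl one_ne_zero)
    rw [Complex.ofReal_one, one_smul] at h1
    exact h1)
  have hS' : S.toVectorial.supp ∩ Y = ∅ := S.supp_inter_eq_empty_iff.2 fun x _ => hS x
  rw [← mk_eq_null S hS' hS]
  exact mk_eq_of_path (E := E.gsum N) (F := S) _ hS' ((E.gsum N).even.contMap_id subset_rfl)
    ((E.gsum N).odd.contMap_id subset_rfl) (fun _ => Function.bijective_id)
    (fun _ => Function.bijective_id) hoff (fun x hx t => hb x t (Or.inr hx)) fun _ _ => rfl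

theorem add_null [CompactSpace X] [T2Space X] (z : KF X Y) :
    z + mk (nullObj X).toVectorial supp_nullObj = z := by
  obtain ⟨E, hE, rfl⟩ := exists_eq_mk z
  rw [mk_add]
  refine mk_congr (E := E.gsum (nullObj X)) (F := E) _ hE
    (CBundle.contMap_fst _ _) (CBundle.contMap_fst _ _) (fun x => ?_) (fun x => ?_)
    fun _ _ _ => rfl
  all_goals exact ⟨fun v w h => Prod.ext h ((subsingleton_null x).elim _ _), fun v => ⟨(v, 0), rfl⟩⟩

theorem add_assoc' [CompactSpace X] [T2Space X] (z w u : KF X Y) : z + w + u = z + (w + u) := by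
  obtain ⟨E, hE, rfl⟩ := exists_eq_mk z
  obtain ⟨F, hF, rfl⟩ := exists_eq_mk w
  obtain ⟨G, hG, rfl⟩ := exists_eq_mk u
  rw [mk_add, mk_add, mk_add, mk_add]
  have key : ∀ A B C : CBundle (univ : Set X), ((A.gsum B).gsum C).ContMap (A.gsum (B.gsum C)) univ
      fun _ => ((LinearMap.fst ℂ _ _) ∘ₗ (LinearMap.fst ℂ _ _)).prod
        (((LinearMap.snd ℂ _ _) ∘ₗ (LinearMap.fst ℂ _ _)).prod (LinearMap.snd ℂ _ _)) :=
    fun A B C =>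
      ((CBundle.contMap_fst A B).comp (CBundle.contMap_fst _ C) (subset_univ _)).prodMk
      (((CBundle.contMap_snd A B).comp (CBundle.contMap_fst _ C) (subset_univ _)).prodMk
        (CBundle.contMap_snd _ C))
  have hb : ∀ (A B C : CBundle (univ : Set X)) (x : X), Function.Bijective
      (((LinearMap.fst ℂ (A.Fib x) (B.Fib x)) ∘ₗ (LinearMap.fst ℂ _ (C.Fib x))).prod
        (((LinearMap.snd ℂ (A.Fib x) (B.Fib x)) ∘ₗ (LinearMap.fst ℂ _ _)).prod
          (LinearMap.snd ℂ _ (C.Fib x)))) := fun A B C x =>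
    (Equiv.prodAssoc (A.Fib x) (B.Fib x) (C.Fib x)).bijective
  exact mk_congr (E := (E.gsum F).gsum G) (F := E.gsum (F.gsum G)) _ _ (key _ _ _) (key _ _ _)
    (hb _ _ _) (hb _ _ _) fun _ _ _ => rfl

/-- The group structure on `KF(X, Y)`. -/
@[reducible]
noncomputable def addCommGroup (X : Type u) [TopologicalSpace X] [CompactSpace X] [T2Space X]
    (Y : Set X) : AddCommGroup (KF X Y) :=
  letI : Zero (KF X Y) := ⟨mk (nullObj X).toVectorial supp_nullObj⟩
  letI : Neg (KF X Y) := ⟨fun z => (exists_add_eq_null z).choose⟩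
  { toAdd := KF.instAdd
    add_assoc := add_assoc'
    zero_add := fun z => (add_comm' _ _).trans (add_null z)
    add_zero := add_null
    nsmul := nsmulRec
    zsmul := zsmulRec
    neg_add_cancel := fun z => (add_comm' _ _).trans (exists_add_eq_null z).choose_spec
    add_comm := add_comm' }

end KF

/-! ### The comparison of `K(X, Y)` and `KF(X, Y)` -/

section Comparison

variable {X : Type u} [TopologicalSpace X] [CompactSpace X] [T2Space X] {Y : Set X}

/-- The class in `K(X, Y)` of a vectorial bundle, by means of a global representative. -/
noncomputable def RelVectorialBundle.toRel (E : RelVectorialBundle X Y) : RelKGroup X Y :=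
  RelKGroup.mk (E.1.exists_global.choose.toTriple (by
    rw [← E.1.exists_global.choose_spec.supp_eq]
    exact E.2))

theorem RelVectorialBundle.toRel_eq (hY : IsClosed Y) (E : RelVectorialBundle X Y)
    {G : HFObj (univ : Set X)} (hG : G.toVectorial.supp ∩ Y = ∅) (h : G.toVectorial.Iso E.1) :
    E.toRel = RelKGroup.mk (G.toTriple hG) :=
  HFObj.mk_toTriple_eq_of_iso hY _ hG (h.trans E.1.exists_global.choose_spec).symm

/-- The homotopy itself has a global representative, X × [0,1] being compact. Its two ends represent
E and F, and all its slices have one class in K(X, Y). -/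
theorem RelVectorialBundle.Homotopic.toRel_eq (hY : IsClosed Y) {E F : RelVectorialBundle X Y}
    (h : E.Homotopic F) : E.toRel = F.toRel := by
  obtain ⟨⟨H, hH⟩, h0, h1⟩ := h
  obtain ⟨G, hG⟩ := H.exists_global
  have hb : ∀ p ∈ Y ×ˢ (univ : Set unitInterval), G.InvertibleAt p :=
    G.supp_inter_eq_empty_iff.1 (by rwa [← hG.supp_eq])
  let S : unitInterval → HFObj (univ : Set X) := fun t => G.comap (sliceMap X t)
  have hs : ∀ t, (S t).toVectorial.supp ∩ Y = ∅ := fun t =>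
    (S t).supp_inter_eq_empty_iff.2 fun x hx => hb (x, t) ⟨hx, trivial⟩
  rw [RelVectorialBundle.toRel_eq hY E (hs 0) ((hG.symm.comap (sliceMap X 0)).trans h0),
    RelVectorialBundle.toRel_eq hY F (hs 1) ((hG.symm.comap (sliceMap X 1)).trans h1)]
  exact RelKGroup.mk_slice_eq hY (G.cont₁₀.mono (subset_univ _)) (fun p hp => (hb p hp).1) 0 1

/-- The map from `KF(X, Y)` to `K(X, Y)` taking underlying triples. -/
noncomputable def KF.toRel (hY : IsClosed Y) : KF X Y → RelKGroup X Y :=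
  Quot.lift RelVectorialBundle.toRel fun _ _ h => h.toRel_eq hY

theorem KF.toRel_mk (hY : IsClosed Y) {G : HFObj (univ : Set X)}
    (hG : G.toVectorial.supp ∩ Y = ∅) :
    KF.toRel hY (KF.mk G.toVectorial hG) = RelKGroup.mk (G.toTriple hG) :=
  RelVectorialBundle.toRel_eq hY ⟨_, hG⟩ hG (.refl _)

attribute [local instance] KF.addCommGroup

/-- The class in `KF(X, Y)` of a triple. -/
noncomputable def KTriple.toKF (hY : IsClosed Y) (T : KTriple Y) : KF X Y :=
  KF.mk (HFObj.lift hY T).toVectorial (HFObj.supp_lift hY T)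

/-- Neither the chosen extension of α nor the chosen metrics matter, by `KF.mk_congr`; f₀ and f₁
need not be isometric. -/
theorem KTriple.toKF_eq (hY : IsClosed Y) (T : KTriple Y) {G : HFObj (univ : Set X)}
    (hG : G.toVectorial.supp ∩ Y = ∅)
    {f₀ : ∀ x, T.E₀.Fib x →ₗ[ℂ] G.even.Fib x} {f₁ : ∀ x, T.E₁.Fib x →ₗ[ℂ] G.odd.Fib x}
    (h₀ : T.E₀.ContMap G.even.toCBundle univ f₀) (h₁ : T.E₁.ContMap G.odd.toCBundle univ f₁)
    (b₀ : ∀ x, Function.Bijective (f₀ x)) (b₁ : ∀ x, Function.Bijective (f₁ x))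
    (h : ∀ x ∈ Y, ∀ v, f₁ x (T.α x v) = G.h₁₀ x (f₀ x v)) :
    T.toKF hY = KF.mk G.toVectorial hG :=
  KF.mk_congr (E := HFObj.lift hY T) _ hG h₀ h₁ b₀ b₁ fun x hx v =>
    (congrArg (f₁ x) (DFunLike.congr_fun (HFObj.lift_h₁₀ hY T hx) v)).trans (h x hx v)

theorem KTriple.toKF_toTriple (hY : IsClosed Y) {G : HFObj (univ : Set X)}
    (hG : G.toVectorial.supp ∩ Y = ∅) :
    (G.toTriple hG).toKF hY = KF.mk G.toVectorial hG :=
  toKF_eq hY _ hG (G.even.contMap_id subset_rfl) (G.odd.contMap_id subset_rfl)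
    (fun _ => Function.bijective_id) (fun _ => Function.bijective_id) fun _ _ _ => rfl

/-- The homomorphism from `K(X, Y)` to `KF(X, Y)`. -/
noncomputable def RelKGroup.toKF (hY : IsClosed Y) : RelKGroup X Y →+ KF X Y :=
  QuotientAddGroup.lift _ (FreeAbelianGroup.lift (KTriple.toKF hY)) (by
    refine (AddSubgroup.closure_le _).2 ?_
    rintro z (⟨S, T, f₀, g₀, f₁, g₁, h₀, h₁, h⟩ | ⟨S, T⟩ | ⟨P⟩)
    · refine (map_sub _ _ _).trans (sub_eq_zero.2 ?_)
      rw [FreeAbelianGroup.lift_apply_of, FreeAbelianGroup.lift_apply_of]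
      refine KTriple.toKF_eq hY S _ h₀.cont_to h₁.cont_to h₀.bijective h₁.bijective
        fun x hx v => ?_
      exact (h x hx v).trans (DFunLike.congr_fun (HFObj.lift_h₁₀ hY T hx) _).symm
    · refine (map_sub _ _ _).trans (sub_eq_zero.2 ?_)
      rw [map_add, FreeAbelianGroup.lift_apply_of, FreeAbelianGroup.lift_apply_of,
        FreeAbelianGroup.lift_apply_of]
      refine Eq.trans ?_ (KF.mk_add _ _).symm
      refine KTriple.toKF_eq hY _ _ (CBundle.contMap_id _ subset_rfl)
        (CBundle.contMap_id _ subset_rfl) (fun _ => Function.bijective_id)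
        (fun _ => Function.bijective_id) fun x hx v => ?_
      exact Prod.ext (DFunLike.congr_fun (HFObj.lift_h₁₀ hY S hx) _).symm
        (DFunLike.congr_fun (HFObj.lift_h₁₀ hY T hx) _).symm
    -- The elementary triple is represented by an everywhere invertible object, whose class is zero.
    · let G : HFObj (univ : Set X) := HFObj.ofMap P.hermitian P.hermitian
        (fun _ => LinearMap.id) (P.contMap_id subset_rfl)
      have hG : ∀ x, G.InvertibleAt x := fun x =>
        G.invertibleAt_of_bijective trivial Function.bijective_id
      have hG' : G.toVectorial.supp ∩ Y = ∅ := G.supp_inter_eq_empty_iff.2 fun x _ => hG x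
      refine (FreeAbelianGroup.lift_apply_of _ _).trans (Eq.trans ?_ (KF.mk_eq_null G hG' hG))
      exact KTriple.toKF_eq hY _ _ (P.contMap_id subset_rfl)
        (P.contMap_id subset_rfl) (fun _ => Function.bijective_id)
        (fun _ => Function.bijective_id) fun _ _ _ => rfl)

theorem RelKGroup.toKF_mk (hY : IsClosed Y) (T : KTriple Y) : toKF hY (mk T) = T.toKF hY :=
  FreeAbelianGroup.lift_apply_of _ _

/-- For injectivity `KF.toRel` serves as a left inverse of mere functions; its additivity is not
needed. Surjectivity comes from global representatives. -/
theorem RelKGroup.toKF_bijective (hY : IsClosed Y) :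
    Function.Bijective (toKF hY : RelKGroup X Y →+ KF X Y) := by
  constructor
  · refine Function.LeftInverse.injective (g := KF.toRel hY) fun z => ?_
    obtain ⟨T, rfl⟩ := exists_eq_mk hY z
    rw [toKF_mk]
    exact (KF.toRel_mk hY _).trans (HFObj.mk_toTriple_lift hY T)
  · intro z
    obtain ⟨G, hG, rfl⟩ := KF.exists_eq_mk z
    exact ⟨mk (G.toTriple hG), (toKF_mk hY _).trans (KTriple.toKF_toTriple hY hG)⟩

/-- The isomorphism of `K(X, Y)` and `KF(X, Y)`. -/
noncomputable def RelKGroup.equivKF (hY : IsClosed Y) : RelKGroup X Y ≃+ KF X Y :=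
  AddEquiv.ofBijective (toKF hY) (toKF_bijective hY)

theorem RelKGroup.equivKF_toTriple (hY : IsClosed Y) {G : HFObj (univ : Set X)}
    (hG : G.toVectorial.supp ∩ Y = ∅) :
    equivKF hY (mk (G.toTriple hG)) = KF.mk G.toVectorial hG :=
  (toKF_mk hY _).trans (KTriple.toKF_toTriple hY hG)

end Comparison

/-! ### The absolute case -/

namespace KGroup

variable {X : Type u} [TopologicalSpace X]

theorem mk_eq_of_iso {E F : CBundle (univ : Set X)} (h : ∃ f g, E.IsoPair F f g) :
    mk E = mk F :=
  QuotientAddGroup.eq_iff_sub_mem.2 (AddSubgroup.subset_closure (Rel.iso E F h))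

theorem mk_gsum (E F : CBundle (univ : Set X)) : mk (E.gsum F) = mk E + mk F :=
  QuotientAddGroup.eq_iff_sub_mem.2 (AddSubgroup.subset_closure (Rel.sum E F))

theorem contMap_fst_null_bijective (E : CBundle (univ : Set X)) (x : X) :
    Function.Bijective (LinearMap.fst ℂ (E.Fib x) ((CBundle.null X).Fib x)) :=
  ⟨fun _ _ h => Prod.ext h ((KF.subsingleton_null x).elim _ _), fun v => ⟨(v, 0), rfl⟩⟩

/-- From 0 ⊕ 0 ≅ 0. -/
theorem mk_null : mk (CBundle.null X) = 0 := by
  have h := mk_eq_of_iso ⟨_, _, CBundle.IsoPair.of_bijective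
    (CBundle.contMap_fst (CBundle.null X) (CBundle.null X)) (contMap_fst_null_bijective _)⟩
  rw [mk_gsum] at h
  exact add_eq_left.1 h

/-- The difference of the bundles of a triple. -/
def _root_.RelKGroup.toKGroup : RelKGroup X (∅ : Set X) →+ KGroup X :=
  QuotientAddGroup.lift _ (FreeAbelianGroup.lift fun T => mk T.E₀ - mk T.E₁) (by
    refine (AddSubgroup.closure_le _).2 ?_
    rintro z (⟨S, T, f₀, g₀, f₁, g₁, h₀, h₁, -⟩ | ⟨S, T⟩ | ⟨P⟩)
    · refine (map_sub _ _ _).trans (sub_eq_zero.2 ?_)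
      rw [FreeAbelianGroup.lift_apply_of, FreeAbelianGroup.lift_apply_of,
        mk_eq_of_iso ⟨_, _, h₀⟩, mk_eq_of_iso ⟨_, _, h₁⟩]
    · refine (map_sub _ _ _).trans (sub_eq_zero.2 ?_)
      rw [map_add, FreeAbelianGroup.lift_apply_of, FreeAbelianGroup.lift_apply_of,
        FreeAbelianGroup.lift_apply_of]
      refine (congrArg₂ _ (mk_gsum _ _) (mk_gsum _ _)).trans ?_
      abel
    · exact (FreeAbelianGroup.lift_apply_of _ _).trans (sub_self _))

theorem _root_.RelKGroup.toKGroup_mk (T : KTriple (∅ : Set X)) :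
    RelKGroup.toKGroup (RelKGroup.mk T) = mk T.E₀ - mk T.E₁ :=
  FreeAbelianGroup.lift_apply_of _ _

/-- The triple of two bundles, relative to the empty set. -/
def pair (E F : CBundle (univ : Set X)) : KTriple (∅ : Set X) where
  E₀ := E
  E₁ := F
  α _ := 0
  cont := CBundle.contMap_zero _ _
  bij _ hx := hx.elim

/-- The class of a bundle in `K(X, ∅)`. -/
noncomputable def toRelKGroup : KGroup X →+ RelKGroup X (∅ : Set X) :=
  QuotientAddGroup.lift _
    (FreeAbelianGroup.lift fun E => RelKGroup.mk (pair E (CBundle.null X))) (by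
    refine (AddSubgroup.closure_le _).2 ?_
    rintro z (⟨E, F, f, g, h⟩ | ⟨E, F⟩)
    · refine (map_sub _ _ _).trans (sub_eq_zero.2 ?_)
      rw [FreeAbelianGroup.lift_apply_of, FreeAbelianGroup.lift_apply_of]
      exact RelKGroup.mk_eq_of_iso ⟨f, g, _, _, h, .refl _, fun _ hx => hx.elim⟩
    · refine (map_sub _ _ _).trans (sub_eq_zero.2 ?_)
      rw [map_add, FreeAbelianGroup.lift_apply_of, FreeAbelianGroup.lift_apply_of,
        FreeAbelianGroup.lift_apply_of, ← RelKGroup.mk_sum]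
      exact (RelKGroup.mk_eq_of_iso (S := (pair E (CBundle.null X)).sum (pair F (CBundle.null X)))
        (T := pair (E.gsum F) (CBundle.null X)) ⟨_, _, _, _, .refl _, .of_bijective
          (CBundle.contMap_fst (CBundle.null X) (CBundle.null X)) (contMap_fst_null_bijective _),
          fun _ hx => hx.elim⟩).symm)

theorem toRelKGroup_mk (E : CBundle (univ : Set X)) :
    toRelKGroup (mk E) = RelKGroup.mk (pair E (CBundle.null X)) :=
  FreeAbelianGroup.lift_apply_of _ _

theorem toKGroup_toRelKGroup (z : KGroup X) : RelKGroup.toKGroup (toRelKGroup z) = z := by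
  have h : (RelKGroup.toKGroup.comp toRelKGroup : KGroup X →+ KGroup X) = AddMonoidHom.id _ :=
    QuotientAddGroup.addMonoidHom_ext _ (FreeAbelianGroup.lift_ext _ _ fun E => by
      change RelKGroup.toKGroup (toRelKGroup (mk E)) = mk E
      rw [toRelKGroup_mk, RelKGroup.toKGroup_mk]
      exact (congrArg _ mk_null).trans (sub_zero _))
  exact DFunLike.congr_fun h z

theorem toRelKGroup_toKGroup (z : RelKGroup X (∅ : Set X)) :
    toRelKGroup (RelKGroup.toKGroup z) = z := by
  have h : (toRelKGroup.comp RelKGroup.toKGroup : RelKGroup X (∅ : Set X) →+ _) =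
      AddMonoidHom.id _ :=
    QuotientAddGroup.addMonoidHom_ext _ (FreeAbelianGroup.lift_ext _ _ fun T => by
      change toRelKGroup (RelKGroup.toKGroup (RelKGroup.mk T)) = RelKGroup.mk T
      -- The claim becomes [E⁰, 0] + [E¹, E¹, id] = [T] + [E¹, 0]. Over the empty set only the
      -- bundles matter, and 0 ⊕ E¹ is isomorphic to E¹ ⊕ 0 by exchange.
      rw [RelKGroup.toKGroup_mk, map_sub, toRelKGroup_mk, toRelKGroup_mk, sub_eq_iff_eq_add,
        ← RelKGroup.mk_sum, ← add_zero (RelKGroup.mk _), ← RelKGroup.mk_elem T.E₁,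
        ← RelKGroup.mk_sum]
      exact RelKGroup.mk_eq_of_iso ⟨_, _, _, _, .refl _, .swap _ _, fun _ hx => hx.elim⟩)
  exact DFunLike.congr_fun h z

/-- The identification of `K(X)` with `K(X, ∅)`. -/
noncomputable def equivRel (X : Type u) [TopologicalSpace X] :
    KGroup X ≃+ RelKGroup X (∅ : Set X) :=
  { toRelKGroup with
    invFun := RelKGroup.toKGroup
    left_inv := toKGroup_toRelKGroup
    right_inv := toRelKGroup_toKGroup }

end KGroup

theorem mainTheorem8 (X : Type u) [TopologicalSpace X] [CompactSpace X] [T2Space X] :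
    (∀ Y : Set X, IsClosed Y →
      ∃! Φ : RelKGroup X Y ≃+ KF X Y,
        ∀ (E : HFObj (univ : Set X)) (h : E.toVectorial.supp ∩ Y = ∅),
          Φ (RelKGroup.mk (E.toTriple h)) = KF.mk E.toVectorial h) ∧
    (∃! Φ : KGroup X ≃+ KF X (∅ : Set X),
      ∀ E₀ E₁ : HBundle (univ : Set X),
        Φ (KGroup.mk E₀.toCBundle - KGroup.mk E₁.toCBundle) =
          KF.mk (HFObj.ofZero E₀ E₁).toVectorial (inter_empty _)) := by
  refine ⟨fun Y hY => ⟨RelKGroup.equivKF hY, fun E h => RelKGroup.equivKF_toTriple hY h,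
    fun Φ hΦ => AddEquiv.ext fun z => ?_⟩, ?_⟩
  -- Every class is that of the underlying triple of a global object, where Φ is prescribed.
  · obtain ⟨T, rfl⟩ := RelKGroup.exists_eq_mk hY z
    rw [← HFObj.mk_toTriple_lift hY T, hΦ, RelKGroup.equivKF_toTriple]
  · have key : ∀ E₀ E₁ : HBundle (univ : Set X),
        RelKGroup.toKGroup (RelKGroup.mk ((HFObj.ofZero E₀ E₁).toTriple (inter_empty _))) =
          KGroup.mk E₀.toCBundle - KGroup.mk E₁.toCBundle := fun _ _ => RelKGroup.toKGroup_mk _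
    refine ⟨(KGroup.equivRel X).trans (RelKGroup.equivKF isClosed_empty), fun E₀ E₁ => ?_,
      fun Φ hΦ => AddEquiv.ext fun z => ?_⟩
    · rw [← key, AddEquiv.trans_apply]
      refine (congrArg (RelKGroup.equivKF isClosed_empty)
        (KGroup.toRelKGroup_toKGroup
          (RelKGroup.mk ((HFObj.ofZero E₀ E₁).toTriple (inter_empty _))))).trans ?_
      exact RelKGroup.equivKF_toTriple isClosed_empty _
    -- Likewise z is a difference of two bundles, on which any choice of metrics makes the condition
    -- on Φ applicable.
    · obtain ⟨T, hT⟩ := RelKGroup.exists_eq_mk isClosed_empty (KGroup.toRelKGroup z)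
      have hz : z = KGroup.mk T.E₀ - KGroup.mk T.E₁ := by
        rw [← RelKGroup.toKGroup_mk, ← hT, KGroup.toKGroup_toRelKGroup]
      rw [hz]
      refine (hΦ T.E₀.hermitian T.E₁.hermitian).trans ?_
      rw [AddEquiv.trans_apply]
      refine Eq.symm (Eq.trans (congrArg (RelKGroup.equivKF isClosed_empty) ?_)
        (RelKGroup.equivKF_toTriple isClosed_empty
        (G := HFObj.ofZero T.E₀.hermitian T.E₁.hermitian) (inter_empty _)))
      exact (congrArg KGroup.toRelKGroup (key T.E₀.hermitian T.E₁.hermitian).symm).trans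
        (KGroup.toRelKGroup_toKGroup _)
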